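/- **Setting.** Let $\overline M$ be a smooth manifold of dimension $2n\ge 4$ with a Kähler–Norden structure: a smooth almost complex structure $J$ ($J^2=-\mathrm{id}$) and a smooth semi-Riemannian metric $\overline g$ with $\overline g(JX,JY)=-\overline g(X,Y)$ and $\overline\nabla J=0$, where $\overline\nabla$ is the Levi-Civita connection of $\overline g$. Let $\overline{\widetilde g}(X,Y)=\overline g(JX,Y)$ be the associated Norden metric; its Levi-Civita connection is also $\overline\nabla$. Suppose that $\overline M$ has constant totally real sectional curvatures with respect to $\overline g$, i.e. there are functions $\overline\nu,\overline{\widetilde\nu}:\overline M\to\mathbb R$ such that, for the curvature tensor $\overline R$ of $\overline\nabla$, $$\frac{\overline g(\overline R(x,y)y,x)}{\overline g(x,x)\overline g(y,y)-\overline g(x,y)^2}=\overline\nu(p),\qquad \frac{\overline g(\overline R(x,y)y,Jx)}{\overline g(x,x)\overline g(y,y)-\overline g(x,y)^2}=\overline{\widetilde\nu}(p)$$ for every $p\in\overline M$ and all $x,y\in T_p\overline M$ spanning a $\overline g$-non-degenerate plane $\alpha$ with $J\alpha$ $\overline g$-orthogonal to $\alpha$. Let $M$ be an (immersed) hypersurface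 of $\overline M$, and let $\overline h$ be one of $\overline g$, $\overline{\widetilde g}$, with induced form $h$ on $M$. $(M,h)$ is lightlike if $T_pM\cap T_pM^\perp\ne 0$ for all $p$, where $\perp$ is taken with respect to $\overline h$. A screen distribution $S(TM)$ is a smooth distribution, non-degenerate for $h$ and complementary to $\mathrm{Rad}\,TM = TM\cap TM^{\perp}$ in $TM$. A null pair on an open $U\subset M$ consists of a smooth section $\xi$ of $\mathrm{Rad}\,TM$ and a smooth section $N$ of $T\overline M|_M$ over $U$ with $\overline h(N,\xi)=1$ and $\overline h(N,N)=\overline h(N,W)=0$ for all $W\in S(TM)$; such $N$ locally span the transversal bundle $\mathrm{tr}(TM)$. $(M,h)$, with its screen, is radical transversal if $J(TM^\perp)=\mathrm{tr}(TM)$; then $J\xi=bN$ with a nowhere vanishing function $b$ on $U$. The Gauss formula $\overline\nabla_XY=\nabla_XY+B(X,Y)N$ ($X,Y$ tangent to $M$, $\nabla_XY$ tangent to $M$) defines the induced connection $\nabla$ on $M$ and the local second fundamental form $B$. $(M,h)$ is totally umbilical if every point of $M$ has an open neighbourhood $U$ with a null pair and a smooth function $\rho$ on $U$ such that $B=\rho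 h$ on $U$. (The function $\rho^2/b$ does not depend on the choice of the null pair.) Let $R$ be the curvature tensor of $\nabla$ and $\mathrm{Ric}(X,Y)=\mathrm{trace}\{Z\mapsto R(X,Z)Y\}$. For tangent $X,Y$ let $R(X,Y)$ act on tensors as a derivation. $(M,h)$ is called semi-symmetric if $R(X,Y)\cdot R=0$ for all $X,Y$, Ricci semi-symmetric if $R(X,Y)\cdot \mathrm{Ric}=0$ for all $X,Y$, locally symmetric if $\nabla R=0$, and almost Einstein if $\mathrm{Ric}=kg+c\widetilde g$ for some constants $k,c\in\mathbb R$, where $g,\widetilde g$ are induced on $M$ by $\overline g,\overline{\widetilde g}$. **Theorem 1.1.** (a) Let $(M,g)$ be a totally umbilical radical transversal lightlike hypersurface of $\overline M$, and suppose that $\overline{\widetilde\nu}$ vanishes nowhere. Then the following are equivalent: (i) $(M,g)$ is semi-symmetric; (ii) $(M,g)$ is Ricci semi-symmetric; (iii) $\overline{\widetilde\nu}=\rho^2/b$ along $M$, for all local null pairs and the corresponding functions $\rho$, $b$. If moreover $\overline{\widetilde\nu}$ is constant, then (i), (ii), (iii) are also equivalent to each of: (iv) $(M,g)$ is locally symmetric;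 (v) $(M,g)$ is almost Einstein. (b) Let $(M,\widetilde g)$ be a totally umbilical radical transversal lightlike hypersurface of $\overline M$, where all notions (null pair $\xi,N$, $J\xi=\widetilde bN$, $\widetilde B=\widetilde\rho\,\widetilde g$, induced connection, $R$, $\mathrm{Ric}$) are formed with $\overline{\widetilde g}$ in place of $\overline g$, and suppose that $\overline\nu$ (which is still defined with respect to $\overline g$) vanishes nowhere. Then the same statements hold for $(M,\widetilde g)$, with (iii) replaced by $\overline\nu=\widetilde\rho^{\,2}/\widetilde b$ along $M$ and the assumption that $\overline{\widetilde\nu}$ is constant replaced by the assumption that $\overline\nu$ is constant. -/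

import Mathlib

open scoped Manifold ContDiff Topology
open Bundle Set Module

noncomputable section

/-! ## Vector fields, curvature and Ricci tensor of an affine connection -/

section Connection

variable {F : Type*} [NormedAddCommGroup F] [NormedSpace ℝ F]
  {M : Type*} [TopologicalSpace M] [ChartedSpace F M]

/-- An operator `Y ↦ (x ↦ ∇_x Y)` on vector fields; it sends a vector field `Y`, a point `p` and
a vector `x` at `p` to `(∇_x Y)(p)`. -/
abbrev FieldOperator (F M : Type*) [NormedAddCommGroup F] [NormedSpace ℝ F]
    [TopologicalSpace M] [ChartedSpace F M] :=
  (Π p : M, TangentSpace 𝓘(ℝ, F) p) →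
    Π p : M, TangentSpace 𝓘(ℝ, F) p → TangentSpace 𝓘(ℝ, F) p

/-- `R(X,Y)Z = ∇_X ∇_Y Z - ∇_Y ∇_X Z - ∇_{[X,Y]} Z` for vector fields `X`, `Y`, `Z`. -/
def curvatureOfFields (D : FieldOperator F M) (X Y Z : Π p : M, TangentSpace 𝓘(ℝ, F) p) (p : M) :
    TangentSpace 𝓘(ℝ, F) p :=
  D (fun q => D Z q (Y q)) p (X p) - D (fun q => D Z q (X q)) p (Y p)
    - D Z p (VectorField.mlieBracket 𝓘(ℝ, F) X Y p)

variable [IsManifold 𝓘(ℝ, F) ∞ M]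

/-- The vector field `X` is smooth on the set `U`. -/
def SmoothFieldOn (X : Π p : M, TangentSpace 𝓘(ℝ, F) p) (U : Set M) : Prop :=
  ContMDiffOn 𝓘(ℝ, F) 𝓘(ℝ, F).tangent ∞
    (fun p => (⟨p, X p⟩ : TotalSpace F (TangentSpace 𝓘(ℝ, F) : M → Type _))) U

/-- The curvature tensor `R(x,y,z) = R(x,y)z` on tangent vectors at `p`. The vectors are extended
to vector fields that are smooth near `p`; for a connection, `R` does not depend on the
extension. -/
def curvatureTensor (D : FieldOperator F M) (p : M) (x y z : TangentSpace 𝓘(ℝ, F) p) :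
    TangentSpace 𝓘(ℝ, F) p :=
  curvatureOfFields D (FiberBundle.extend F x) (FiberBundle.extend F y)
    (FiberBundle.extend F z) p

/-- The induced Ricci type tensor `R^{(0,2)}(x,y) = trace (z ↦ R(x,z)y)`; the trace is computed
in a basis of the tangent space. -/
def ricciTensor [FiniteDimensional ℝ F] (D : FieldOperator F M) (p : M)
    (x y : TangentSpace 𝓘(ℝ, F) p) : ℝ :=
  let e : Basis (Fin (finrank ℝ F)) ℝ (TangentSpace 𝓘(ℝ, F) p) := finBasis ℝ F
  ∑ i, e.repr (curvatureTensor D p x (e i) y) i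

/-- Semi-symmetry: `R(X,Y) · R = 0`, where `R(X,Y)` acts on `R` as a derivation. -/
def SemiSymmetric (D : FieldOperator F M) : Prop :=
  ∀ (p : M) (x y u v w : TangentSpace 𝓘(ℝ, F) p),
    curvatureTensor D p x y (curvatureTensor D p u v w)
      - curvatureTensor D p u v (curvatureTensor D p x y w)
      - curvatureTensor D p (curvatureTensor D p x y u) v w
      - curvatureTensor D p u (curvatureTensor D p x y v) w = 0

/-- Ricci semi-symmetry: `R(X,Y) · Ric = 0`. -/
def RicciSemiSymmetric [FiniteDimensional ℝ F] (D : FieldOperator F M) : Prop :=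
  ∀ (p : M) (x y x₁ x₂ : TangentSpace 𝓘(ℝ, F) p),
    -ricciTensor D p (curvatureTensor D p x y x₁) x₂
      - ricciTensor D p x₁ (curvatureTensor D p x y x₂) = 0

/-- Local symmetry: `∇ R = 0`, that is,
`∇_U (R(X,Y)Z) - R(∇_U X,Y)Z - R(X,∇_U Y)Z - R(X,Y)∇_U Z = 0` for smooth vector fields. -/
def LocallySymmetric (D : FieldOperator F M) : Prop :=
  ∀ U X Y Z : (Π p : M, TangentSpace 𝓘(ℝ, F) p),
    SmoothFieldOn U univ → SmoothFieldOn X univ → SmoothFieldOn Y univ → SmoothFieldOn Z univ →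
    ∀ p : M,
      D (fun q => curvatureTensor D q (X q) (Y q) (Z q)) p (U p)
        - curvatureTensor D p (D X p (U p)) (Y p) (Z p)
        - curvatureTensor D p (X p) (D Y p (U p)) (Z p)
        - curvatureTensor D p (X p) (Y p) (D Z p (U p)) = 0

end Connection

/-! ## Kähler-Norden manifolds -/

section KaehlerNorden

variable {E : Type*} [NormedAddCommGroup E] [NormedSpace ℝ E] [FiniteDimensional ℝ E]
  [CompleteSpace E]
  {B : Type*} [TopologicalSpace B] [ChartedSpace E B] [IsManifold 𝓘(ℝ, E) ∞ B]

/-- `D` is the Levi-Civita connection of the symmetric bilinear form field `h`: it is torsion-free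
and `v(h(Y,Z)) = h(∇_v Y,Z) + h(Y,∇_v Z)`. -/
structure IsLeviCivita
    (h : Π p : B, TangentSpace 𝓘(ℝ, E) p →L[ℝ] TangentSpace 𝓘(ℝ, E) p →L[ℝ] ℝ)
    (D : CovariantDerivative 𝓘(ℝ, E) E (TangentSpace 𝓘(ℝ, E) : B → Type _)) : Prop where
  torsion_free : D.torsion = 0
  metric : ∀ (Y Z : Π p : B, TangentSpace 𝓘(ℝ, E) p) (p : B) (v : TangentSpace 𝓘(ℝ, E) p),
    MDiffAt (T% Y) p → MDiffAt (T% Z) p →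
    mvfderiv 𝓘(ℝ, E) (fun q => h q (Y q) (Z q)) p v =
      h p (D Y p v) (Z p) + h p (Y p) (D Z p v)

variable (E B) in
/-- A Kähler-Norden structure: a smooth almost complex structure `J`, a smooth semi-Riemannian
metric `g` for which `J` is an anti-isometry (a Norden metric), and the Levi-Civita connection
`nabla` of `g`, for which `J` is parallel. -/
structure KaehlerNorden where
  /-- the almost complex structure -/
  J : Π p : B, TangentSpace 𝓘(ℝ, E) p →L[ℝ] TangentSpace 𝓘(ℝ, E) p
  /-- the Norden metric -/
  g : Π p : B, TangentSpace 𝓘(ℝ, E) p →L[ℝ] TangentSpace 𝓘(ℝ, E) p →L[ℝ] ℝ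
  /-- the Levi-Civita connection of `g` -/
  nabla : CovariantDerivative 𝓘(ℝ, E) E (TangentSpace 𝓘(ℝ, E) : B → Type _)
  J_smooth : ContMDiff 𝓘(ℝ, E) (𝓘(ℝ, E).prod 𝓘(ℝ, E →L[ℝ] E)) ∞
    (fun p => TotalSpace.mk' (E →L[ℝ] E) p (J p))
  g_smooth : ContMDiff 𝓘(ℝ, E) (𝓘(ℝ, E).prod 𝓘(ℝ, E →L[ℝ] E →L[ℝ] ℝ)) ∞
    (fun p => TotalSpace.mk' (E →L[ℝ] E →L[ℝ] ℝ) p (g p))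
  g_symm : ∀ p x y, g p x y = g p y x
  g_nondegenerate : ∀ p x, (∀ y, g p x y = 0) → x = 0
  J_sq : ∀ p x, J p (J p x) = -x
  norden : ∀ p x y, g p (J p x) (J p y) = -g p x y
  leviCivita : IsLeviCivita g nabla
  J_parallel : ∀ (Y : Π p : B, TangentSpace 𝓘(ℝ, E) p) (p : B) (v : TangentSpace 𝓘(ℝ, E) p),
    MDiffAt (T% Y) p → nabla (fun q => J q (Y q)) p v = J p (nabla Y p v)

namespace KaehlerNorden

variable (K : KaehlerNorden E B)

/-- The associated Norden metric `(x,y) ↦ g(Jx,y)`. -/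
def assoc (p : B) : TangentSpace 𝓘(ℝ, E) p →L[ℝ] TangentSpace 𝓘(ℝ, E) p →L[ℝ] ℝ :=
  (K.g p).comp (K.J p)

/-- The Levi-Civita connections of the two Norden metrics coincide. -/
theorem isLeviCivita_assoc : IsLeviCivita K.assoc K.nabla where
  torsion_free := K.leviCivita.torsion_free
  metric Y Z p v hY hZ := by
    have hJ : MDiffAt (T% (fun q => K.J q (Y q))) p := by
      have h1 := (K.J_smooth p).mdifferentiableAt (by simp)
      exact h1.clm_bundle_apply hY
    have := K.leviCivita.metric (fun q => K.J q (Y q)) Z p v hJ hZ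
    rw [K.J_parallel Y p v hY] at this
    exact this

/-- The curvature tensor of the Levi-Civita connection. -/
def curvature (p : B) (x y z : TangentSpace 𝓘(ℝ, E) p) : TangentSpace 𝓘(ℝ, E) p :=
  curvatureTensor (fun Y q v => K.nabla Y q v) p x y z

/-- `π₁(x,y,y,x) = g(x,x) g(y,y) - g(x,y)²`; it is non-zero exactly when `x`, `y` span a
plane that is non-degenerate with respect to `g`. -/
def gram (p : B) (x y : TangentSpace 𝓘(ℝ, E) p) : ℝ :=
  K.g p y y * K.g p x x - K.g p x y * K.g p y x

/-- For every point `p` and every non-degenerate totally real plane `α = span {x, y}` at `p`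
(`Jα` is `g`-orthogonal to `α`), the sectional curvatures `R(x,y,y,x) / π₁(x,y,y,x)` and
`R(x,y,y,Jx) / π₁(x,y,y,x)` equal `ν p` and `νt p`. -/
def HasConstantTotallyRealCurvatures (ν νt : B → ℝ) : Prop :=
  ∀ (p : B) (x y : TangentSpace 𝓘(ℝ, E) p), K.gram p x y ≠ 0 →
    K.g p (K.J p x) x = 0 → K.g p (K.J p x) y = 0 → K.g p (K.J p y) x = 0 →
    K.g p (K.J p y) y = 0 →
    K.g p (K.curvature p x y y) x / K.gram p x y = ν p ∧
    K.g p (K.curvature p x y y) (K.J p x) / K.gram p x y = νt p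

end KaehlerNorden

end KaehlerNorden

/-! ## Lightlike hypersurfaces -/

section Hypersurface

variable {E : Type*} [NormedAddCommGroup E] [NormedSpace ℝ E] [FiniteDimensional ℝ E]
  {B : Type*} [TopologicalSpace B] [ChartedSpace E B] [IsManifold 𝓘(ℝ, E) ∞ B]
  {F : Type*} [NormedAddCommGroup F] [NormedSpace ℝ F]
  {M : Type*} [TopologicalSpace M] [ChartedSpace F M] [IsManifold 𝓘(ℝ, F) ∞ M]

/-- A smooth immersion. -/
structure IsSmoothImmersion (F E : Type*) [NormedAddCommGroup F] [NormedSpace ℝ F]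
    [NormedAddCommGroup E] [NormedSpace ℝ E]
    {M : Type*} [TopologicalSpace M] [ChartedSpace F M]
    {B : Type*} [TopologicalSpace B] [ChartedSpace E B] (f : M → B) : Prop where
  smooth : ContMDiff 𝓘(ℝ, F) 𝓘(ℝ, E) ∞ f
  injective : ∀ p, Function.Injective (mfderiv 𝓘(ℝ, F) 𝓘(ℝ, E) f p)

/-- The vector field `V` along `f` (a section of the restriction of the ambient tangent bundle
to the hypersurface) is smooth on `U`. -/
def SmoothAlongOn (f : M → B) (V : Π p : M, TangentSpace 𝓘(ℝ, E) (f p)) (U : Set M) : Prop :=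
  ContMDiffOn 𝓘(ℝ, F) 𝓘(ℝ, E).tangent ∞
    (fun p => (⟨f p, V p⟩ : TotalSpace E (TangentSpace 𝓘(ℝ, E) : B → Type _))) U

/-- The covariant derivative `∇_v V` of a vector field `V` along `f` in the direction of a vector
`v` tangent to `M`. In terms of a local frame `e_i` of the ambient tangent bundle near `f p`, with
`V = ∑ V^i (e_i ∘ f)`, it is `∑ (v(V^i) e_i + V^i ∇_{df v} e_i)`. -/
def covAlong (D : CovariantDerivative 𝓘(ℝ, E) E (TangentSpace 𝓘(ℝ, E) : B → Type _)) (f : M → B)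
    (V : Π p : M, TangentSpace 𝓘(ℝ, E) (f p)) (p : M) (v : TangentSpace 𝓘(ℝ, F) p) :
    TangentSpace 𝓘(ℝ, E) (f p) :=
  let t := trivializationAt E (TangentSpace 𝓘(ℝ, E) : B → Type _) (f p)
  let e := finBasis ℝ E
  ∑ i, (mvfderiv 𝓘(ℝ, F) (fun q => t.localFrameCoeff 𝓘(ℝ, E) e i (f q) (V q)) p v •
        t.localFrame e i (f p)
      + t.localFrameCoeff 𝓘(ℝ, E) e i (f p) (V p) •
        D (t.localFrame e i) (f p) (mfderiv 𝓘(ℝ, F) 𝓘(ℝ, E) f p v))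

variable (h : Π p : B, TangentSpace 𝓘(ℝ, E) p →L[ℝ] TangentSpace 𝓘(ℝ, E) p →L[ℝ] ℝ) (f : M → B)

/-- The (possibly degenerate) metric induced on `M` by the ambient metric `h`. -/
def inducedMetric (p : M) (x y : TangentSpace 𝓘(ℝ, F) p) : ℝ :=
  h (f p) (mfderiv 𝓘(ℝ, F) 𝓘(ℝ, E) f p x) (mfderiv 𝓘(ℝ, F) 𝓘(ℝ, E) f p y)

/-- The normal space `T_pM^⊥` in the ambient tangent space. -/
def normalSpace (p : M) : Submodule ℝ (TangentSpace 𝓘(ℝ, E) (f p)) where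
  carrier := {u | ∀ w : TangentSpace 𝓘(ℝ, F) p,
    h (f p) u (mfderiv 𝓘(ℝ, F) 𝓘(ℝ, E) f p w) = 0}
  zero_mem' := by intro w; simp
  add_mem' := by intro a b ha hb w; simp [ha w, hb w]
  smul_mem' := by intro c a ha w; simp [ha w]

/-- The radical `Rad T_pM = T_pM ∩ T_pM^⊥`, as a subspace of `T_pM`. -/
def radical (p : M) : Submodule ℝ (TangentSpace 𝓘(ℝ, F) p) :=
  (normalSpace (F := F) h f p).comap (mfderiv 𝓘(ℝ, F) 𝓘(ℝ, E) f p).toLinearMap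

/-- `M` is lightlike: the tangent and the normal space meet non-trivially at every point. -/
def IsLightlike : Prop := ∀ p : M, radical (F := F) h f p ≠ ⊥

/-- `S` is a screen distribution: a smooth distribution, complementary to the radical in `TM`,
on which the induced metric is non-degenerate. -/
structure IsScreen (S : Π p : M, Submodule ℝ (TangentSpace 𝓘(ℝ, F) p)) : Prop where
  isCompl : ∀ p, IsCompl (S p) (radical h f p)
  nondegenerate : ∀ p, ∀ x ∈ S p, (∀ y ∈ S p, inducedMetric h f p x y = 0) → x = 0
  smooth : ∀ p, ∃ U : Set M, IsOpen U ∧ p ∈ U ∧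
    ∃ (m : ℕ) (e : Fin m → Π q : M, TangentSpace 𝓘(ℝ, F) q),
      (∀ i, SmoothFieldOn (e i) U) ∧ ∀ q ∈ U, S q = Submodule.span ℝ (range fun i => e i q)

variable (S : Π p : M, Submodule ℝ (TangentSpace 𝓘(ℝ, F) p))

/-- `ξ ∈ Rad T_pM` and the ambient vector `N` satisfy `h(N,ξ) = 1`, `h(N,N) = 0` and `h(N,W) = 0`
for all `W` in the screen. -/
structure IsNullPairAt (p : M) (ξ : TangentSpace 𝓘(ℝ, F) p)
    (N : TangentSpace 𝓘(ℝ, E) (f p)) : Prop where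
  mem_radical : ξ ∈ radical h f p
  pairing : h (f p) N (mfderiv 𝓘(ℝ, F) 𝓘(ℝ, E) f p ξ) = 1
  null : h (f p) N N = 0
  orthogonal : ∀ w ∈ S p, h (f p) N (mfderiv 𝓘(ℝ, F) 𝓘(ℝ, E) f p w) = 0

/-- The fibre at `p` of the transversal bundle `tr(TM)` determined by the screen `S`. -/
def transversalSpace (p : M) : Submodule ℝ (TangentSpace 𝓘(ℝ, E) (f p)) :=
  Submodule.span ℝ {N | ∃ ξ, IsNullPairAt h f S p ξ N}

open Classical in
/-- The induced connection on `M`, given by the Gauss formula: `∇_x Y` is the tangential part of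
the ambient derivative of `Y` along `x`, with respect to the splitting of the ambient tangent
space as `T_pM ⊕ tr(TM)_p`. -/
def inducedConnection (D : CovariantDerivative 𝓘(ℝ, E) E (TangentSpace 𝓘(ℝ, E) : B → Type _)) :
    FieldOperator F M := fun Y p x =>
  if hu : ∃ u : TangentSpace 𝓘(ℝ, F) p,
      covAlong D f (fun q => mfderiv 𝓘(ℝ, F) 𝓘(ℝ, E) f q (Y q)) p x
        - mfderiv 𝓘(ℝ, F) 𝓘(ℝ, E) f p u ∈ transversalSpace h f S p
  then hu.choose else 0

/-- The local second fundamental form `B(x,y) = h(∇_x Y, ξ)` (with `Y` any extension of `y`), the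
coefficient of `N` in the Gauss formula for a null pair `ξ`, `N`. -/
def secondFundamentalForm
    (D : CovariantDerivative 𝓘(ℝ, E) E (TangentSpace 𝓘(ℝ, E) : B → Type _))
    (ξ : Π p : M, TangentSpace 𝓘(ℝ, F) p) (p : M) (x y : TangentSpace 𝓘(ℝ, F) p) : ℝ :=
  h (f p) (covAlong D f (fun q => mfderiv 𝓘(ℝ, F) 𝓘(ℝ, E) f q (FiberBundle.extend F y q)) p x)
    (mfderiv 𝓘(ℝ, F) 𝓘(ℝ, E) f p (ξ p))

/-- On the open set `U`, the smooth fields `ξ`, `N` form a null pair and the smooth function `ρ`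
satisfies `B = ρ g` for the second fundamental form `B` belonging to `ξ`. -/
structure IsUmbilicalOn
    (D : CovariantDerivative 𝓘(ℝ, E) E (TangentSpace 𝓘(ℝ, E) : B → Type _)) (U : Set M)
    (ξ : Π p : M, TangentSpace 𝓘(ℝ, F) p) (N : Π p : M, TangentSpace 𝓘(ℝ, E) (f p))
    (ρ : M → ℝ) : Prop where
  isOpen : IsOpen U
  smooth_xi : SmoothFieldOn ξ U
  smooth_N : SmoothAlongOn (F := F) f N U
  nullPair : ∀ p ∈ U, IsNullPairAt h f S p (ξ p) (N p)
  smooth_rho : ContMDiffOn 𝓘(ℝ, F) 𝓘(ℝ, ℝ) ∞ ρ U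
  umbilical : ∀ p ∈ U, ∀ x y : TangentSpace 𝓘(ℝ, F) p,
    secondFundamentalForm h f D ξ p x y = ρ p * inducedMetric h f p x y

/-- `(M, h, S)` is a totally umbilical radical transversal lightlike hypersurface, immersed by `f`:
`J(TM^⊥) = tr(TM)`, and locally `B = ρ g`. -/
structure IsUmbilicalRadicalTransversal
    (J : Π p : B, TangentSpace 𝓘(ℝ, E) p →L[ℝ] TangentSpace 𝓘(ℝ, E) p)
    (D : CovariantDerivative 𝓘(ℝ, E) E (TangentSpace 𝓘(ℝ, E) : B → Type _)) : Prop where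
  lightlike : IsLightlike (F := F) h f
  screen : IsScreen h f S
  radicalTransversal : ∀ p : M,
    (normalSpace (F := F) h f p).map (J (f p)).toLinearMap = transversalSpace h f S p
  umbilical : ∀ p : M, ∃ U ξ N ρ, p ∈ U ∧ IsUmbilicalOn h f S D U ξ N ρ

/-- `κ = ρ² / b` along `M`: for every local null pair `ξ`, `N` with umbilicity factor `ρ`
and every function `b` with `Jξ = b N`. -/
def CurvatureEqSqDiv
    (J : Π p : B, TangentSpace 𝓘(ℝ, E) p →L[ℝ] TangentSpace 𝓘(ℝ, E) p)
    (D : CovariantDerivative 𝓘(ℝ, E) E (TangentSpace 𝓘(ℝ, E) : B → Type _)) (κ : B → ℝ) : Prop :=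
  ∀ U ξ N ρ, IsUmbilicalOn h f S D U ξ N ρ →
    ∀ b : M → ℝ, (∀ p ∈ U, J (f p) (mfderiv 𝓘(ℝ, F) 𝓘(ℝ, E) f p (ξ p)) = b p • N p) →
    ∀ p ∈ U, κ (f p) = ρ p ^ 2 / b p

/-- `Ric = k g + c g̃` with constants `k`, `c`, where `Ric` is the Ricci tensor of the connection
`D` on `M`, and `g`, `g̃` are induced by the two Norden metrics. -/
def AlmostEinstein [FiniteDimensional ℝ F] [CompleteSpace E] (K : KaehlerNorden E B)
    (D : FieldOperator F M) : Prop :=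
  ∃ k c : ℝ, ∀ (p : M) (x y : TangentSpace 𝓘(ℝ, F) p),
    ricciTensor D p x y = k * inducedMetric K.g f p x y + c * inducedMetric K.assoc f p x y

end Hypersurface

end

/-! # Symmetric radical transversal lightlike hypersurfaces

Both Norden metrics are treated at once: the argument is carried out for a triple `(h, J, D)`
(`IsKaehlerNorden`) and applied to `g` and to `g̃`. Write `h̃ = h(J·, ·)`, let `κ` be the sectional
curvature that is assumed not to vanish and `ν` the other one (with a sign in the case of `g̃`).

*The ambient curvature.* A tangent space of the ambient manifold is the complexification of a
totally real subspace on which `h` is definite. On it the sectional values of the curvature are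
known, and as `J` is parallel they determine the whole tensor
(`curvature_eq_of_totallyReal_const`): `R̄` is a combination, with coefficients `ν` and `κ`, of two
explicit tensors in `h` and `J` (`HasCurvatureForm`).

*The hypersurface.* Radical transversality makes the tangential part `φ` of `J` a complex structure
on the screen, with kernel spanned by `ξ` (`IsRadicalFrame`). Differentiating `Jξ = bN` shows that
the Weingarten operator of `N` is `(ρ/b) J` up to multiples of `N`. Hence by the Gauss equation the
induced curvature is
`R(X,Y)Z = -κ (h̃(Y,Z) X - h̃(X,Z) Y) + μ (h(Y,Z) φX - h(X,Z) φY)` with `μ = ρ²/b - κ`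
(`curvatureTensor_eq`), whereas the Codazzi equation in the direction of `ξ` gives `ν = 0` along the
hypersurface and `dρ(ξ) - ρ α(ξ) = -κ b` (`curvature_constants`). The condition on `ρ²/b` says that
`μ = 0`.

*The equivalences.* If `μ = 0`, then `R` is the curvature-like tensor of the form `h̃`, which is
parallel for the induced connection (`mvfderiv_inducedTwin`), and the Ricci tensor is a multiple of
`h̃`; all the symmetry conditions follow, those on constants if `κ` is constant. Conversely,
semi-symmetry, Ricci semi-symmetry and the almost Einstein condition give `μ = 0` pointwise, by
evaluation on `ξ` and on screen vectors. Local symmetry gives only `μ ρ = 0`, as the induced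
connection fails to be metric by a term with the factor `ρ` (`mvfderiv_inducedMetric`); if `μ ≠ 0`
at a point, then `ρ = 0` nearby, so that `0 = -κ b` by the Codazzi equation, which is absurd. -/

noncomputable section

/-! ### Derivatives of vector-valued functions and the Lie bracket -/

section VectorValued

variable {F : Type*} [NormedAddCommGroup F] [NormedSpace ℝ F]
  {M : Type*} [TopologicalSpace M] [ChartedSpace F M]
  {V W : Type*} [NormedAddCommGroup V] [NormedSpace ℝ V] [NormedAddCommGroup W] [NormedSpace ℝ W]

/-- In the chart at `p`, the differential of a vector-valued function is its Fréchet derivative. -/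
lemma hasFDerivAt_writtenInExtChartAt {u : M → V} {p : M} (hu : MDiffAt u p) :
    HasFDerivAt (u ∘ (extChartAt 𝓘(ℝ, F) p).symm) (mvfderiv 𝓘(ℝ, F) u p : F →L[ℝ] V)
      (extChartAt 𝓘(ℝ, F) p p) := by
  have h := hu.hasMFDerivAt.2
  simp only [modelWithCornersSelf_coe, range_id] at h
  exact hasFDerivWithinAt_univ.1 h

lemma mvfderiv_eq_of_hasFDerivAt {u : M → V} {p : M} {L : F →L[ℝ] V} (hu : ContinuousAt u p)
    (h : HasFDerivAt (u ∘ (extChartAt 𝓘(ℝ, F) p).symm) L (extChartAt 𝓘(ℝ, F) p p)) :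
    (mvfderiv 𝓘(ℝ, F) u p : F →L[ℝ] V) = L := by
  have h' : HasMFDerivAt 𝓘(ℝ, F) 𝓘(ℝ, V) u p L :=
    ⟨hu, by rw [modelWithCornersSelf_coe, range_id]; exact hasFDerivWithinAt_univ.2 h⟩
  exact h'.mfderiv

lemma mvfderiv_congr {u v : M → V} {p : M} (h : u =ᶠ[𝓝 p] v) :
    mvfderiv 𝓘(ℝ, F) u p = mvfderiv 𝓘(ℝ, F) v p := by
  have := h.mfderiv_eq (I := 𝓘(ℝ, F)) (I' := 𝓘(ℝ, V))
  have h2 := h.eq_of_nhds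
  ext x
  exact congrArg (fun L : F →L[ℝ] V => L x) this

lemma mvfderiv_clm_apply {L : M → V →L[ℝ] W} {u : M → V} {p : M} (hL : MDiffAt L p)
    (hu : MDiffAt u p) (x : TangentSpace 𝓘(ℝ, F) p) :
    mvfderiv 𝓘(ℝ, F) (fun q => L q (u q)) p x =
      mvfderiv 𝓘(ℝ, F) L p x (u p) + L p (mvfderiv 𝓘(ℝ, F) u p x) := by
  have h := (hasFDerivAt_writtenInExtChartAt hL).clm_apply (hasFDerivAt_writtenInExtChartAt hu)
  have h3 := mvfderiv_eq_of_hasFDerivAt (u := fun q => L q (u q)) (p := p)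
    (hL.continuousAt.clm_apply hu.continuousAt) h
  have h4 := congrArg (fun L : F →L[ℝ] W => L x) h3
  simp only [Function.comp_apply, extChartAt_to_inv] at h4
  exact h4.trans (add_comm _ _)

lemma mvfderiv_clm_comp (L : V →L[ℝ] W) {u : M → V} {p : M}
    (hu : MDiffAt u p) (x : TangentSpace 𝓘(ℝ, F) p) :
    mvfderiv 𝓘(ℝ, F) (fun q => L (u q)) p x = L (mvfderiv 𝓘(ℝ, F) u p x) := by
  have := mvfderiv_clm_apply (L := fun _ => L) mdifferentiableAt_const hu x
  rw [this, mvfderiv_const]; simp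

lemma mvfderiv_finsetSum {ι : Type*} {u : ι → M → V} {p : M} (s : Finset ι)
    (hu : ∀ i ∈ s, MDiffAt (u i) p) :
    mvfderiv 𝓘(ℝ, F) (fun q => ∑ i ∈ s, u i q) p = ∑ i ∈ s, mvfderiv 𝓘(ℝ, F) (u i) p := by
  have h := HasFDerivAt.fun_sum (fun i hi => hasFDerivAt_writtenInExtChartAt (hu i hi))
  refine mvfderiv_eq_of_hasFDerivAt ?_ h
  exact tendsto_finsetSum _ fun i hi => (hu i hi).continuousAt

/-- The chain rule for a vector-valued function on the target manifold. -/
lemma mvfderiv_comp_map {E : Type*} [NormedAddCommGroup E] [NormedSpace ℝ E]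
    {B : Type*} [TopologicalSpace B] [ChartedSpace E B] {u : B → V} {f : M → B} {p : M}
    (hu : MDiffAt u (f p)) (hf : MDifferentiableAt 𝓘(ℝ, F) 𝓘(ℝ, E) f p)
    (x : TangentSpace 𝓘(ℝ, F) p) :
    mvfderiv 𝓘(ℝ, F) (fun q => u (f q)) p x =
      mvfderiv 𝓘(ℝ, E) u (f p) (mfderiv 𝓘(ℝ, F) 𝓘(ℝ, E) f p x) :=
  mfderiv_comp_apply p hu hf x

end VectorValued

section Bracket

variable {F : Type*} [NormedAddCommGroup F] [NormedSpace ℝ F]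
  {M : Type*} [TopologicalSpace M] [ChartedSpace F M] [IsManifold 𝓘(ℝ, F) ∞ M]
  {V : Type*} [NormedAddCommGroup V] [NormedSpace ℝ V]

/-- The derivative of a smooth vector-valued function in the direction of a smooth field is
smooth. -/
lemma contMDiffOn_mvfderiv_apply {u : M → V} {X : Π p : M, TangentSpace 𝓘(ℝ, F) p} {U : Set M}
    (hU : IsOpen U) (hu : ContMDiffOn 𝓘(ℝ, F) 𝓘(ℝ, V) ∞ u U) (hX : SmoothFieldOn X U) :
    ContMDiffOn 𝓘(ℝ, F) 𝓘(ℝ, V) ∞ (fun q => mvfderiv 𝓘(ℝ, F) u q (X q)) U := by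
  have h := hu.contMDiffOn_tangentMapWithin (m := ∞) (by simp) hU.uniqueMDiffOn
  have h2 := h.comp hX (fun q hq => hq)
  have h3 := (contMDiff_snd_tangentBundle_modelSpace (n := ∞) V 𝓘(ℝ, V)).comp_contMDiffOn h2
  refine h3.congr fun q hq => ?_
  simp only [Function.comp, tangentMapWithin, mfderivWithin_of_isOpen hU hq]
  rfl

/-- The differential of a smooth map carries smooth fields to smooth fields along the map. -/
lemma smoothAlongOn_mfderiv {E : Type*} [NormedAddCommGroup E] [NormedSpace ℝ E]
    {B : Type*} [TopologicalSpace B] [ChartedSpace E B] [IsManifold 𝓘(ℝ, E) ∞ B] {f : M → B}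
    (hf : ContMDiff 𝓘(ℝ, F) 𝓘(ℝ, E) ∞ f) {X : Π p : M, TangentSpace 𝓘(ℝ, F) p} {U : Set M}
    (hX : SmoothFieldOn X U) :
    SmoothAlongOn (F := F) f (fun q => mfderiv 𝓘(ℝ, F) 𝓘(ℝ, E) f q (X q)) U :=
  (hf.contMDiff_tangentMap (m := ∞) (by simp)).comp_contMDiffOn hX

/-- The Lie bracket acts on smooth functions as the commutator of the two derivations. -/
lemma mvfderiv_mlieBracket [CompleteSpace F] {u : M → V} {X Y : Π p : M, TangentSpace 𝓘(ℝ, F) p}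
    {U : Set M} {p : M}
    (hU : IsOpen U) (hp : p ∈ U) (hu : ContMDiffOn 𝓘(ℝ, F) 𝓘(ℝ, V) ∞ u U)
    (hX : SmoothFieldOn X U) (hY : SmoothFieldOn Y U) :
    mvfderiv 𝓘(ℝ, F) (fun q => mvfderiv 𝓘(ℝ, F) u q (Y q)) p (X p)
      - mvfderiv 𝓘(ℝ, F) (fun q => mvfderiv 𝓘(ℝ, F) u q (X q)) p (Y p)
      = mvfderiv 𝓘(ℝ, F) u p (VectorField.mlieBracket 𝓘(ℝ, F) X Y p) := by
  set φ := extChartAt 𝓘(ℝ, F) p with hφ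
  have hsrc : φ.source ∈ 𝓝 p := extChartAt_source_mem_nhds p
  have hy0 : φ.symm (φ p) = p := extChartAt_to_inv p
  -- the chart at `p` has the identity as its derivative there, by the choice of tangent coordinates
  have hid : ∀ v : F, (mfderiv 𝓘(ℝ, F) 𝓘(ℝ, F) φ p : F →L[ℝ] F) v = v := by
    intro v
    have h0 : HasFDerivAt (φ ∘ φ.symm) (ContinuousLinearMap.id ℝ F) (φ p) := by
      refine (hasFDerivAt_id (φ p)).congr_of_eventuallyEq ?_
      filter_upwards [extChartAt_target_mem_nhds (I := 𝓘(ℝ, F)) p] with y hy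
      exact φ.right_inv hy
    have h1 := mvfderiv_eq_of_hasFDerivAt (u := φ) (continuousAt_extChartAt p) h0
    exact congrArg (fun L : F →L[ℝ] F => L v) h1
  -- the coordinate expression of a field, evaluated at `φ q`, is the field pushed forward by `φ`
  have key : ∀ X : (Π p : M, TangentSpace 𝓘(ℝ, F) p), ∀ q ∈ φ.source,
      VectorField.mpullbackWithin 𝓘(ℝ, F) 𝓘(ℝ, F) φ.symm X (range 𝓘(ℝ, F)) (φ q)
        = mfderiv 𝓘(ℝ, F) 𝓘(ℝ, F) φ q (X q) := by
    intro X q hq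
    have hinv := isInvertible_mfderivWithin_extChartAt_symm (I := 𝓘(ℝ, F)) (x := p)
      (φ.map_source hq)
    have hc := mfderivWithin_extChartAt_symm_comp_mfderiv_extChartAt' (I := 𝓘(ℝ, F)) (x := p) hq
    have hc' : ∀ v : TangentSpace 𝓘(ℝ, F) q,
        mfderivWithin 𝓘(ℝ, F) 𝓘(ℝ, F) φ.symm (range 𝓘(ℝ, F)) (φ q)
          (mfderiv 𝓘(ℝ, F) 𝓘(ℝ, F) φ q v) = v := fun v =>
      congrArg (fun L : F →L[ℝ] F => L v) hc
    rw [VectorField.mpullbackWithin_apply]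
    have hX : X (φ.symm (φ q)) = (X q : F) := by rw [φ.left_inv hq]
    refine (congrArg _ (hX.trans (hc' (X q)).symm)).trans ?_
    obtain ⟨e, he⟩ := hinv
    rw [← he]
    erw [ContinuousLinearMap.inverse_equiv]
    exact e.symm_apply_apply _
  have hsymm : ContMDiffOn 𝓘(ℝ, F) 𝓘(ℝ, F) ∞ φ.symm φ.target := contMDiffOn_extChartAt_symm p
  have hOo : IsOpen (φ.target ∩ φ.symm ⁻¹' U) :=
    hsymm.continuousOn.isOpen_inter_preimage (isOpen_extChartAt_target p) hU
  have hwO : ContDiffOn ℝ ∞ (u ∘ φ.symm) (φ.target ∩ φ.symm ⁻¹' U) :=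
    contMDiffOn_iff_contDiffOn.1
      (hu.comp (hsymm.mono inter_subset_left) (fun y hy => hy.2))
  have hdu : ∀ q ∈ φ.source, q ∈ U → ∀ v : TangentSpace 𝓘(ℝ, F) q, mvfderiv 𝓘(ℝ, F) u q v =
      fderiv ℝ (u ∘ φ.symm) (φ q) (mfderiv 𝓘(ℝ, F) 𝓘(ℝ, F) φ q v) := by
    intro q hq hqU v
    have hO : φ q ∈ φ.target ∩ φ.symm ⁻¹' U :=
      ⟨φ.map_source hq, by rw [mem_preimage, φ.left_inv hq]; exact hqU⟩
    have h1 : DifferentiableAt ℝ (u ∘ φ.symm) (φ q) :=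
      (hwO.contDiffAt (hOo.mem_nhds hO)).differentiableAt (by simp)
    have h2 : MDifferentiableAt 𝓘(ℝ, F) 𝓘(ℝ, F) φ q :=
      mdifferentiableAt_extChartAt (by simpa [hφ] using hq)
    have h3 := mvfderiv_comp_map (F := F) (u := u ∘ φ.symm) (f := φ) h1.mdifferentiableAt h2 v
    have h4 : u =ᶠ[𝓝 q] fun x => (u ∘ φ.symm) (φ x) := by
      filter_upwards [(isOpen_extChartAt_source p).mem_nhds hq] with x hx
      simp [φ.left_inv hx]
    rw [mvfderiv_congr h4, h3]
    exact congrArg (fun L : F →L[ℝ] V => L _) mfderiv_eq_fderiv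
  have hO : φ p ∈ φ.target ∩ φ.symm ⁻¹' U :=
    ⟨mem_extChartAt_target p, by rw [mem_preimage, hy0]; exact hp⟩
  have hw : ContDiffAt ℝ ∞ (u ∘ φ.symm) (φ p) := hwO.contDiffAt (hOo.mem_nhds hO)
  have hdw : DifferentiableAt ℝ (fderiv ℝ (u ∘ φ.symm)) (φ p) :=
    (hw.fderiv_right (m := 1) (by norm_cast)).differentiableAt (by simp)
  have hdiff : ∀ X : (Π p : M, TangentSpace 𝓘(ℝ, F) p), SmoothFieldOn X U →
      DifferentiableAt ℝ (VectorField.mpullbackWithin 𝓘(ℝ, F) 𝓘(ℝ, F) φ.symm X (range 𝓘(ℝ, F)))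
        (φ p) := by
    intro X hX
    have h1 := (hX.contMDiffAt (hU.mem_nhds hp)).mdifferentiableAt (by simp)
    have h2 := (mdifferentiableWithinAt_univ.2 h1)
      |>.differentiableWithinAt_mpullbackWithin_vectorField
    simp only [preimage_univ, univ_inter, modelWithCornersSelf_coe, range_id] at h2 ⊢
    exact differentiableWithinAt_univ.1 h2
  -- the product rule for `q ↦ du(X)` in coordinates; the second derivatives of `u` will cancel
  have hder : ∀ X : (Π p : M, TangentSpace 𝓘(ℝ, F) p), SmoothFieldOn X U →
      ∀ v : F, (mvfderiv 𝓘(ℝ, F) (fun q => mvfderiv 𝓘(ℝ, F) u q (X q)) p : F →L[ℝ] V) v =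
        fderiv ℝ (fderiv ℝ (u ∘ φ.symm)) (φ p) v (X p) + fderiv ℝ (u ∘ φ.symm) (φ p)
        (fderiv ℝ (VectorField.mpullbackWithin 𝓘(ℝ, F) 𝓘(ℝ, F) φ.symm X (range 𝓘(ℝ, F)))
          (φ p) v) := by
    intro X hX v
    have h1 := hdw.hasFDerivAt.clm_apply (hdiff X hX).hasFDerivAt
    have h2 : (fun q => mvfderiv 𝓘(ℝ, F) u q (X q)) ∘ φ.symm =ᶠ[𝓝 (φ p)] fun y =>
        fderiv ℝ (u ∘ φ.symm) y
          (VectorField.mpullbackWithin 𝓘(ℝ, F) 𝓘(ℝ, F) φ.symm X (range 𝓘(ℝ, F)) y) := by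
      filter_upwards [hOo.mem_nhds hO] with y hy
      have := hdu (φ.symm y) (φ.map_target hy.1) hy.2 (X (φ.symm y))
      rw [← key X _ (φ.map_target hy.1), φ.right_inv hy.1] at this
      exact this
    have h3 := mvfderiv_eq_of_hasFDerivAt
      ((contMDiffOn_mvfderiv_apply hU hu hX).continuousOn.continuousAt (hU.mem_nhds hp))
      (h1.congr_of_eventuallyEq h2)
    rw [h3]
    refine (add_comm _ _).trans ?_
    congr 1
    refine congrArg (fderiv ℝ (fderiv ℝ (u ∘ φ.symm)) (φ p) v) ?_
    exact (key X p (mem_extChartAt_source p)).trans (hid (X p))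
  have hbr : VectorField.mlieBracket 𝓘(ℝ, F) X Y p =
      VectorField.lieBracket ℝ
        (VectorField.mpullbackWithin 𝓘(ℝ, F) 𝓘(ℝ, F) φ.symm X (range 𝓘(ℝ, F)))
        (VectorField.mpullbackWithin 𝓘(ℝ, F) 𝓘(ℝ, F) φ.symm Y (range 𝓘(ℝ, F))) (φ p) := by
    rw [← VectorField.mlieBracketWithin_univ, VectorField.mlieBracketWithin_apply]
    have : mfderiv 𝓘(ℝ, F) 𝓘(ℝ, F) (extChartAt 𝓘(ℝ, F) p) p = ContinuousLinearMap.id ℝ F :=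
      ContinuousLinearMap.ext hid
    refine (congrArg (fun L : F →L[ℝ] F => L.inverse _) this).trans ?_
    refine (congrArg (fun L : F →L[ℝ] F => L _) ContinuousLinearMap.inverse_id).trans ?_
    have hs : (extChartAt 𝓘(ℝ, F) p).symm ⁻¹' univ ∩ range 𝓘(ℝ, F) = univ := by simp
    refine (congrArg (fun s : Set F => VectorField.lieBracketWithin (E := F) ℝ _ _ s _) hs).trans ?_
    exact congrFun VectorField.lieBracketWithin_univ _
  have hX0 : (VectorField.mpullbackWithin 𝓘(ℝ, F) 𝓘(ℝ, F) φ.symm X (range 𝓘(ℝ, F)) (φ p))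
      = X p := (key X p (mem_extChartAt_source p)).trans (hid (X p))
  have hY0 : (VectorField.mpullbackWithin 𝓘(ℝ, F) 𝓘(ℝ, F) φ.symm Y (range 𝓘(ℝ, F)) (φ p))
      = Y p := (key Y p (mem_extChartAt_source p)).trans (hid (Y p))
  have hsym : fderiv ℝ (fderiv ℝ (u ∘ φ.symm)) (φ p) (X p) (Y p) =
      fderiv ℝ (fderiv ℝ (u ∘ φ.symm)) (φ p) (Y p) (X p) :=
    (hw.isSymmSndFDerivAt (by simpa using (mod_cast le_top : ((2 : ℕ∞) : WithTop ℕ∞) ≤ ∞)))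
      (X p) (Y p)
  refine (congrArg₂ (· - ·) (hder Y hY (X p)) (hder X hX (Y p))).trans ?_
  refine Eq.trans ?_ (congrArg (mvfderiv 𝓘(ℝ, F) u p : F →L[ℝ] V) hbr.symm)
  refine Eq.trans ?_ (hdu p (mem_extChartAt_source p) hp _).symm
  refine Eq.trans ?_ (congrArg (fderiv ℝ (u ∘ φ.symm) (φ p)) (hid _)).symm
  refine Eq.trans ?_ (map_sub (fderiv ℝ (u ∘ φ.symm) (φ p)) _ _).symm
  erw [hsym, hX0, hY0]
  abel

end Bracket

/-! ### Coordinates of tangent vectors and fields along a map -/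

section Along

variable {E : Type*} [NormedAddCommGroup E] [NormedSpace ℝ E]
  {B : Type*} [TopologicalSpace B] [ChartedSpace E B] [IsManifold 𝓘(ℝ, E) ∞ B]
  {F : Type*} [NormedAddCommGroup F] [NormedSpace ℝ F]
  {M : Type*} [TopologicalSpace M] [ChartedSpace F M]

/-- The coordinates of a tangent vector at `b` in the tangent bundle trivialization around `b₀`. -/
def coordVec (b₀ b : B) : TangentSpace 𝓘(ℝ, E) b →L[ℝ] E :=
  (trivializationAt E (TangentSpace 𝓘(ℝ, E) : B → Type _) b₀).continuousLinearMapAt ℝ b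

/-- The tangent vector at `b` with coordinates `a` in the trivialization around `b₀`; as `b` varies
this is the coordinate vector field with constant coefficients `a`. -/
def ofCoord (b₀ b : B) : E →L[ℝ] TangentSpace 𝓘(ℝ, E) b :=
  (trivializationAt E (TangentSpace 𝓘(ℝ, E) : B → Type _) b₀).symmL ℝ b

lemma coordVec_ofCoord {b₀ b : B} (hb : b ∈ (chartAt E b₀).source) (a : E) :
    coordVec b₀ b (ofCoord b₀ b a) = a :=
  (trivializationAt E (TangentSpace 𝓘(ℝ, E) : B → Type _) b₀).continuousLinearMapAt_symmL hb a

lemma ofCoord_coordVec {b₀ b : B} (hb : b ∈ (chartAt E b₀).source) (v : TangentSpace 𝓘(ℝ, E) b) :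
    ofCoord b₀ b (coordVec b₀ b v) = v :=
  (trivializationAt E (TangentSpace 𝓘(ℝ, E) : B → Type _) b₀).symmL_continuousLinearMapAt hb v

lemma coordVec_eq {b₀ b : B} (hb : b ∈ (chartAt E b₀).source) (v : TangentSpace 𝓘(ℝ, E) b) :
    coordVec b₀ b v =
      ((trivializationAt E (TangentSpace 𝓘(ℝ, E) : B → Type _) b₀) ⟨b, v⟩).2 := by
  rw [coordVec, Trivialization.continuousLinearMapAt_apply,
    Trivialization.coe_linearMapAt_of_mem _ (show b ∈ Trivialization.baseSet _ from hb)]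

lemma coordVec_eq_mvfderiv {b₀ b : B} (hb : b ∈ (chartAt E b₀).source)
    (v : TangentSpace 𝓘(ℝ, E) b) :
    coordVec b₀ b v = mvfderiv 𝓘(ℝ, E) (extChartAt 𝓘(ℝ, E) b₀) b v := by
  rw [coordVec, TangentBundle.continuousLinearMapAt_trivializationAt hb]
  rfl

lemma extend_eq_ofCoord {b₀ b : B} (hb : b ∈ (chartAt E b₀).source)
    (v : TangentSpace 𝓘(ℝ, E) b₀) :
    FiberBundle.extend E v b = ofCoord b₀ b (coordVec b₀ b₀ v) := by
  rw [coordVec_eq (mem_chart_source E b₀)]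
  exact ((trivializationAt E (TangentSpace 𝓘(ℝ, E) : B → Type _) b₀).symmL_apply hb _).symm

lemma smoothFieldOn_ofCoord (b₀ : B) (a : E) :
    SmoothFieldOn (fun b => ofCoord b₀ b a) (chartAt E b₀).source := by
  refine ((trivializationAt E (TangentSpace 𝓘(ℝ, E) : B → Type _)
    b₀).contMDiffOn_section_baseSet_iff).2 ?_
  refine (contMDiffOn_const (c := a)).congr fun b hb => ?_
  rw [← coordVec_eq hb]
  exact coordVec_ofCoord hb a

lemma smoothFieldOn_extend {b₀ : B} (v : TangentSpace 𝓘(ℝ, E) b₀) :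
    SmoothFieldOn (FiberBundle.extend E v) (chartAt E b₀).source := by
  refine ContMDiffOn.congr (smoothFieldOn_ofCoord b₀ (coordVec b₀ b₀ v)) fun b hb => ?_
  simp only [extend_eq_ofCoord hb]

/-- The vector field `V` along `f` is differentiable at `p`. -/
def MDiffAlongAt (f : M → B) (V : Π p : M, TangentSpace 𝓘(ℝ, E) (f p)) (p : M) : Prop :=
  MDifferentiableAt 𝓘(ℝ, F) 𝓘(ℝ, E).tangent
    (fun p => (⟨f p, V p⟩ : TotalSpace E (TangentSpace 𝓘(ℝ, E) : B → Type _))) p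

lemma mDiffAlongAt_iff {f : M → B} {V : Π p : M, TangentSpace 𝓘(ℝ, E) (f p)} {p : M} {b₀ : B}
    (hp : f p ∈ (chartAt E b₀).source) :
    MDiffAlongAt (F := F) f V p ↔ MDifferentiableAt 𝓘(ℝ, F) 𝓘(ℝ, E) f p ∧
      MDifferentiableAt 𝓘(ℝ, F) 𝓘(ℝ, E) (fun q => coordVec b₀ (f q) (V q)) p := by
  refine ((trivializationAt E (TangentSpace 𝓘(ℝ, E) : B → Type _)
    b₀).mdifferentiableAt_totalSpace_iff 𝓘(ℝ, E) _ ?_).trans ?_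
  · exact (Trivialization.mem_source _).2 hp
  · refine and_congr_right fun hf => ?_
    have : (fun q => ((trivializationAt E (TangentSpace 𝓘(ℝ, E) : B → Type _) b₀)
        ⟨f q, V q⟩).2) =ᶠ[𝓝 p] fun q => coordVec b₀ (f q) (V q) := by
      filter_upwards [hf.continuousAt.preimage_mem_nhds
        ((chartAt E b₀).open_source.mem_nhds hp)] with q hq
      exact (coordVec_eq hq _).symm
    exact this.mdifferentiableAt_iff

lemma smoothAlongOn_iff {f : M → B} {V : Π p : M, TangentSpace 𝓘(ℝ, E) (f p)} {U : Set M} {b₀ : B}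
    (hf : ContMDiffOn 𝓘(ℝ, F) 𝓘(ℝ, E) ∞ f U) (hU : ∀ p ∈ U, f p ∈ (chartAt E b₀).source) :
    SmoothAlongOn (F := F) f V U ↔
      ContMDiffOn 𝓘(ℝ, F) 𝓘(ℝ, E) ∞ (fun q => coordVec b₀ (f q) (V q)) U := by
  refine ((trivializationAt E (TangentSpace 𝓘(ℝ, E) : B → Type _)
    b₀).contMDiffOn_iff (IB := 𝓘(ℝ, E))
      (f := fun p => (⟨f p, V p⟩ : TotalSpace E (TangentSpace 𝓘(ℝ, E) : B → Type _)))
      fun p hp => (Trivialization.mem_source _).2 (hU p hp)).trans ?_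
  refine (and_iff_right hf).trans (contMDiffOn_congr fun q hq => ?_)
  exact (coordVec_eq (hU q hq) _).symm

variable {f : M → B} {V W : Π p : M, TangentSpace 𝓘(ℝ, E) (f p)} {p : M} {U : Set M}

lemma SmoothAlongOn.mDiffAlongAt (hV : SmoothAlongOn (F := F) f V U) (hU : U ∈ 𝓝 p) :
    MDiffAlongAt (F := F) f V p :=
  (hV.contMDiffAt hU).mdifferentiableAt (by simp)

lemma MDiffAlongAt.mdifferentiableAt (hV : MDiffAlongAt (F := F) f V p) :
    MDifferentiableAt 𝓘(ℝ, F) 𝓘(ℝ, E) f p :=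
  ((mDiffAlongAt_iff (mem_chart_source E (f p))).1 hV).1

lemma MDiffAlongAt.add (hV : MDiffAlongAt (F := F) f V p) (hW : MDiffAlongAt (F := F) f W p) :
    MDiffAlongAt (F := F) f (fun q => V q + W q) p := by
  have hp := mem_chart_source E (f p)
  rw [mDiffAlongAt_iff hp] at *
  exact ⟨hV.1, by simp only [map_add]; exact hV.2.add hW.2⟩

lemma MDiffAlongAt.smul {a : M → ℝ} (ha : MDifferentiableAt 𝓘(ℝ, F) 𝓘(ℝ, ℝ) a p)
    (hV : MDiffAlongAt (F := F) f V p) :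
    MDiffAlongAt (F := F) f (fun q => a q • V q) p := by
  have hp := mem_chart_source E (f p)
  rw [mDiffAlongAt_iff hp] at *
  exact ⟨hV.1, by simp only [map_smul]; exact ha.smul hV.2⟩

lemma MDiffAlongAt.sub (hV : MDiffAlongAt (F := F) f V p) (hW : MDiffAlongAt (F := F) f W p) :
    MDiffAlongAt (F := F) f (fun q => V q - W q) p := by
  have hp := mem_chart_source E (f p)
  rw [mDiffAlongAt_iff hp] at *
  exact ⟨hV.1, by simp only [map_sub]; exact hV.2.sub hW.2⟩

lemma SmoothAlongOn.mono {U' : Set M} (hV : SmoothAlongOn (F := F) f V U) (h : U' ⊆ U) :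
    SmoothAlongOn (F := F) f V U' := ContMDiffOn.mono hV h

lemma SmoothAlongOn.congr (hV : SmoothAlongOn (F := F) f V U) (h : ∀ q ∈ U, W q = V q) :
    SmoothAlongOn (F := F) f W U :=
  ContMDiffOn.congr hV fun q hq => by simp only [h q hq]

/-- To check that a field along `f` is smooth on an open set, it is enough to do so near each
point. -/
lemma smoothAlongOn_of_locally (h : ∀ q ∈ U, ∃ U', IsOpen U' ∧ q ∈ U' ∧
    SmoothAlongOn (F := F) f V (U ∩ U')) : SmoothAlongOn (F := F) f V U :=
  contMDiffOn_of_locally_contMDiffOn h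

end Along

/-! ### The connection along a map in coordinates -/

section CovAlong

variable {E : Type*} [NormedAddCommGroup E] [NormedSpace ℝ E]
  {B : Type*} [TopologicalSpace B] [ChartedSpace E B] [IsManifold 𝓘(ℝ, E) ∞ B]
  {F : Type*} [NormedAddCommGroup F] [NormedSpace ℝ F]
  {M : Type*} [TopologicalSpace M] [ChartedSpace F M]

variable (D : CovariantDerivative 𝓘(ℝ, E) E (TangentSpace 𝓘(ℝ, E) : B → Type _))

lemma mdiffAt_ofCoord {b₀ b : B} (hb : b ∈ (chartAt E b₀).source) (a : E) :
    MDiffAt (T% (fun b => ofCoord b₀ b a)) b :=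
  ((smoothFieldOn_ofCoord b₀ a).contMDiffAt
    ((chartAt E b₀).open_source.mem_nhds hb)).mdifferentiableAt (by simp)

variable {D} in
lemma CovariantDerivative.sum_smul {ι : Type*} (s : Finset ι) {a : ι → B → ℝ}
    {e : ι → Π b : B, TangentSpace 𝓘(ℝ, E) b} {b : B} (ha : ∀ i ∈ s, MDiffAt (a i) b)
    (he : ∀ i ∈ s, MDiffAt (T% (e i)) b) (v : TangentSpace 𝓘(ℝ, E) b) :
    D (fun q => ∑ i ∈ s, a i q • e i q) b v =
      ∑ i ∈ s, (mvfderiv 𝓘(ℝ, E) (a i) b v • e i b + a i b • D (e i) b v) := by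
  classical
  induction s using Finset.induction_on with
  | empty =>
    have : D (0 : Π b : B, TangentSpace 𝓘(ℝ, E) b) b = 0 := by simp
    simp only [Finset.sum_empty]
    exact congrArg (fun L : E →L[ℝ] E => L v) this
  | insert i s hi ih =>
    simp only [Finset.mem_insert, forall_eq_or_imp] at ha he
    have h1 : MDiffAt (T% (a i • e i)) b := ha.1.smul_section he.1
    have h2 : MDiffAt (T% (fun q => ∑ i ∈ s, a i q • e i q)) b :=
      MDifferentiableAt.sum_section fun i hi => (ha.2 i hi).smul_section (he.2 i hi)
    have h3 := D.isCovariantDerivativeOn.add (s := univ) h1 h2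
    have h4 := D.isCovariantDerivativeOn.leibniz (s := univ) he.1 ha.1
    simp only [Finset.sum_insert hi]
    refine (congrArg (fun L : E →L[ℝ] E => L v) h3).trans ?_
    refine (congrArg (fun L : TangentSpace 𝓘(ℝ, E) b →L[ℝ] TangentSpace 𝓘(ℝ, E) b =>
      L v + _) h4).trans ?_
    rw [← ih ha.2 he.2]
    refine congrArg (· + _) ?_
    exact add_comm _ _

variable [FiniteDimensional ℝ E]

lemma localFrame_eq_ofCoord (b₀ : B) (i : Fin (finrank ℝ E)) :
    (trivializationAt E (TangentSpace 𝓘(ℝ, E) : B → Type _) b₀).localFrame (finBasis ℝ E) i =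
      fun b => ofCoord b₀ b (finBasis ℝ E i) := by
  ext b
  by_cases hb : b ∈ (trivializationAt E (TangentSpace 𝓘(ℝ, E) : B → Type _) b₀).baseSet
  · rw [Trivialization.localFrame_apply_of_mem_baseSet _ _ hb, ofCoord,
      Trivialization.symmL_apply _ hb]
    simp [Trivialization.basisAt]
  · rw [Trivialization.localFrame_apply_of_notMem _ _ hb, ofCoord,
      Trivialization.symmL_apply_of_notMem _ hb]

lemma localFrameCoeff_eq_coord {b₀ b : B} (hb : b ∈ (chartAt E b₀).source)
    (i : Fin (finrank ℝ E)) (v : TangentSpace 𝓘(ℝ, E) b) :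
    (trivializationAt E (TangentSpace 𝓘(ℝ, E) : B → Type _) b₀).localFrameCoeff 𝓘(ℝ, E)
      (finBasis ℝ E) i b v = (finBasis ℝ E).coord i (coordVec b₀ b v) := by
  have h := (trivializationAt E (TangentSpace 𝓘(ℝ, E) : B → Type _) b₀).localFrameCoeff_eq_coeff
    (I := 𝓘(ℝ, E)) (b := finBasis ℝ E) (s := FiberBundle.extend E v) (x := b) (i := i) hb
  rw [FiberBundle.extend_apply_self] at h
  rw [h, coordVec_eq hb]
  simp only [FiberBundle.extend_apply_self]
  rfl

/-- The coordinate form of `covAlong`, in the trivialization at the base point. -/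
lemma covAlong_eq_sum (f : M → B) (V : Π p : M, TangentSpace 𝓘(ℝ, E) (f p)) (p : M)
    (v : TangentSpace 𝓘(ℝ, F) p) (hf : ContinuousAt f p) :
    covAlong D f V p v = ∑ i, (
      mvfderiv 𝓘(ℝ, F) (fun q => (finBasis ℝ E).coord i (coordVec (f p) (f q) (V q))) p v •
        ofCoord (f p) (f p) (finBasis ℝ E i) +
      (finBasis ℝ E).coord i (coordVec (f p) (f p) (V p)) •
        D (fun b => ofCoord (f p) b (finBasis ℝ E i)) (f p)
          (mfderiv 𝓘(ℝ, F) 𝓘(ℝ, E) f p v)) := by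
  have hs : ∀ᶠ q in 𝓝 p, f q ∈ (chartAt E (f p)).source :=
    hf.preimage_mem_nhds ((chartAt E (f p)).open_source.mem_nhds (mem_chart_source E (f p)))
  refine Finset.sum_congr rfl fun i _ => ?_
  rw [localFrame_eq_ofCoord, localFrameCoeff_eq_coord (mem_chart_source E (f p))]
  congr 2
  refine congrArg (fun L : F →L[ℝ] ℝ => L v) (mvfderiv_congr ?_)
  filter_upwards [hs] with q hq
  exact localFrameCoeff_eq_coord hq i _

variable {D}

/-- `covAlong` may be computed in terms of any finite family of fields near `f p`. -/
lemma covAlong_of_eventuallyEq_sum {f : M → B} {V : Π p : M, TangentSpace 𝓘(ℝ, E) (f p)} {p : M}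
    {ι : Type*} [Fintype ι] {a : ι → M → ℝ} {e : ι → Π b : B, TangentSpace 𝓘(ℝ, E) b}
    (hf : MDifferentiableAt 𝓘(ℝ, F) 𝓘(ℝ, E) f p) (ha : ∀ i, MDiffAt (a i) p)
    (he : ∀ i, MDiffAt (T% (e i)) (f p))
    (hV : ∀ᶠ q in 𝓝 p, V q = ∑ i, a i q • e i (f q)) (v : TangentSpace 𝓘(ℝ, F) p) :
    covAlong D f V p v = ∑ i, (mvfderiv 𝓘(ℝ, F) (a i) p v • e i (f p)
      + a i p • D (e i) (f p) (mfderiv 𝓘(ℝ, F) 𝓘(ℝ, E) f p v)) := by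
  have hp := mem_chart_source E (f p)
  have hs : ∀ᶠ q in 𝓝 p, f q ∈ (chartAt E (f p)).source :=
    hf.continuousAt.preimage_mem_nhds ((chartAt E (f p)).open_source.mem_nhds hp)
  -- the coefficients of the fields `e i` in the coordinate frame
  let c : ι → Fin (finrank ℝ E) → B → ℝ := fun i j b =>
    (finBasis ℝ E).coord j (coordVec (f p) b (e i b))
  have hc : ∀ i j, MDiffAt (c i j) (f p) := fun i j => by
    have h1 := ((mDiffAlongAt_iff (f := (id : B → B)) hp).1 (he i)).2
    exact (((finBasis ℝ E).coord j).toContinuousLinearMap.contMDiffAt.mdifferentiableAt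
      one_ne_zero).comp (f p) h1
  have hexp : ∀ b ∈ (chartAt E (f p)).source, ∀ w : TangentSpace 𝓘(ℝ, E) b,
      ∑ j, (finBasis ℝ E).coord j (coordVec (f p) b w) • ofCoord (f p) b (finBasis ℝ E j) = w := by
    intro b hb w
    rw [← ofCoord_coordVec hb w, coordVec_ofCoord hb]
    conv_rhs => rw [← (finBasis ℝ E).sum_repr (coordVec (f p) b w), map_sum]
    simp
  have hDe : ∀ i, ∀ w : TangentSpace 𝓘(ℝ, E) (f p), D (e i) (f p) w =
      ∑ j, (mvfderiv 𝓘(ℝ, E) (c i j) (f p) w • ofCoord (f p) (f p) (finBasis ℝ E j) +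
        c i j (f p) • D (fun b => ofCoord (f p) b (finBasis ℝ E j)) (f p) w) := by
    intro i w
    rw [← CovariantDerivative.sum_smul Finset.univ (fun j _ => hc i j)
      (fun j _ => mdiffAt_ofCoord hp _)]
    have h2 : MDiffAt (T% (fun q => ∑ j, c i j q • ofCoord (f p) q (finBasis ℝ E j))) (f p) :=
      MDifferentiableAt.sum_section fun j _ => (hc i j).smul_section (mdiffAt_ofCoord hp _)
    have h3 := D.isCovariantDerivativeOn.congr_of_eventuallyEq (s := univ) (he i) h2
      Filter.univ_mem (by
        filter_upwards [(chartAt E (f p)).open_source.mem_nhds hp] with b hb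
        exact (hexp b hb _).symm)
    exact congrArg (fun L : E →L[ℝ] E => L w) h3
  have hcoef : ∀ j, mvfderiv 𝓘(ℝ, F)
      (fun q => (finBasis ℝ E).coord j (coordVec (f p) (f q) (V q))) p v =
      ∑ i, (mvfderiv 𝓘(ℝ, F) (a i) p v * c i j (f p) + a i p *
        mvfderiv 𝓘(ℝ, E) (c i j) (f p) (mfderiv 𝓘(ℝ, F) 𝓘(ℝ, E) f p v)) := by
    intro j
    have h1 : (fun q => (finBasis ℝ E).coord j (coordVec (f p) (f q) (V q))) =ᶠ[𝓝 p]
        fun q => ∑ i, a i q * c i j (f q) := by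
      filter_upwards [hV] with q hq
      simp [hq, c]
    have hcf : ∀ i, MDiffAt (fun q => c i j (f q)) p := fun i => (hc i j).comp p hf
    have hm : ∀ i, MDiffAt (fun q => a i q * c i j (f q)) p := fun i => (ha i).mul (hcf i)
    rw [mvfderiv_congr h1, mvfderiv_finsetSum _ fun i _ => hm i]
    refine (sum_apply _ _ _).trans (Finset.sum_congr rfl fun i _ => ?_)
    rw [mvfderiv_fun_mul (ha i) (hcf i)]
    simp only [add_apply, smul_apply, smul_eq_mul]
    rw [mvfderiv_comp_map (hc i j) hf]
    ring
  have hVp : ∀ j, (finBasis ℝ E).coord j (coordVec (f p) (f p) (V p)) =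
      ∑ i, a i p * c i j (f p) := by
    intro j
    simp [hV.self_of_nhds, c]
  rw [covAlong_eq_sum D f V p v hf.continuousAt]
  simp only [hcoef, hVp, hDe, Finset.sum_smul, Finset.smul_sum, add_smul, smul_add]
  simp only [← Finset.sum_add_distrib]
  rw [Finset.sum_comm]
  refine Finset.sum_congr rfl fun i _ => ?_
  have h5 : (mvfderiv 𝓘(ℝ, F) (a i) p v) • e i (f p) = ∑ j, (mvfderiv 𝓘(ℝ, F) (a i) p v) •
      (c i j (f p) • ofCoord (f p) (f p) (finBasis ℝ E j)) := by
    rw [← Finset.smul_sum]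
    exact congrArg _ (hexp (f p) hp (e i (f p))).symm
  rw [h5, ← Finset.sum_add_distrib]
  refine Finset.sum_congr rfl fun j _ => ?_
  simp only [mul_smul]
  abel

/-- The Christoffel tensor of `D` in the trivialization around `b₀`: `christoffel D b₀ b z a` are
the coordinates of the derivative of the field with constant coefficients `z` in the direction with
coordinates `a`. -/
def christoffel (D : CovariantDerivative 𝓘(ℝ, E) E (TangentSpace 𝓘(ℝ, E) : B → Type _))
    (b₀ b : B) : E →L[ℝ] E →L[ℝ] E :=
  ∑ i, ((finBasis ℝ E).coord i).toContinuousLinearMap.smulRight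
    (((coordVec b₀ b).comp (D (fun b => ofCoord b₀ b (finBasis ℝ E i)) b)).comp (ofCoord b₀ b))

/-- The covariant derivative along `f` in coordinates: the derivative of the coordinates plus the
Christoffel term. -/
lemma coordVec_covAlong {f : M → B} {V : Π p : M, TangentSpace 𝓘(ℝ, E) (f p)} {p : M} {b₀ : B}
    (hp : f p ∈ (chartAt E b₀).source) (hV : MDiffAlongAt (F := F) f V p)
    (v : TangentSpace 𝓘(ℝ, F) p) :
    coordVec b₀ (f p) (covAlong D f V p v) =
      mvfderiv 𝓘(ℝ, F) (fun q => coordVec b₀ (f q) (V q)) p v +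
      christoffel D b₀ (f p) (coordVec b₀ (f p) (V p))
        (coordVec b₀ (f p) (mfderiv 𝓘(ℝ, F) 𝓘(ℝ, E) f p v)) := by
  have hf := hV.mdifferentiableAt
  have hV' := ((mDiffAlongAt_iff hp).1 hV).2
  have hs : ∀ᶠ q in 𝓝 p, f q ∈ (chartAt E b₀).source :=
    hf.continuousAt.preimage_mem_nhds ((chartAt E b₀).open_source.mem_nhds hp)
  have hexp : ∀ᶠ q in 𝓝 p, V q = ∑ i, (finBasis ℝ E).coord i (coordVec b₀ (f q) (V q)) •
      ofCoord b₀ (f q) (finBasis ℝ E i) := by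
    filter_upwards [hs] with q hq
    conv_lhs => rw [← ofCoord_coordVec hq (V q),
      ← (finBasis ℝ E).sum_repr (coordVec b₀ (f q) (V q)), map_sum]
    simp
  have hL : ∀ i, MDiffAt (fun q => (finBasis ℝ E).coord i (coordVec b₀ (f q) (V q))) p := fun i =>
    (((finBasis ℝ E).coord i).toContinuousLinearMap.contMDiffAt.mdifferentiableAt
      one_ne_zero).comp p hV'
  rw [covAlong_of_eventuallyEq_sum hf hL (fun i => mdiffAt_ofCoord hp (finBasis ℝ E i)) hexp,
    map_sum]
  simp only [map_add, map_smul, Finset.sum_add_distrib, coordVec_ofCoord hp]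
  congr 1
  · have h1 : ∀ i,
        mvfderiv 𝓘(ℝ, F) (fun q => (finBasis ℝ E).coord i (coordVec b₀ (f q) (V q))) p v =
        (finBasis ℝ E).repr (mvfderiv 𝓘(ℝ, F) (fun q => coordVec b₀ (f q) (V q)) p v) i := fun i =>
      mvfderiv_clm_comp ((finBasis ℝ E).coord i).toContinuousLinearMap hV' v
    simp only [h1]
    exact (finBasis ℝ E).sum_repr _
  · simp only [christoffel, sum_apply]
    refine Finset.sum_congr rfl fun i _ => ?_
    simp [ofCoord_coordVec hp]

end CovAlong

/-! ### Rules for the connection along a map, and Kähler-Norden triples -/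

section CovAlongRules

variable {E : Type*} [NormedAddCommGroup E] [NormedSpace ℝ E] [FiniteDimensional ℝ E]
  {B : Type*} [TopologicalSpace B] [ChartedSpace E B] [IsManifold 𝓘(ℝ, E) ∞ B]
  {F : Type*} [NormedAddCommGroup F] [NormedSpace ℝ F]
  {M : Type*} [TopologicalSpace M] [ChartedSpace F M]
  {D : CovariantDerivative 𝓘(ℝ, E) E (TangentSpace 𝓘(ℝ, E) : B → Type _)}
  {f : M → B} {V W : Π p : M, TangentSpace 𝓘(ℝ, E) (f p)} {p : M}

lemma eq_of_coordVec_eq {b₀ b : B} (hb : b ∈ (chartAt E b₀).source) {v w : TangentSpace 𝓘(ℝ, E) b}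
    (h : coordVec b₀ b v = coordVec b₀ b w) : v = w := by
  rw [← ofCoord_coordVec hb v, h, ofCoord_coordVec hb w]

lemma covAlong_congr (hf : ContinuousAt f p) (h : ∀ᶠ q in 𝓝 p, V q = W q)
    (v : TangentSpace 𝓘(ℝ, F) p) : covAlong D f V p v = covAlong D f W p v := by
  rw [covAlong_eq_sum D f V p v hf, covAlong_eq_sum D f W p v hf, h.self_of_nhds]
  refine Finset.sum_congr rfl fun i _ => ?_
  congr 2
  refine congrArg (fun L : F →L[ℝ] ℝ => L v) (mvfderiv_congr ?_)
  filter_upwards [h] with q hq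
  rw [hq]

lemma covAlong_add (hV : MDiffAlongAt (F := F) f V p) (hW : MDiffAlongAt (F := F) f W p)
    (v : TangentSpace 𝓘(ℝ, F) p) :
    covAlong D f (fun q => V q + W q) p v = covAlong D f V p v + covAlong D f W p v := by
  have hp := mem_chart_source E (f p)
  apply eq_of_coordVec_eq hp
  rw [map_add, coordVec_covAlong hp (hV.add hW), coordVec_covAlong hp hV, coordVec_covAlong hp hW]
  simp only [map_add]
  rw [mvfderiv_fun_add ((mDiffAlongAt_iff hp).1 hV).2 ((mDiffAlongAt_iff hp).1 hW).2]
  simp only [add_apply]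
  abel

lemma covAlong_smul {a : M → ℝ} (ha : MDifferentiableAt 𝓘(ℝ, F) 𝓘(ℝ, ℝ) a p)
    (hV : MDiffAlongAt (F := F) f V p) (v : TangentSpace 𝓘(ℝ, F) p) :
    covAlong D f (fun q => a q • V q) p v =
      mvfderiv 𝓘(ℝ, F) a p v • V p + a p • covAlong D f V p v := by
  have hp := mem_chart_source E (f p)
  apply eq_of_coordVec_eq hp
  rw [map_add, map_smul, map_smul, coordVec_covAlong hp (hV.smul ha), coordVec_covAlong hp hV]
  simp only [map_smul]
  rw [mvfderiv_fun_smul ha ((mDiffAlongAt_iff hp).1 hV).2]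
  simp
  abel

lemma covAlong_sub (hV : MDiffAlongAt (F := F) f V p) (hW : MDiffAlongAt (F := F) f W p)
    (v : TangentSpace 𝓘(ℝ, F) p) :
    covAlong D f (fun q => V q - W q) p v = covAlong D f V p v - covAlong D f W p v := by
  have hp := mem_chart_source E (f p)
  apply eq_of_coordVec_eq hp
  rw [map_sub, coordVec_covAlong hp (hV.sub hW), coordVec_covAlong hp hV, coordVec_covAlong hp hW]
  simp only [map_sub]
  rw [mvfderiv_fun_sub ((mDiffAlongAt_iff hp).1 hV).2 ((mDiffAlongAt_iff hp).1 hW).2]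
  simp only [sub_apply]
  abel

/-- Along the identity, `covAlong` is the connection itself. -/
lemma covAlong_id {Y : Π b : B, TangentSpace 𝓘(ℝ, E) b} {b : B} (hY : MDiffAt (T% Y) b)
    (v : TangentSpace 𝓘(ℝ, E) b) : covAlong D (fun b : B => b) Y b v = D Y b v := by
  refine (covAlong_of_eventuallyEq_sum (ι := Unit) (a := fun _ _ => 1) (e := fun _ => Y)
    (f := fun b : B => b) mdifferentiableAt_id (fun _ => mdifferentiableAt_const) (fun _ => hY)
    (by simp) v).trans ?_
  have : mfderiv 𝓘(ℝ, E) 𝓘(ℝ, E) (fun b : B => b) b v = v :=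
    congrArg (fun L : E →L[ℝ] E => L v) mfderiv_id
  simp [mvfderiv_const, this]

end CovAlongRules

section SmoothCLM

variable {F : Type*} [NormedAddCommGroup F] [NormedSpace ℝ F]
  {M : Type*} [TopologicalSpace M] [ChartedSpace F M]
  {V W : Type*} [NormedAddCommGroup V] [NormedSpace ℝ V] [FiniteDimensional ℝ V]
  [NormedAddCommGroup W] [NormedSpace ℝ W]

/-- On a finite-dimensional space, smoothness of a family of operators may be tested on vectors. -/
lemma contMDiffOn_clm_of_apply {L : M → V →L[ℝ] W} {U : Set M}
    (h : ∀ v, ContMDiffOn 𝓘(ℝ, F) 𝓘(ℝ, W) ∞ (fun q => L q v) U) :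
    ContMDiffOn 𝓘(ℝ, F) 𝓘(ℝ, V →L[ℝ] W) ∞ L U := by
  have hL : ∀ q, L q = ∑ i, ContinuousLinearMap.smulRightL ℝ V W
      ((finBasis ℝ V).coord i).toContinuousLinearMap (L q (finBasis ℝ V i)) := by
    intro q
    ext v
    conv_lhs => rw [← (finBasis ℝ V).sum_repr v, map_sum]
    simp
  refine ContMDiffOn.congr (f := fun q => ∑ i, ContinuousLinearMap.smulRightL ℝ V W
      ((finBasis ℝ V).coord i).toContinuousLinearMap (L q (finBasis ℝ V i))) ?_ fun q _ => hL q
  refine contMDiffOn_finsetSum fun i _ => ?_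
  exact (ContinuousLinearMap.contMDiff _).comp_contMDiffOn (h _)

end SmoothCLM

section Norden

variable {E : Type*} [NormedAddCommGroup E] [NormedSpace ℝ E] [FiniteDimensional ℝ E]
  [CompleteSpace E]
  {B : Type*} [TopologicalSpace B] [ChartedSpace E B] [IsManifold 𝓘(ℝ, E) ∞ B]

/-- `(h, J, D)` is a Kähler-Norden structure. This is the form of the conditions that both Norden
metrics of a `KaehlerNorden` structure visibly satisfy; smoothness of `h` is stated for its
coefficients in the coordinate frames. -/
structure IsKaehlerNorden
    (h : Π p : B, TangentSpace 𝓘(ℝ, E) p →L[ℝ] TangentSpace 𝓘(ℝ, E) p →L[ℝ] ℝ)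
    (J : Π p : B, TangentSpace 𝓘(ℝ, E) p →L[ℝ] TangentSpace 𝓘(ℝ, E) p)
    (D : CovariantDerivative 𝓘(ℝ, E) E (TangentSpace 𝓘(ℝ, E) : B → Type _)) : Prop where
  J_smooth : ContMDiff 𝓘(ℝ, E) (𝓘(ℝ, E).prod 𝓘(ℝ, E →L[ℝ] E)) ∞
    (fun p => TotalSpace.mk' (E →L[ℝ] E) p (J p))
  smooth_coeff : ∀ (b₀ : B) (a c : E), ContMDiffOn 𝓘(ℝ, E) 𝓘(ℝ, ℝ) ∞
    (fun b => h b (ofCoord b₀ b a) (ofCoord b₀ b c)) (chartAt E b₀).source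
  symm : ∀ p x y, h p x y = h p y x
  nondegenerate : ∀ p x, (∀ y, h p x y = 0) → x = 0
  J_sq : ∀ p x, J p (J p x) = -x
  norden : ∀ p x y, h p (J p x) (J p y) = -h p x y
  leviCivita : IsLeviCivita h D
  J_parallel : ∀ (Y : Π p : B, TangentSpace 𝓘(ℝ, E) p) (p : B) (v : TangentSpace 𝓘(ℝ, E) p),
    MDiffAt (T% Y) p → D (fun q => J q (Y q)) p v = J p (D Y p v)

lemma KaehlerNorden.isKaehlerNorden (K : KaehlerNorden E B) :
    IsKaehlerNorden K.g K.J K.nabla where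
  J_smooth := K.J_smooth
  smooth_coeff b₀ a c := by
    have ha := smoothFieldOn_ofCoord b₀ a
    have hc := smoothFieldOn_ofCoord b₀ c
    have := (K.g_smooth.contMDiffOn (s := (chartAt E b₀).source)).clm_bundle_apply₂
      (F₃ := ℝ) (E₃ := Bundle.Trivial B ℝ) ha hc
    exact fun b hb => (contMDiffWithinAt_totalSpace.1 (this b hb)).2
  symm := K.g_symm
  nondegenerate := K.g_nondegenerate
  J_sq := K.J_sq
  norden := K.norden
  leviCivita := K.leviCivita
  J_parallel := K.J_parallel

lemma KaehlerNorden.isKaehlerNorden_assoc (K : KaehlerNorden E B) :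
    IsKaehlerNorden K.assoc K.J K.nabla where
  J_smooth := K.J_smooth
  smooth_coeff b₀ a c := by
    have ha := smoothFieldOn_ofCoord b₀ a
    have hc := smoothFieldOn_ofCoord b₀ c
    have hJ := (K.J_smooth.contMDiffOn (s := (chartAt E b₀).source)).clm_bundle_apply ha
    have := (K.g_smooth.contMDiffOn (s := (chartAt E b₀).source)).clm_bundle_apply₂
      (F₃ := ℝ) (E₃ := Bundle.Trivial B ℝ) hJ hc
    exact fun b hb => (contMDiffWithinAt_totalSpace.1 (this b hb)).2
  symm p x y := by
    have := K.norden p (K.J p x) y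
    rw [K.J_sq] at this
    simp only [map_neg, neg_apply] at this
    change K.g p (K.J p x) y = K.g p (K.J p y) x
    rw [K.g_symm p (K.J p y) x]
    linarith
  nondegenerate p x hx := by
    have h1 : K.J p x = 0 := K.g_nondegenerate p _ hx
    have h2 := K.J_sq p x
    rw [h1, map_zero] at h2
    exact neg_eq_zero.1 h2.symm
  J_sq := K.J_sq
  norden p x y := K.norden p (K.J p x) y
  leviCivita := K.isLeviCivita_assoc
  J_parallel := K.J_parallel

end Norden

/-! ### Coefficients of the metric, of the complex structure and of the connection -/

section Coefficients

variable {E : Type*} [NormedAddCommGroup E] [NormedSpace ℝ E] [FiniteDimensional ℝ E]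
  [CompleteSpace E]
  {B : Type*} [TopologicalSpace B] [ChartedSpace E B] [IsManifold 𝓘(ℝ, E) ∞ B]
  {h : Π p : B, TangentSpace 𝓘(ℝ, E) p →L[ℝ] TangentSpace 𝓘(ℝ, E) p →L[ℝ] ℝ}
  {J : Π p : B, TangentSpace 𝓘(ℝ, E) p →L[ℝ] TangentSpace 𝓘(ℝ, E) p}
  {D : CovariantDerivative 𝓘(ℝ, E) E (TangentSpace 𝓘(ℝ, E) : B → Type _)}

variable (h) in
/-- The coefficients of the bilinear form field `h` in the trivialization around `b₀`. -/
def formCoeff (b₀ b : B) : E →L[ℝ] E →L[ℝ] ℝ :=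
  LinearMap.toContinuousLinearMap
    { toFun := fun a => (h b (ofCoord b₀ b a)).comp (ofCoord b₀ b)
      map_add' := fun a c => by ext; simp
      map_smul' := fun a c => by ext; simp }

variable (J) in
/-- The coefficients of the endomorphism field `J` in the trivialization around `b₀`. -/
def endCoeff (b₀ b : B) : E →L[ℝ] E :=
  (coordVec b₀ b).comp ((J b).comp (ofCoord b₀ b))

lemma formCoeff_coordVec {b₀ b : B} (hb : b ∈ (chartAt E b₀).source)
    (v w : TangentSpace 𝓘(ℝ, E) b) :
    formCoeff h b₀ b (coordVec b₀ b v) (coordVec b₀ b w) = h b v w := by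
  change h b (ofCoord b₀ b _) (ofCoord b₀ b _) = _
  rw [ofCoord_coordVec hb, ofCoord_coordVec hb]

lemma endCoeff_coordVec {b₀ b : B} (hb : b ∈ (chartAt E b₀).source)
    (v : TangentSpace 𝓘(ℝ, E) b) :
    endCoeff J b₀ b (coordVec b₀ b v) = coordVec b₀ b (J b v) := by
  change coordVec b₀ b (J b (ofCoord b₀ b _)) = _
  rw [ofCoord_coordVec hb]

lemma christoffel_coordVec {b₀ b : B} (hb : b ∈ (chartAt E b₀).source) (a : E)
    (w : TangentSpace 𝓘(ℝ, E) b) :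
    christoffel D b₀ b a (coordVec b₀ b w) = coordVec b₀ b (D (fun b => ofCoord b₀ b a) b w) := by
  have hs := (chartAt E b₀).open_source.mem_nhds hb
  have ha : MDiffAlongAt (F := E) (fun b : B => b) (fun b => ofCoord b₀ b a) b :=
    mdiffAt_ofCoord hb a
  have h1 := coordVec_covAlong (D := D) (f := fun b : B => b) hb ha w
  have h2 : (fun q => coordVec b₀ q (ofCoord b₀ q a)) =ᶠ[𝓝 b] fun _ => a :=
    Filter.eventually_of_mem hs fun q hq => coordVec_ofCoord hq a
  have h3 : mfderiv 𝓘(ℝ, E) 𝓘(ℝ, E) (fun b : B => b) b w = w :=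
    congrArg (fun L : E →L[ℝ] E => L w) mfderiv_id
  rw [covAlong_id ha, mvfderiv_congr h2, coordVec_ofCoord hb, h3, mvfderiv_const] at h1
  rw [h1]
  simp

lemma IsKaehlerNorden.contMDiffOn_formCoeff (K : IsKaehlerNorden h J D) (b₀ : B) :
    ContMDiffOn 𝓘(ℝ, E) 𝓘(ℝ, E →L[ℝ] E →L[ℝ] ℝ) ∞ (formCoeff h b₀) (chartAt E b₀).source :=
  contMDiffOn_clm_of_apply fun a => contMDiffOn_clm_of_apply fun c => K.smooth_coeff b₀ a c

lemma IsKaehlerNorden.smoothFieldOn_apply_J (K : IsKaehlerNorden h J D)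
    {Y : Π b : B, TangentSpace 𝓘(ℝ, E) b} {U : Set B} (hY : SmoothFieldOn Y U) :
    SmoothFieldOn (fun b => J b (Y b)) U :=
  (K.J_smooth.contMDiffOn (s := U)).clm_bundle_apply hY

lemma IsKaehlerNorden.contMDiffOn_endCoeff (K : IsKaehlerNorden h J D) (b₀ : B) :
    ContMDiffOn 𝓘(ℝ, E) 𝓘(ℝ, E →L[ℝ] E) ∞ (endCoeff J b₀) (chartAt E b₀).source := by
  refine contMDiffOn_clm_of_apply fun a => ?_
  have h1 := K.smoothFieldOn_apply_J (smoothFieldOn_ofCoord b₀ a)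
  exact (smoothAlongOn_iff (f := fun b : B => b) contMDiffOn_id fun _ hp => hp).1 h1

lemma IsKaehlerNorden.mvfderiv_formCoeff (K : IsKaehlerNorden h J D) {b₀ b : B}
    (hb : b ∈ (chartAt E b₀).source) (w : TangentSpace 𝓘(ℝ, E) b) (a c : E) :
    mvfderiv 𝓘(ℝ, E) (formCoeff h b₀) b w a c =
      formCoeff h b₀ b (christoffel D b₀ b a (coordVec b₀ b w)) c +
      formCoeff h b₀ b a (christoffel D b₀ b c (coordVec b₀ b w)) := by
  have hs := (chartAt E b₀).open_source.mem_nhds hb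
  have hG : MDiffAt (formCoeff h b₀) b :=
    ((K.contMDiffOn_formCoeff b₀).contMDiffAt hs).mdifferentiableAt (by simp)
  have h1 := K.leviCivita.metric _ _ b w (mdiffAt_ofCoord hb a) (mdiffAt_ofCoord hb c)
  have h2 : mvfderiv 𝓘(ℝ, E) (fun q => formCoeff h b₀ q a c) b w =
      mvfderiv 𝓘(ℝ, E) (formCoeff h b₀) b w a c := by
    have hGa : MDiffAt (fun q => formCoeff h b₀ q a) b :=
      hG.clm_apply (f := fun _ => a) mdifferentiableAt_const
    rw [mvfderiv_clm_apply (u := fun _ => c) hGa mdifferentiableAt_const,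
      mvfderiv_clm_apply (u := fun _ => a) hG mdifferentiableAt_const]
    simp [mvfderiv_const]
  rw [← h2]
  refine h1.trans ?_
  rw [christoffel_coordVec hb, christoffel_coordVec hb, ← formCoeff_coordVec hb,
    ← formCoeff_coordVec hb, coordVec_ofCoord hb, coordVec_ofCoord hb]

lemma IsKaehlerNorden.mvfderiv_endCoeff (K : IsKaehlerNorden h J D) {b₀ b : B}
    (hb : b ∈ (chartAt E b₀).source) (w : TangentSpace 𝓘(ℝ, E) b) (a : E) :
    mvfderiv 𝓘(ℝ, E) (endCoeff J b₀) b w a +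
      christoffel D b₀ b (endCoeff J b₀ b a) (coordVec b₀ b w) =
      endCoeff J b₀ b (christoffel D b₀ b a (coordVec b₀ b w)) := by
  have hs := (chartAt E b₀).open_source.mem_nhds hb
  have hG : MDiffAt (endCoeff J b₀) b :=
    ((K.contMDiffOn_endCoeff b₀).contMDiffAt hs).mdifferentiableAt (by simp)
  have ha : MDiffAlongAt (F := E) (fun b : B => b) (fun b => J b (ofCoord b₀ b a)) b :=
    ((K.smoothFieldOn_apply_J (smoothFieldOn_ofCoord b₀ a)).contMDiffAt hs).mdifferentiableAt
      (by simp)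
  have h1 := coordVec_covAlong (D := D) (f := fun b : B => b) hb ha w
  have h3 : mfderiv 𝓘(ℝ, E) 𝓘(ℝ, E) (fun b : B => b) b w = w :=
    congrArg (fun L : E →L[ℝ] E => L w) mfderiv_id
  have h4 : mvfderiv 𝓘(ℝ, E) (fun q => coordVec b₀ q (J q (ofCoord b₀ q a))) b w =
      mvfderiv 𝓘(ℝ, E) (endCoeff J b₀) b w a := by
    refine (mvfderiv_clm_apply (u := fun _ => a) hG mdifferentiableAt_const w).trans ?_
    simp [mvfderiv_const]
  rw [covAlong_id ha, K.J_parallel _ b w (mdiffAt_ofCoord hb a), h3, h4] at h1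
  rw [christoffel_coordVec hb a, endCoeff_coordVec hb, h1]
  rfl

/-- The Christoffel tensor of a torsion-free connection is symmetric. -/
lemma IsKaehlerNorden.christoffel_symm (K : IsKaehlerNorden h J D) {b₀ b : B}
    (hb : b ∈ (chartAt E b₀).source) (a c : E) :
    christoffel D b₀ b a c = christoffel D b₀ b c a := by
  have hs := (chartAt E b₀).open_source.mem_nhds hb
  have h1 := (CovariantDerivative.torsion_eq_zero_iff (cov := D)).1 K.leviCivita.torsion_free
    (mdiffAt_ofCoord hb a) (mdiffAt_ofCoord hb c)
  have h2 : coordVec b₀ b (VectorField.mlieBracket 𝓘(ℝ, E) (fun b => ofCoord b₀ b a)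
      (fun b => ofCoord b₀ b c) b) = 0 := by
    rw [coordVec_eq_mvfderiv hb, ← mvfderiv_mlieBracket (chartAt E b₀).open_source hb
      (by simpa using contMDiffOn_extChartAt (I := 𝓘(ℝ, E)) (x := b₀)) (smoothFieldOn_ofCoord b₀ a)
      (smoothFieldOn_ofCoord b₀ c)]
    have h3 : ∀ d : E, (fun q => mvfderiv 𝓘(ℝ, E) (extChartAt 𝓘(ℝ, E) b₀) q (ofCoord b₀ q d))
        =ᶠ[𝓝 b] fun _ => d := fun d =>
      Filter.eventually_of_mem hs fun q hq =>
        (coordVec_eq_mvfderiv hq _).symm.trans (coordVec_ofCoord hq d)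
    rw [mvfderiv_congr (h3 a), mvfderiv_congr (h3 c)]
    simp [mvfderiv_const]
  have h4 := congrArg (coordVec b₀ b) h1
  rw [h2, map_sub, ← christoffel_coordVec hb, ← christoffel_coordVec hb, coordVec_ofCoord hb,
    coordVec_ofCoord hb, sub_eq_zero] at h4
  exact h4.symm

/-- The Koszul formula for the Christoffel tensor. -/
lemma IsKaehlerNorden.koszul (K : IsKaehlerNorden h J D) {b₀ b : B}
    (hb : b ∈ (chartAt E b₀).source) (a c d : E) :
    formCoeff h b₀ b (christoffel D b₀ b a c) d = 2⁻¹ * (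
      mvfderiv 𝓘(ℝ, E) (formCoeff h b₀) b (ofCoord b₀ b c) a d +
      mvfderiv 𝓘(ℝ, E) (formCoeff h b₀) b (ofCoord b₀ b a) c d -
      mvfderiv 𝓘(ℝ, E) (formCoeff h b₀) b (ofCoord b₀ b d) a c) := by
  have hsymm : ∀ x y, formCoeff h b₀ b x y = formCoeff h b₀ b y x := fun x y => K.symm _ _ _
  simp only [K.mvfderiv_formCoeff hb, coordVec_ofCoord hb]
  rw [K.christoffel_symm hb c a, K.christoffel_symm hb d a, K.christoffel_symm hb d c,
    hsymm a (christoffel D b₀ b c d), hsymm c (christoffel D b₀ b a d)]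
  ring

lemma IsKaehlerNorden.isInvertible_formCoeff (K : IsKaehlerNorden h J D) {b₀ b : B}
    (hb : b ∈ (chartAt E b₀).source) : (formCoeff h b₀ b).IsInvertible := by
  have hinj : Function.Injective (formCoeff h b₀ b).toLinearMap := by
    refine (injective_iff_map_eq_zero _).2 fun a ha => ?_
    have h1 : ofCoord b₀ b a = 0 := by
      refine K.nondegenerate b _ fun y => ?_
      rw [← formCoeff_coordVec hb, coordVec_ofCoord hb]
      exact congrArg (fun L : E →L[ℝ] ℝ => L _) ha
    rw [← coordVec_ofCoord hb a, h1, map_zero]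
  have hrank : finrank ℝ E = finrank ℝ (E →L[ℝ] ℝ) := by
    rw [← (LinearMap.toContinuousLinearMap : (E →ₗ[ℝ] ℝ) ≃ₗ[ℝ] (E →L[ℝ] ℝ)).finrank_eq,
      Module.finrank_linearMap_self]
  exact ⟨(LinearEquiv.ofInjectiveOfFinrankEq _ hinj hrank).toContinuousLinearEquiv, by ext; rfl⟩

/-- The Christoffel tensor is smooth, since by the Koszul formula it is obtained from first
derivatives of the metric coefficients by applying the inverse of the metric. -/
lemma IsKaehlerNorden.contMDiffOn_christoffel (K : IsKaehlerNorden h J D) (b₀ : B) :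
    ContMDiffOn 𝓘(ℝ, E) 𝓘(ℝ, E →L[ℝ] E →L[ℝ] E) ∞ (christoffel D b₀) (chartAt E b₀).source := by
  refine contMDiffOn_clm_of_apply fun a => contMDiffOn_clm_of_apply fun c => ?_
  have hG := K.contMDiffOn_formCoeff b₀
  have hdG : ∀ x : E, ContMDiffOn 𝓘(ℝ, E) 𝓘(ℝ, E →L[ℝ] E →L[ℝ] ℝ) ∞
      (fun b => mvfderiv 𝓘(ℝ, E) (formCoeff h b₀) b (ofCoord b₀ b x)) (chartAt E b₀).source :=
    fun x => contMDiffOn_mvfderiv_apply (chartAt E b₀).open_source hG (smoothFieldOn_ofCoord b₀ x)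
  have hdG' : ∀ x y z : E, ContMDiffOn 𝓘(ℝ, E) 𝓘(ℝ, ℝ) ∞
      (fun b => mvfderiv 𝓘(ℝ, E) (formCoeff h b₀) b (ofCoord b₀ b x) y z)
      (chartAt E b₀).source := fun x y z =>
    ((hdG x).clm_apply (contMDiffOn_const (c := y))).clm_apply (contMDiffOn_const (c := z))
  have hlow : ContMDiffOn 𝓘(ℝ, E) 𝓘(ℝ, E →L[ℝ] ℝ) ∞
      (fun b => formCoeff h b₀ b (christoffel D b₀ b a c)) (chartAt E b₀).source := by
    refine contMDiffOn_clm_of_apply fun d => ?_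
    refine ContMDiffOn.congr ?_ fun b hb => K.koszul hb a c d
    exact contMDiffOn_const.mul (((hdG' _ _ _).add (hdG' _ _ _)).sub (hdG' _ _ _))
  have hinv : ContMDiffOn 𝓘(ℝ, E) 𝓘(ℝ, (E →L[ℝ] ℝ) →L[ℝ] E) ∞
      (fun b => (formCoeff h b₀ b).inverse) (chartAt E b₀).source := by
    intro b hb
    obtain ⟨e, he⟩ := K.isInvertible_formCoeff hb
    have h1 := (contDiffAt_map_inverse (𝕜 := ℝ) (n := ∞) e).contMDiffAt
    rw [he] at h1
    exact h1.comp_contMDiffWithinAt b (hG b hb)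
  refine ContMDiffOn.congr (hinv.clm_apply hlow) fun b hb => ?_
  obtain ⟨e, he⟩ := K.isInvertible_formCoeff hb
  rw [← he, ContinuousLinearMap.inverse_equiv]
  exact (e.symm_apply_apply _).symm

end Coefficients

/-! ### Differential calculus along a map -/

section AlongCalculus

variable {E : Type*} [NormedAddCommGroup E] [NormedSpace ℝ E] [FiniteDimensional ℝ E]
  [CompleteSpace E]
  {B : Type*} [TopologicalSpace B] [ChartedSpace E B] [IsManifold 𝓘(ℝ, E) ∞ B]
  {F : Type*} [NormedAddCommGroup F] [NormedSpace ℝ F]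
  {M : Type*} [TopologicalSpace M] [ChartedSpace F M]
  {h : Π p : B, TangentSpace 𝓘(ℝ, E) p →L[ℝ] TangentSpace 𝓘(ℝ, E) p →L[ℝ] ℝ}
  {J : Π p : B, TangentSpace 𝓘(ℝ, E) p →L[ℝ] TangentSpace 𝓘(ℝ, E) p}
  {D : CovariantDerivative 𝓘(ℝ, E) E (TangentSpace 𝓘(ℝ, E) : B → Type _)}
  {f : M → B} {V W : Π p : M, TangentSpace 𝓘(ℝ, E) (f p)} {p : M} {U : Set M}

lemma isOpen_preimage_chart_source (hf : ContMDiff 𝓘(ℝ, F) 𝓘(ℝ, E) ∞ f) (b₀ : B) :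
    IsOpen (f ⁻¹' (chartAt E b₀).source) :=
  (chartAt E b₀).open_source.preimage hf.continuous

lemma IsKaehlerNorden.contMDiffOn_apply_apply (K : IsKaehlerNorden h J D)
    (hf : ContMDiff 𝓘(ℝ, F) 𝓘(ℝ, E) ∞ f)
    (hV : SmoothAlongOn (F := F) f V U) (hW : SmoothAlongOn (F := F) f W U) :
    ContMDiffOn 𝓘(ℝ, F) 𝓘(ℝ, ℝ) ∞ (fun q => h (f q) (V q) (W q)) U := by
  refine contMDiffOn_of_locally_contMDiffOn fun p hp => ⟨f ⁻¹' (chartAt E (f p)).source,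
    isOpen_preimage_chart_source hf _, mem_chart_source E (f p), ?_⟩
  have hV' := (smoothAlongOn_iff hf.contMDiffOn fun q hq => hq.2).1
    (hV.mono (inter_subset_left (t := f ⁻¹' (chartAt E (f p)).source)))
  have hW' := (smoothAlongOn_iff hf.contMDiffOn fun q hq => hq.2).1
    (hW.mono (inter_subset_left (t := f ⁻¹' (chartAt E (f p)).source)))
  have hG := (K.contMDiffOn_formCoeff (f p)).comp
    (hf.contMDiffOn (s := U ∩ f ⁻¹' (chartAt E (f p)).source)) fun q hq => hq.2
  exact ((hG.clm_apply hV').clm_apply hW').congr fun q hq => (formCoeff_coordVec hq.2 _ _).symm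

lemma IsKaehlerNorden.smoothAlongOn_J (K : IsKaehlerNorden h J D)
    (hf : ContMDiff 𝓘(ℝ, F) 𝓘(ℝ, E) ∞ f) (hV : SmoothAlongOn (F := F) f V U) :
    SmoothAlongOn (F := F) f (fun q => J (f q) (V q)) U := by
  refine smoothAlongOn_of_locally fun p hp => ⟨f ⁻¹' (chartAt E (f p)).source,
    isOpen_preimage_chart_source hf _, mem_chart_source E (f p), ?_⟩
  have hV' := (smoothAlongOn_iff hf.contMDiffOn fun q hq => hq.2).1
    (hV.mono (inter_subset_left (t := f ⁻¹' (chartAt E (f p)).source)))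
  have hG := (K.contMDiffOn_endCoeff (f p)).comp
    (hf.contMDiffOn (s := U ∩ f ⁻¹' (chartAt E (f p)).source)) fun q hq => hq.2
  exact (smoothAlongOn_iff hf.contMDiffOn fun q hq => hq.2).2
    ((hG.clm_apply hV').congr fun q hq => (endCoeff_coordVec hq.2 _).symm)

lemma SmoothAlongOn.add (hf : ContMDiff 𝓘(ℝ, F) 𝓘(ℝ, E) ∞ f)
    (hV : SmoothAlongOn (F := F) f V U) (hW : SmoothAlongOn (F := F) f W U) :
    SmoothAlongOn (F := F) f (fun q => V q + W q) U := by
  refine smoothAlongOn_of_locally fun p hp => ⟨f ⁻¹' (chartAt E (f p)).source,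
    isOpen_preimage_chart_source hf _, mem_chart_source E (f p), ?_⟩
  have hV' := (smoothAlongOn_iff hf.contMDiffOn fun q hq => hq.2).1
    (hV.mono (inter_subset_left (t := f ⁻¹' (chartAt E (f p)).source)))
  have hW' := (smoothAlongOn_iff hf.contMDiffOn fun q hq => hq.2).1
    (hW.mono (inter_subset_left (t := f ⁻¹' (chartAt E (f p)).source)))
  exact (smoothAlongOn_iff hf.contMDiffOn fun q hq => hq.2).2
    ((hV'.add hW').congr fun q hq => map_add _ _ _)

lemma SmoothAlongOn.smul (hf : ContMDiff 𝓘(ℝ, F) 𝓘(ℝ, E) ∞ f) {a : M → ℝ}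
    (ha : ContMDiffOn 𝓘(ℝ, F) 𝓘(ℝ, ℝ) ∞ a U) (hV : SmoothAlongOn (F := F) f V U) :
    SmoothAlongOn (F := F) f (fun q => a q • V q) U := by
  refine smoothAlongOn_of_locally fun p hp => ⟨f ⁻¹' (chartAt E (f p)).source,
    isOpen_preimage_chart_source hf _, mem_chart_source E (f p), ?_⟩
  have hV' := (smoothAlongOn_iff hf.contMDiffOn fun q hq => hq.2).1
    (hV.mono (inter_subset_left (t := f ⁻¹' (chartAt E (f p)).source)))
  exact (smoothAlongOn_iff hf.contMDiffOn fun q hq => hq.2).2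
    (((ha.mono inter_subset_left).smul hV').congr fun q hq => map_smul _ _ _)

lemma IsKaehlerNorden.mDiffAlongAt_J (K : IsKaehlerNorden h J D)
    (hV : MDiffAlongAt (F := F) f V p) : MDiffAlongAt (F := F) f (fun q => J (f q) (V q)) p := by
  have hp := mem_chart_source E (f p)
  have hs := (chartAt E (f p)).open_source.mem_nhds hp
  obtain ⟨hf, hV'⟩ := (mDiffAlongAt_iff hp).1 hV
  refine (mDiffAlongAt_iff hp).2 ⟨hf, ?_⟩
  have hG : MDiffAt (fun q => endCoeff J (f p) (f q)) p :=
    (((K.contMDiffOn_endCoeff (f p)).contMDiffAt hs).mdifferentiableAt (by simp)).comp p hf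
  refine (hG.clm_apply hV').congr_of_eventuallyEq ?_
  filter_upwards [hf.continuousAt.preimage_mem_nhds hs] with q hq
  exact (endCoeff_coordVec hq _).symm

/-- Compatibility with the metric, for fields along a map. -/
lemma IsKaehlerNorden.hasDeriv_apply_apply (K : IsKaehlerNorden h J D)
    (hV : MDiffAlongAt (F := F) f V p) (hW : MDiffAlongAt (F := F) f W p) :
    MDiffAt (fun q => h (f q) (V q) (W q)) p ∧ ∀ v : TangentSpace 𝓘(ℝ, F) p,
    mvfderiv 𝓘(ℝ, F) (fun q => h (f q) (V q) (W q)) p v =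
      h (f p) (covAlong D f V p v) (W p) + h (f p) (V p) (covAlong D f W p v) := by
  have hp := mem_chart_source E (f p)
  have hs := (chartAt E (f p)).open_source.mem_nhds hp
  obtain ⟨hf, hV'⟩ := (mDiffAlongAt_iff hp).1 hV
  have hW' := ((mDiffAlongAt_iff hp).1 hW).2
  have hG0 : MDiffAt (formCoeff h (f p)) (f p) :=
    ((K.contMDiffOn_formCoeff (f p)).contMDiffAt hs).mdifferentiableAt (by simp)
  have hG : MDiffAt (fun q => formCoeff h (f p) (f q)) p := hG0.comp p hf
  have heq : (fun q => h (f q) (V q) (W q)) =ᶠ[𝓝 p] fun q => formCoeff h (f p) (f q)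
      (coordVec (f p) (f q) (V q)) (coordVec (f p) (f q) (W q)) := by
    filter_upwards [hf.continuousAt.preimage_mem_nhds hs] with q hq
    exact (formCoeff_coordVec hq _ _).symm
  have hGV := hG.clm_apply hV'
  refine ⟨(hGV.clm_apply hW').congr_of_eventuallyEq heq, fun v => ?_⟩
  rw [mvfderiv_congr heq, mvfderiv_clm_apply hGV hW', mvfderiv_clm_apply hG hV',
    mvfderiv_comp_map hG0 hf, ← formCoeff_coordVec hp, ← formCoeff_coordVec hp,
    coordVec_covAlong hp hV, coordVec_covAlong hp hW]
  simp only [add_apply, K.mvfderiv_formCoeff hp, map_add]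
  ring

/-- `J` is parallel also for fields along a map. -/
lemma IsKaehlerNorden.covAlong_J (K : IsKaehlerNorden h J D)
    (hV : MDiffAlongAt (F := F) f V p) (v : TangentSpace 𝓘(ℝ, F) p) :
    covAlong D f (fun q => J (f q) (V q)) p v = J (f p) (covAlong D f V p v) := by
  have hp := mem_chart_source E (f p)
  have hs := (chartAt E (f p)).open_source.mem_nhds hp
  obtain ⟨hf, hV'⟩ := (mDiffAlongAt_iff hp).1 hV
  have hG0 : MDiffAt (endCoeff J (f p)) (f p) :=
    ((K.contMDiffOn_endCoeff (f p)).contMDiffAt hs).mdifferentiableAt (by simp)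
  have hG : MDiffAt (fun q => endCoeff J (f p) (f q)) p := hG0.comp p hf
  have heq : (fun q => coordVec (f p) (f q) (J (f q) (V q))) =ᶠ[𝓝 p]
      fun q => endCoeff J (f p) (f q) (coordVec (f p) (f q) (V q)) := by
    filter_upwards [hf.continuousAt.preimage_mem_nhds hs] with q hq
    exact (endCoeff_coordVec hq _).symm
  apply eq_of_coordVec_eq hp
  rw [coordVec_covAlong hp (K.mDiffAlongAt_J hV), mvfderiv_congr heq, mvfderiv_clm_apply hG hV',
    mvfderiv_comp_map hG0 hf, ← endCoeff_coordVec hp, ← endCoeff_coordVec hp,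
    coordVec_covAlong hp hV, map_add, ← K.mvfderiv_endCoeff hp]
  abel

end AlongCalculus

section AlongCurvature

variable {E : Type*} [NormedAddCommGroup E] [NormedSpace ℝ E] [FiniteDimensional ℝ E]
  [CompleteSpace E]
  {B : Type*} [TopologicalSpace B] [ChartedSpace E B] [IsManifold 𝓘(ℝ, E) ∞ B]
  {F : Type*} [NormedAddCommGroup F] [NormedSpace ℝ F]
  {M : Type*} [TopologicalSpace M] [ChartedSpace F M] [IsManifold 𝓘(ℝ, F) ∞ M]
  {h : Π p : B, TangentSpace 𝓘(ℝ, E) p →L[ℝ] TangentSpace 𝓘(ℝ, E) p →L[ℝ] ℝ}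
  {J : Π p : B, TangentSpace 𝓘(ℝ, E) p →L[ℝ] TangentSpace 𝓘(ℝ, E) p}
  {D : CovariantDerivative 𝓘(ℝ, E) E (TangentSpace 𝓘(ℝ, E) : B → Type _)}
  {f : M → B} {V W : Π p : M, TangentSpace 𝓘(ℝ, E) (f p)} {p : M} {U : Set M}
  {X Y : Π p : M, TangentSpace 𝓘(ℝ, F) p}

lemma SmoothFieldOn.mono {U' : Set M} (hX : SmoothFieldOn X U) (h : U' ⊆ U) :
    SmoothFieldOn X U' := ContMDiffOn.mono hX h

/-- The derivative of a smooth field along `f` in the direction of a smooth field is smooth. -/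
lemma IsKaehlerNorden.smoothAlongOn_covAlong (K : IsKaehlerNorden h J D)
    (hf : ContMDiff 𝓘(ℝ, F) 𝓘(ℝ, E) ∞ f) (hU : IsOpen U) (hV : SmoothAlongOn (F := F) f V U)
    (hX : SmoothFieldOn X U) :
    SmoothAlongOn (F := F) f (fun q => covAlong D f V q (X q)) U := by
  refine smoothAlongOn_of_locally fun p hp => ⟨f ⁻¹' (chartAt E (f p)).source,
    isOpen_preimage_chart_source hf _, mem_chart_source E (f p), ?_⟩
  set U' := U ∩ f ⁻¹' (chartAt E (f p)).source with hU'
  have hUo : IsOpen U' := hU.inter (isOpen_preimage_chart_source hf _)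
  have hV' := (smoothAlongOn_iff hf.contMDiffOn fun q hq => hq.2).1
    (hV.mono (inter_subset_left (t := f ⁻¹' (chartAt E (f p)).source)))
  have hX' := hX.mono (inter_subset_left (t := f ⁻¹' (chartAt E (f p)).source))
  have hdX := (smoothAlongOn_iff hf.contMDiffOn fun q hq => hq.2).1 (smoothAlongOn_mfderiv hf hX')
  have hG := (K.contMDiffOn_christoffel (f p)).comp (hf.contMDiffOn (s := U')) fun q hq => hq.2
  refine (smoothAlongOn_iff hf.contMDiffOn fun q hq => hq.2).2 ?_
  refine ContMDiffOn.congr ((contMDiffOn_mvfderiv_apply hUo hV' hX').add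
    ((hG.clm_apply hV').clm_apply hdX)) fun q hq => ?_
  exact coordVec_covAlong hq.2 ((hV.mono inter_subset_left).mDiffAlongAt (hUo.mem_nhds hq)) _

/-- In coordinates, the differential of `f` is the derivative of its coordinate expression. -/
lemma coordVec_mfderiv (hf : ContMDiff 𝓘(ℝ, F) 𝓘(ℝ, E) ∞ f) {b₀ : B}
    (hp : f p ∈ (chartAt E b₀).source) (v : TangentSpace 𝓘(ℝ, F) p) :
    coordVec b₀ (f p) (mfderiv 𝓘(ℝ, F) 𝓘(ℝ, E) f p v) =
      mvfderiv 𝓘(ℝ, F) (fun q => extChartAt 𝓘(ℝ, E) b₀ (f q)) p v := by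
  rw [coordVec_eq_mvfderiv hp]
  exact (mvfderiv_comp_map (mdifferentiableAt_extChartAt hp)
    (hf.mdifferentiableAt (by simp)) v).symm

lemma contMDiffOn_extChartAt_comp (hf : ContMDiff 𝓘(ℝ, F) 𝓘(ℝ, E) ∞ f) (b₀ : B) :
    ContMDiffOn 𝓘(ℝ, F) 𝓘(ℝ, E) ∞ (fun q => extChartAt 𝓘(ℝ, E) b₀ (f q))
      (f ⁻¹' (chartAt E b₀).source) :=
  (contMDiffOn_extChartAt (I := 𝓘(ℝ, E)) (x := b₀)).comp hf.contMDiffOn fun _ hq => hq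

/-- A torsion-free connection differentiates the differential of `f` symmetrically. -/
lemma IsKaehlerNorden.covAlong_mfderiv_sub [CompleteSpace F] (K : IsKaehlerNorden h J D)
    (hf : ContMDiff 𝓘(ℝ, F) 𝓘(ℝ, E) ∞ f) (hU : IsOpen U) (hp : p ∈ U) (hX : SmoothFieldOn X U)
    (hY : SmoothFieldOn Y U) :
    covAlong D f (fun q => mfderiv 𝓘(ℝ, F) 𝓘(ℝ, E) f q (Y q)) p (X p) -
      covAlong D f (fun q => mfderiv 𝓘(ℝ, F) 𝓘(ℝ, E) f q (X q)) p (Y p) =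
      mfderiv 𝓘(ℝ, F) 𝓘(ℝ, E) f p (VectorField.mlieBracket 𝓘(ℝ, F) X Y p) := by
  have hc := mem_chart_source E (f p)
  have hO := isOpen_preimage_chart_source hf (f p)
  have hpO : p ∈ U ∩ f ⁻¹' (chartAt E (f p)).source := ⟨hp, hc⟩
  have hs := hO.mem_nhds (show p ∈ f ⁻¹' (chartAt E (f p)).source from hc)
  have key : ∀ Z : (Π p : M, TangentSpace 𝓘(ℝ, F) p),
      (fun q => coordVec (f p) (f q) (mfderiv 𝓘(ℝ, F) 𝓘(ℝ, E) f q (Z q))) =ᶠ[𝓝 p]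
      fun q => mvfderiv 𝓘(ℝ, F) (fun q => extChartAt 𝓘(ℝ, E) (f p) (f q)) q (Z q) := fun Z =>
    Filter.eventually_of_mem hs fun q hq => coordVec_mfderiv hf hq _
  have hb := mvfderiv_mlieBracket (hU.inter hO) hpO
    ((contMDiffOn_extChartAt_comp hf (f p)).mono inter_subset_right)
    (hX.mono inter_subset_left) (hY.mono inter_subset_left)
  apply eq_of_coordVec_eq hc
  rw [map_sub, coordVec_mfderiv hf hc, ← hb, coordVec_covAlong hc
    ((smoothAlongOn_mfderiv hf hY).mDiffAlongAt (hU.mem_nhds hp)), coordVec_covAlong hc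
    ((smoothAlongOn_mfderiv hf hX).mDiffAlongAt (hU.mem_nhds hp)), mvfderiv_congr (key X),
    mvfderiv_congr (key Y), K.christoffel_symm hc]
  abel

variable (D) in
/-- The curvature tensor in coordinates, in terms of the Christoffel tensor. -/
def curvatureCoeff (b₀ b : B) (v w : TangentSpace 𝓘(ℝ, E) b) (z : E) : E :=
  mvfderiv 𝓘(ℝ, E) (christoffel D b₀) b v z (coordVec b₀ b w)
    - mvfderiv 𝓘(ℝ, E) (christoffel D b₀) b w z (coordVec b₀ b v)
    + christoffel D b₀ b (christoffel D b₀ b z (coordVec b₀ b w)) (coordVec b₀ b v)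
    - christoffel D b₀ b (christoffel D b₀ b z (coordVec b₀ b v)) (coordVec b₀ b w)

/-- The curvature of the connection along `f`, in coordinates. It depends on the fields only through
their values at the point. -/
lemma IsKaehlerNorden.coordVec_curvature_along [CompleteSpace F] (K : IsKaehlerNorden h J D)
    (hf : ContMDiff 𝓘(ℝ, F) 𝓘(ℝ, E) ∞ f) (hU : IsOpen U) (hp : p ∈ U) (hX : SmoothFieldOn X U)
    (hY : SmoothFieldOn Y U) (hV : SmoothAlongOn (F := F) f V U) {b₀ : B}
    (hc : f p ∈ (chartAt E b₀).source) :
    coordVec b₀ (f p) (covAlong D f (fun q => covAlong D f V q (Y q)) p (X p)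
      - covAlong D f (fun q => covAlong D f V q (X q)) p (Y p)
      - covAlong D f V p (VectorField.mlieBracket 𝓘(ℝ, F) X Y p)) =
    curvatureCoeff D b₀ (f p) (mfderiv 𝓘(ℝ, F) 𝓘(ℝ, E) f p (X p))
      (mfderiv 𝓘(ℝ, F) 𝓘(ℝ, E) f p (Y p)) (coordVec b₀ (f p) (V p)) := by
  have hfp : MDifferentiableAt 𝓘(ℝ, F) 𝓘(ℝ, E) f p := hf.mdifferentiableAt (by simp)
  have hO := isOpen_preimage_chart_source hf b₀
  set U' := U ∩ f ⁻¹' (chartAt E b₀).source with hU'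
  have hUo : IsOpen U' := hU.inter hO
  have hpU : p ∈ U' := ⟨hp, hc⟩
  have hn := hUo.mem_nhds hpU
  have hV0 := hV.mono (inter_subset_left (t := f ⁻¹' (chartAt E b₀).source))
  have hVc : ContMDiffOn 𝓘(ℝ, F) 𝓘(ℝ, E) ∞ (fun q => coordVec b₀ (f q) (V q)) U' :=
    (smoothAlongOn_iff hf.contMDiffOn fun q hq => hq.2).1 hV0
  have hΓ0 : MDiffAt (christoffel D b₀) (f p) :=
    ((K.contMDiffOn_christoffel b₀).contMDiffAt
      ((chartAt E b₀).open_source.mem_nhds hc)).mdifferentiableAt (by simp)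
  have hΓ : MDiffAt (fun q => christoffel D b₀ (f q)) p := hΓ0.comp p hfp
  have hu : ContMDiffOn 𝓘(ℝ, F) 𝓘(ℝ, E) ∞ (fun q => extChartAt 𝓘(ℝ, E) b₀ (f q)) U' :=
    (contMDiffOn_extChartAt_comp hf b₀).mono inter_subset_right
  have hMD : ∀ {w : M → E}, ContMDiffOn 𝓘(ℝ, F) 𝓘(ℝ, E) ∞ w U' → MDiffAt w p := fun hw =>
    (hw.contMDiffAt hn).mdifferentiableAt (by simp)
  -- the iterated derivative in coordinates
  have key : ∀ X Y : (Π p : M, TangentSpace 𝓘(ℝ, F) p), SmoothFieldOn X U → SmoothFieldOn Y U →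
      coordVec b₀ (f p) (covAlong D f (fun q => covAlong D f V q (Y q)) p (X p)) =
      mvfderiv 𝓘(ℝ, F) (fun q =>
        mvfderiv 𝓘(ℝ, F) (fun q => coordVec b₀ (f q) (V q)) q (Y q)) p (X p)
      + (mvfderiv 𝓘(ℝ, E) (christoffel D b₀) (f p) (mfderiv 𝓘(ℝ, F) 𝓘(ℝ, E) f p (X p))
          (coordVec b₀ (f p) (V p)) (coordVec b₀ (f p) (mfderiv 𝓘(ℝ, F) 𝓘(ℝ, E) f p (Y p)))
        + christoffel D b₀ (f p)
          (mvfderiv 𝓘(ℝ, F) (fun q => coordVec b₀ (f q) (V q)) p (X p))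
          (coordVec b₀ (f p) (mfderiv 𝓘(ℝ, F) 𝓘(ℝ, E) f p (Y p)))
        + christoffel D b₀ (f p) (coordVec b₀ (f p) (V p))
          (mvfderiv 𝓘(ℝ, F) (fun q => mvfderiv 𝓘(ℝ, F)
            (fun q => extChartAt 𝓘(ℝ, E) b₀ (f q)) q (Y q)) p (X p)))
      + christoffel D b₀ (f p)
          (mvfderiv 𝓘(ℝ, F) (fun q => coordVec b₀ (f q) (V q)) p (Y p) +
            christoffel D b₀ (f p) (coordVec b₀ (f p) (V p))
              (coordVec b₀ (f p) (mfderiv 𝓘(ℝ, F) 𝓘(ℝ, E) f p (Y p))))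
          (coordVec b₀ (f p) (mfderiv 𝓘(ℝ, F) 𝓘(ℝ, E) f p (X p))) := by
    intro X Y hX hY
    have hYV : MDiffAlongAt (F := F) f (fun q => covAlong D f V q (Y q)) p :=
      (K.smoothAlongOn_covAlong hf hU hV hY).mDiffAlongAt (hU.mem_nhds hp)
    have hdY : ContMDiffOn 𝓘(ℝ, F) 𝓘(ℝ, E) ∞
        (fun q => mvfderiv 𝓘(ℝ, F) (fun q => coordVec b₀ (f q) (V q)) q (Y q)) U' :=
      contMDiffOn_mvfderiv_apply hUo hVc (hY.mono inter_subset_left)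
    have hduY : ContMDiffOn 𝓘(ℝ, F) 𝓘(ℝ, E) ∞
        (fun q => mvfderiv 𝓘(ℝ, F) (fun q => extChartAt 𝓘(ℝ, E) b₀ (f q)) q (Y q)) U' :=
      contMDiffOn_mvfderiv_apply hUo hu (hY.mono inter_subset_left)
    have hloc : (fun q => coordVec b₀ (f q) (covAlong D f V q (Y q))) =ᶠ[𝓝 p] fun q =>
        mvfderiv 𝓘(ℝ, F) (fun q => coordVec b₀ (f q) (V q)) q (Y q) +
        christoffel D b₀ (f q) (coordVec b₀ (f q) (V q))
          (mvfderiv 𝓘(ℝ, F) (fun q => extChartAt 𝓘(ℝ, E) b₀ (f q)) q (Y q)) :=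
      Filter.eventually_of_mem hn fun q hq => by
        have h1 := coordVec_covAlong (D := D) hq.2 (hV0.mDiffAlongAt (hUo.mem_nhds hq)) (Y q)
        rw [coordVec_mfderiv hf hq.2] at h1
        exact h1
    have hΓV := hΓ.clm_apply (hMD hVc)
    rw [coordVec_covAlong hc hYV, mvfderiv_congr hloc, mvfderiv_fun_add (hMD hdY)
      (hΓV.clm_apply (hMD hduY))]
    have h2 := mvfderiv_clm_apply hΓV (hMD hduY) (X p)
    have h3 := mvfderiv_clm_apply hΓ (hMD hVc) (X p)
    have h4 := coordVec_covAlong (D := D) hc (hV.mDiffAlongAt (hU.mem_nhds hp)) (Y p)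
    rw [h4]
    refine congrArg (· + _) ?_
    refine congrArg (_ + ·) (h2.trans ?_)
    rw [h3, mvfderiv_comp_map hΓ0 hfp, coordVec_mfderiv hf hc (Y p)]
    rfl
  have hbV := mvfderiv_mlieBracket hUo hpU hVc (hX.mono inter_subset_left)
    (hY.mono inter_subset_left)
  have hbu := mvfderiv_mlieBracket hUo hpU hu (hX.mono inter_subset_left)
    (hY.mono inter_subset_left)
  rw [map_sub, map_sub, key X Y hX hY, key Y X hY hX,
    coordVec_covAlong hc (hV.mDiffAlongAt (hU.mem_nhds hp)), coordVec_mfderiv hf hc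
      (VectorField.mlieBracket 𝓘(ℝ, F) X Y p), ← hbV, ← hbu, curvatureCoeff]
  simp only [map_add, map_sub, add_apply]
  abel

end AlongCurvature

/-! ### The ambient curvature tensor and its symmetries -/

section AmbientCurvature

variable {E : Type*} [NormedAddCommGroup E] [NormedSpace ℝ E] [FiniteDimensional ℝ E]
  [CompleteSpace E]
  {B : Type*} [TopologicalSpace B] [ChartedSpace E B] [IsManifold 𝓘(ℝ, E) ∞ B]
  {F : Type*} [NormedAddCommGroup F] [NormedSpace ℝ F]
  {M : Type*} [TopologicalSpace M] [ChartedSpace F M] [IsManifold 𝓘(ℝ, F) ∞ M]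
  {h : Π p : B, TangentSpace 𝓘(ℝ, E) p →L[ℝ] TangentSpace 𝓘(ℝ, E) p →L[ℝ] ℝ}
  {J : Π p : B, TangentSpace 𝓘(ℝ, E) p →L[ℝ] TangentSpace 𝓘(ℝ, E) p}
  {D : CovariantDerivative 𝓘(ℝ, E) E (TangentSpace 𝓘(ℝ, E) : B → Type _)}

variable (D) in
/-- The curvature tensor of a connection on the ambient manifold. -/
def ambientCurvature (b : B) (x y z : TangentSpace 𝓘(ℝ, E) b) : TangentSpace 𝓘(ℝ, E) b :=
  curvatureTensor (fun Y q v => D Y q v) b x y z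

/-- The identity in the form `fun b => b`, for which the type of fields along the map unfolds to the
type of vector fields. -/
lemma contMDiff_self_map {E B : Type*} [NormedAddCommGroup E] [NormedSpace ℝ E]
    [TopologicalSpace B] [ChartedSpace E B] : ContMDiff 𝓘(ℝ, E) 𝓘(ℝ, E) ∞ (fun b : B => b) :=
  contMDiff_id

lemma IsKaehlerNorden.curvatureOfFields_eq_covAlong (K : IsKaehlerNorden h J D) {b : B} {U : Set B}
    {X Y Z : Π b : B, TangentSpace 𝓘(ℝ, E) b} (hU : IsOpen U) (hb : b ∈ U)
    (hX : SmoothFieldOn X U) (hY : SmoothFieldOn Y U) (hZ : SmoothFieldOn Z U) :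
    curvatureOfFields (fun Y q v => D Y q v) X Y Z b =
      covAlong D (fun b : B => b) (fun q => covAlong D (fun b : B => b) Z q (Y q)) b (X b)
      - covAlong D (fun b : B => b) (fun q => covAlong D (fun b : B => b) Z q (X q)) b (Y b)
      - covAlong D (fun b : B => b) Z b (VectorField.mlieBracket 𝓘(ℝ, E) X Y b) := by
  have hZm : ∀ q ∈ U, MDiffAt (T% Z) q := fun q hq =>
    SmoothAlongOn.mDiffAlongAt (f := fun b : B => b) hZ (hU.mem_nhds hq)
  have key : ∀ X Y : (Π b : B, TangentSpace 𝓘(ℝ, E) b), SmoothFieldOn X U → SmoothFieldOn Y U →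
      covAlong D (fun b : B => b) (fun q => covAlong D (fun b : B => b) Z q (Y q)) b (X b) =
      D (fun q => D Z q (Y q)) b (X b) := by
    intro X Y hX hY
    have hs : SmoothFieldOn (fun q => D Z q (Y q)) U :=
      (K.smoothAlongOn_covAlong contMDiff_self_map hU hZ hY).congr
        fun q hq => (covAlong_id (hZm q hq) _).symm
    rw [← covAlong_id (D := D) (SmoothAlongOn.mDiffAlongAt (f := fun b : B => b) hs
      (hU.mem_nhds hb)) (X b)]
    refine covAlong_congr (f := fun b : B => b) continuousAt_id ?_ _
    exact Filter.eventually_of_mem (hU.mem_nhds hb) fun q hq => covAlong_id (hZm q hq) _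
  rw [key X Y hX hY, key Y X hY hX, covAlong_id (hZm b hb)]
  rfl

lemma IsKaehlerNorden.coordVec_curvatureOfFields (K : IsKaehlerNorden h J D) {b₀ b : B} {U : Set B}
    {X Y Z : Π b : B, TangentSpace 𝓘(ℝ, E) b} (hU : IsOpen U) (hb : b ∈ U)
    (hX : SmoothFieldOn X U) (hY : SmoothFieldOn Y U) (hZ : SmoothFieldOn Z U)
    (hc : b ∈ (chartAt E b₀).source) :
    coordVec b₀ b (curvatureOfFields (fun Y q v => D Y q v) X Y Z b) =
      curvatureCoeff D b₀ b (X b) (Y b) (coordVec b₀ b (Z b)) := by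
  have h3 : ∀ w, mfderiv 𝓘(ℝ, E) 𝓘(ℝ, E) (fun b : B => b) b w = w := fun w =>
    congrArg (fun L : E →L[ℝ] E => L w) mfderiv_id
  have h1 := K.coordVec_curvature_along contMDiff_self_map hU hb hX hY hZ hc
  rw [K.curvatureOfFields_eq_covAlong hU hb hX hY hZ]
  refine h1.trans ?_
  erw [h3, h3]

lemma IsKaehlerNorden.coordVec_ambientCurvature (K : IsKaehlerNorden h J D) {b₀ b : B}
    (hc : b ∈ (chartAt E b₀).source) (x y z : TangentSpace 𝓘(ℝ, E) b) :
    coordVec b₀ b (ambientCurvature D b x y z) = curvatureCoeff D b₀ b x y (coordVec b₀ b z) := by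
  have h1 := K.coordVec_curvatureOfFields (chartAt E b).open_source (mem_chart_source E b)
    (smoothFieldOn_extend x) (smoothFieldOn_extend y) (smoothFieldOn_extend z) hc
  simp only [FiberBundle.extend_apply_self] at h1
  exact h1

/-- The curvature of the connection along `f` is the ambient curvature tensor. -/
lemma IsKaehlerNorden.curvature_along [CompleteSpace F] (K : IsKaehlerNorden h J D)
    {f : M → B} {V : Π p : M, TangentSpace 𝓘(ℝ, E) (f p)} {p : M} {U : Set M}
    {X Y : Π p : M, TangentSpace 𝓘(ℝ, F) p}
    (hf : ContMDiff 𝓘(ℝ, F) 𝓘(ℝ, E) ∞ f) (hU : IsOpen U) (hp : p ∈ U) (hX : SmoothFieldOn X U)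
    (hY : SmoothFieldOn Y U) (hV : SmoothAlongOn (F := F) f V U) :
    covAlong D f (fun q => covAlong D f V q (Y q)) p (X p)
      - covAlong D f (fun q => covAlong D f V q (X q)) p (Y p)
      - covAlong D f V p (VectorField.mlieBracket 𝓘(ℝ, F) X Y p) =
    ambientCurvature D (f p) (mfderiv 𝓘(ℝ, F) 𝓘(ℝ, E) f p (X p))
      (mfderiv 𝓘(ℝ, F) 𝓘(ℝ, E) f p (Y p)) (V p) := by
  have hc := mem_chart_source E (f p)
  exact eq_of_coordVec_eq hc ((K.coordVec_curvature_along hf hU hp hX hY hV hc).trans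
    (K.coordVec_ambientCurvature hc _ _ _).symm)

variable {b : B}

set_option synthInstance.maxHeartbeats 200000 in
lemma IsKaehlerNorden.ambientCurvature_add_left (K : IsKaehlerNorden h J D)
    (x x' y z : TangentSpace 𝓘(ℝ, E) b) :
    ambientCurvature D b (x + x') y z =
      ambientCurvature D b x y z + ambientCurvature D b x' y z := by
  have hc := mem_chart_source E b
  apply eq_of_coordVec_eq hc
  rw [map_add]
  simp only [K.coordVec_ambientCurvature hc, curvatureCoeff, map_add, add_apply]
  abel

set_option synthInstance.maxHeartbeats 200000 in
lemma IsKaehlerNorden.ambientCurvature_smul_left (K : IsKaehlerNorden h J D) (a : ℝ)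
    (x y z : TangentSpace 𝓘(ℝ, E) b) :
    ambientCurvature D b (a • x) y z = a • ambientCurvature D b x y z := by
  have hc := mem_chart_source E b
  apply eq_of_coordVec_eq hc
  rw [map_smul]
  simp only [K.coordVec_ambientCurvature hc, curvatureCoeff, map_smul, smul_apply, smul_sub,
    smul_add]

lemma IsKaehlerNorden.ambientCurvature_antisymm (K : IsKaehlerNorden h J D)
    (x y z : TangentSpace 𝓘(ℝ, E) b) :
    ambientCurvature D b x y z = -ambientCurvature D b y x z := by
  have hc := mem_chart_source E b
  apply eq_of_coordVec_eq hc
  rw [map_neg]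
  simp only [K.coordVec_ambientCurvature hc, curvatureCoeff]
  abel

/-- The first Bianchi identity. -/
lemma IsKaehlerNorden.ambientCurvature_bianchi (K : IsKaehlerNorden h J D)
    (x y z : TangentSpace 𝓘(ℝ, E) b) :
    ambientCurvature D b x y z + ambientCurvature D b y z x + ambientCurvature D b z x y = 0 := by
  have hc := mem_chart_source E b
  have hs := (chartAt E b).open_source.mem_nhds hc
  have hΓ : MDiffAt (christoffel D b) b :=
    ((K.contMDiffOn_christoffel b).contMDiffAt hs).mdifferentiableAt (by simp)
  have hsymm : ∀ (v : TangentSpace 𝓘(ℝ, E) b) (a c : E),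
      mvfderiv 𝓘(ℝ, E) (christoffel D b) b v a c = mvfderiv 𝓘(ℝ, E) (christoffel D b) b v c a := by
    intro v a c
    have h1 : ∀ a c : E, mvfderiv 𝓘(ℝ, E) (fun q => christoffel D b q a c) b v =
        mvfderiv 𝓘(ℝ, E) (christoffel D b) b v a c := by
      intro a c
      have hΓa : MDiffAt (fun q => christoffel D b q a) b :=
        hΓ.clm_apply (f := fun _ => a) mdifferentiableAt_const
      rw [mvfderiv_clm_apply (u := fun _ => c) hΓa mdifferentiableAt_const,
        mvfderiv_clm_apply (u := fun _ => a) hΓ mdifferentiableAt_const]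
      simp [mvfderiv_const]
    rw [← h1, ← h1, mvfderiv_congr (Filter.eventually_of_mem hs
      fun q hq => K.christoffel_symm hq a c)]
  apply eq_of_coordVec_eq hc
  rw [map_add, map_add, map_zero]
  simp only [K.coordVec_ambientCurvature hc, curvatureCoeff]
  rw [hsymm x (coordVec b b z), hsymm y (coordVec b b x), hsymm z (coordVec b b y),
    K.christoffel_symm hc (coordVec b b z) (coordVec b b y),
    K.christoffel_symm hc (coordVec b b x) (coordVec b b z),
    K.christoffel_symm hc (coordVec b b y) (coordVec b b x)]
  abel

/-- The curvature operators commute with `J`. -/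
lemma IsKaehlerNorden.ambientCurvature_J (K : IsKaehlerNorden h J D)
    (x y z : TangentSpace 𝓘(ℝ, E) b) :
    ambientCurvature D b x y (J b z) = J b (ambientCurvature D b x y z) := by
  have hc := mem_chart_source E b
  have hU := (chartAt E b).open_source
  have hX := smoothFieldOn_extend x
  have hY := smoothFieldOn_extend y
  have hZ := smoothFieldOn_extend z
  have hJZ := K.smoothFieldOn_apply_J hZ
  have h1 := K.coordVec_curvatureOfFields hU hc hX hY hJZ hc
  rw [K.curvatureOfFields_eq_covAlong hU hc hX hY hJZ] at h1
  have key : ∀ X Y : (Π b : B, TangentSpace 𝓘(ℝ, E) b), SmoothFieldOn X (chartAt E b).source →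
      SmoothFieldOn Y (chartAt E b).source →
      covAlong D (fun b : B => b) (fun q => covAlong D (fun b : B => b)
        (fun q => J q (FiberBundle.extend E z q)) q (Y q)) b (X b) =
      J b (covAlong D (fun b : B => b) (fun q => covAlong D (fun b : B => b)
        (FiberBundle.extend E z) q (Y q)) b (X b)) := by
    intro X Y hX hY
    have hs := K.smoothAlongOn_covAlong contMDiff_self_map hU hZ hY
    refine Eq.trans ?_ (K.covAlong_J (hs.mDiffAlongAt (hU.mem_nhds hc)) _)
    refine covAlong_congr (f := fun b : B => b) continuousAt_id ?_ _
    exact Filter.eventually_of_mem (hU.mem_nhds hc) fun q hq =>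
      K.covAlong_J (SmoothAlongOn.mDiffAlongAt (f := fun b : B => b) hZ (hU.mem_nhds hq)) _
  rw [key _ _ hX hY, key _ _ hY hX] at h1
  have h2 := K.covAlong_J (SmoothAlongOn.mDiffAlongAt (f := fun b : B => b) hZ (hU.mem_nhds hc))
    (VectorField.mlieBracket 𝓘(ℝ, E) (FiberBundle.extend E x) (FiberBundle.extend E y) b)
  simp only [FiberBundle.extend_apply_self] at h1 h2
  have h3 := K.curvatureOfFields_eq_covAlong hU hc hX hY hZ
  simp only [FiberBundle.extend_apply_self] at h3
  apply eq_of_coordVec_eq hc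
  rw [K.coordVec_ambientCurvature hc, ← h1]
  refine congrArg (coordVec b b) ?_
  refine (congrArg (_ - ·) h2).trans ?_
  rw [← map_sub, ← map_sub, ← h3]
  rfl

/-- The curvature operators are skew-adjoint: the second derivatives of `h(Z, W)` commute up to the
bracket. -/
lemma IsKaehlerNorden.ambientCurvature_skew (K : IsKaehlerNorden h J D)
    (x y z w : TangentSpace 𝓘(ℝ, E) b) :
    h b (ambientCurvature D b x y z) w = -h b z (ambientCurvature D b x y w) := by
  have hc := mem_chart_source E b
  have hU := (chartAt E b).open_source
  have hX := smoothFieldOn_extend x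
  have hY := smoothFieldOn_extend y
  have hZ : SmoothAlongOn (F := E) (fun b : B => b) (FiberBundle.extend E z) (chartAt E b).source :=
    smoothFieldOn_extend z
  have hW : SmoothAlongOn (F := E) (fun b : B => b) (FiberBundle.extend E w) (chartAt E b).source :=
    smoothFieldOn_extend w
  have hb := mvfderiv_mlieBracket hU hc (K.contMDiffOn_apply_apply contMDiff_self_map hZ hW) hX hY
  have hn := hU.mem_nhds hc
  have key : ∀ X Y : (Π b : B, TangentSpace 𝓘(ℝ, E) b), SmoothFieldOn X (chartAt E b).source →
      SmoothFieldOn Y (chartAt E b).source →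
      mvfderiv 𝓘(ℝ, E) (fun q => mvfderiv 𝓘(ℝ, E) (fun q => h q (FiberBundle.extend E z q)
        (FiberBundle.extend E w q)) q (Y q)) b (X b) =
      (h b (covAlong D (fun b : B => b) (fun q => covAlong D (fun b : B => b)
          (FiberBundle.extend E z) q (Y q)) b (X b)) w +
        h b (covAlong D (fun b : B => b) (FiberBundle.extend E z) b (Y b))
          (covAlong D (fun b : B => b) (FiberBundle.extend E w) b (X b))) +
      (h b (covAlong D (fun b : B => b) (FiberBundle.extend E z) b (X b))
          (covAlong D (fun b : B => b) (FiberBundle.extend E w) b (Y b)) +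
        h b z (covAlong D (fun b : B => b) (fun q => covAlong D (fun b : B => b)
          (FiberBundle.extend E w) q (Y q)) b (X b))) := by
    intro X Y hX hY
    have h1 : (fun q => mvfderiv 𝓘(ℝ, E) (fun q => h q (FiberBundle.extend E z q)
        (FiberBundle.extend E w q)) q (Y q)) =ᶠ[𝓝 b] fun q =>
        h q (covAlong D (fun b : B => b) (FiberBundle.extend E z) q (Y q))
          (FiberBundle.extend E w q)
        + h q (FiberBundle.extend E z q)
          (covAlong D (fun b : B => b) (FiberBundle.extend E w) q (Y q)) :=
      Filter.eventually_of_mem hn fun q hq => (K.hasDeriv_apply_apply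
        (hZ.mDiffAlongAt (hU.mem_nhds hq)) (hW.mDiffAlongAt (hU.mem_nhds hq))).2 _
    have hZY := (K.smoothAlongOn_covAlong contMDiff_self_map hU hZ hY).mDiffAlongAt hn
    have hWY := (K.smoothAlongOn_covAlong contMDiff_self_map hU hW hY).mDiffAlongAt hn
    have h2 := K.hasDeriv_apply_apply hZY (hW.mDiffAlongAt hn)
    have h3 := K.hasDeriv_apply_apply (hZ.mDiffAlongAt hn) hWY
    rw [mvfderiv_congr h1]
    refine (congrArg (fun L : E →L[ℝ] ℝ => L (X b)) (mvfderiv_fun_add h2.1 h3.1)).trans ?_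
    refine (congrArg₂ (· + ·) (h2.2 (X b)) (h3.2 (X b))).trans ?_
    simp only [FiberBundle.extend_apply_self]
  have h4 := (K.hasDeriv_apply_apply (hZ.mDiffAlongAt hn) (hW.mDiffAlongAt hn)).2
    (VectorField.mlieBracket 𝓘(ℝ, E) (FiberBundle.extend E x) (FiberBundle.extend E y) b)
  have h5 := (key _ _ hX hY).symm
  have h6 := (key _ _ hY hX).symm
  have h7 := K.curvatureOfFields_eq_covAlong hU hc hX hY hZ
  have h8 := K.curvatureOfFields_eq_covAlong hU hc hX hY hW
  have h9 : h b (curvatureOfFields (fun Y q v => D Y q v) (FiberBundle.extend E x)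
      (FiberBundle.extend E y) (FiberBundle.extend E z) b) w + h b z
      (curvatureOfFields (fun Y q v => D Y q v) (FiberBundle.extend E x)
      (FiberBundle.extend E y) (FiberBundle.extend E w) b) = 0 := by
    rw [h7, h8]
    simp only [map_sub, sub_apply]
    rw [h4] at hb
    simp only [FiberBundle.extend_apply_self] at hb h5 h6 ⊢
    linarith
  exact eq_neg_of_add_eq_zero_left h9

end AmbientCurvature

/-! ### Curvature tensors with constant totally real sectional curvatures -/

section CurvatureAlgebra

/-- A quadrilinear form (additivity and homogeneity are only required in enough slots) with the
algebraic symmetries of a Riemannian curvature tensor. -/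
structure IsCurvatureLike {T : Type*} [AddCommGroup T] [Module ℝ T] (S : T → T → T → T → ℝ) :
    Prop where
  add_first : ∀ x x' y z w, S (x + x') y z w = S x y z w + S x' y z w
  smul_first : ∀ (a : ℝ) x y z w, S (a • x) y z w = a * S x y z w
  add_last : ∀ x y z w w', S x y z (w + w') = S x y z w + S x y z w'
  antisymm_left : ∀ x y z w, S x y z w = -S y x z w
  antisymm_right : ∀ x y z w, S x y z w = -S x y w z
  bianchi : ∀ x y z w, S x y z w + S y z x w + S z x y w = 0

namespace IsCurvatureLike

variable {T : Type*} [AddCommGroup T] [Module ℝ T] {S : T → T → T → T → ℝ}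

lemma pair_symm (hS : IsCurvatureLike S) (x y z w : T) : S x y z w = S z w x y := by
  linarith [hS.bianchi x y z w, hS.bianchi y z w x, hS.bianchi z w x y, hS.bianchi w x y z,
    hS.antisymm_right y z x w, hS.antisymm_right z x w y, hS.antisymm_right z w x y,
    hS.antisymm_right w x y z, hS.antisymm_right y w x z, hS.antisymm_right x y w z,
    hS.antisymm_left z x y w, hS.antisymm_left w y z x, hS.antisymm_left x z w y,
    hS.antisymm_left y w x z, hS.antisymm_left z x w y,
    hS.antisymm_left w y x z, hS.antisymm_right z x y w, hS.antisymm_right w y z x]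

lemma add_second (hS : IsCurvatureLike S) (x y y' z w : T) :
    S x (y + y') z w = S x y z w + S x y' z w := by
  rw [hS.antisymm_left, hS.add_first, hS.antisymm_left y, hS.antisymm_left y']; ring

lemma add_third (hS : IsCurvatureLike S) (x y z z' w : T) :
    S x y (z + z') w = S x y z w + S x y z' w := by
  rw [hS.antisymm_right, hS.add_last, hS.antisymm_right x y w, hS.antisymm_right x y w]; ring

/-- A curvature-like form is determined by its sectional values. -/
lemma eq_zero_of_sectional {W : Submodule ℝ T} (hS : IsCurvatureLike S)
    (h : ∀ x ∈ W, ∀ y ∈ W, S x y y x = 0) {x y z w : T} (hx : x ∈ W) (hy : y ∈ W) (hz : z ∈ W)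
    (hw : w ∈ W) : S x y z w = 0 := by
  have h1 : ∀ x ∈ W, ∀ y ∈ W, ∀ z ∈ W, S x y z x = 0 := by
    intro x hx y hy z hz
    have := h x hx (y + z) (W.add_mem hy hz)
    rw [hS.add_second, hS.add_third, hS.add_third, h x hx y hy, h x hx z hz] at this
    have h2 := hS.pair_symm x y z x
    linarith [hS.antisymm_left x z y x, hS.antisymm_right z x x y]
  have h2 : ∀ x ∈ W, ∀ y ∈ W, ∀ z ∈ W, ∀ w ∈ W, S x y z w = -S x z y w := by
    intro x hx y hy z hz w hw
    have := h1 (x + w) (W.add_mem hx hw) y hy z hz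
    rw [hS.add_first, hS.add_last, hS.add_last, h1 x hx y hy z hz, h1 w hw y hy z hz] at this
    linarith [hS.pair_symm w y z x, hS.antisymm_left z x w y, hS.antisymm_right x z w y]
  linarith [h2 x hx y hy z hz w hw, h2 y hy z hz x hx w hw, hS.bianchi x y z w,
    hS.antisymm_left x z y w, hS.antisymm_left y x z w]

/-- In a curvature-like form for which `J` can be moved within the last pair, it can be moved
everywhere. -/
lemma J_first (hS : IsCurvatureLike S) {J : T → T} (hJ : ∀ x y z w, S x y (J z) w = S x y z (J w))
    (x y z w : T) : S (J x) y z w = S x y z (J w) := by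
  have h1 : ∀ x y z w, S (J x) y z w = S x (J y) z w := fun x y z w => by
    rw [hS.pair_symm, hJ, hS.pair_symm]
  have h2 : ∀ x y z, S (J x) y z w - S x y z (J w) + (S (J z) x y w - S z x y (J w)) = 0 := by
    intro x y z
    linarith [hS.bianchi (J x) y z w, hS.bianchi x y z (J w), hJ y z x w, h1 z x y w]
  linarith [h2 x y z, h2 y z x, h2 z x y]

/-- If `T` is the complexification of `W`, a curvature-like form that is compatible with `J` is
determined by the sectional values on `W` of the form itself and of its `J`-twist. -/
lemma eq_zero_of_totallyReal (hS : IsCurvatureLike S) {J : T →ₗ[ℝ] T}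
    (hJ : ∀ x y z w, S x y (J z) w = S x y z (J w)) {W : Submodule ℝ T}
    (hW : ∀ t, ∃ x ∈ W, ∃ y ∈ W, t = x + J y) (h₁ : ∀ x ∈ W, ∀ y ∈ W, S x y y x = 0)
    (h₂ : ∀ x ∈ W, ∀ y ∈ W, S x y y (J x) = 0) (x y z w : T) : S x y z w = 0 := by
  have hS' : IsCurvatureLike fun x y z w => S x y z (J w) :=
    { add_first := fun x x' y z w => hS.add_first _ _ _ _ _
      smul_first := fun a x y z w => hS.smul_first _ _ _ _ _
      add_last := fun x y z w w' => by simp only [map_add]; exact hS.add_last _ _ _ _ _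
      antisymm_left := fun x y z w => hS.antisymm_left _ _ _ _
      antisymm_right := fun x y z w => by
        rw [hS.antisymm_right, hJ]
      bianchi := fun x y z w => hS.bianchi _ _ _ _ }
  have g₁ : ∀ x ∈ W, ∀ y ∈ W, ∀ z ∈ W, ∀ w ∈ W, S x y z w = 0 :=
    fun x hx y hy z hz w hw => hS.eq_zero_of_sectional h₁ hx hy hz hw
  have g₂ : ∀ x ∈ W, ∀ y ∈ W, ∀ z ∈ W, ∀ w ∈ W, S x y z (J w) = 0 :=
    fun x hx y hy z hz w hw => hS'.eq_zero_of_sectional h₂ hx hy hz hw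
  have k₁ : ∀ x y, x ∈ W → y ∈ W → ∀ z ∈ W, ∀ w, S x y z w = 0 := by
    intro x y hx hy z hz w
    obtain ⟨a, ha, c, hc, rfl⟩ := hW w
    rw [hS.add_last, g₁ x hx y hy z hz a ha, g₂ x hx y hy z hz c hc, add_zero]
  have k₂ : ∀ x y, x ∈ W → y ∈ W → ∀ z w, S x y z w = 0 := by
    intro x y hx hy z w
    obtain ⟨a, ha, c, hc, rfl⟩ := hW z
    rw [hS.add_third, hJ, k₁ x y hx hy a ha, k₁ x y hx hy c hc, add_zero]
  have k₃ : ∀ x y, x ∈ W → ∀ z w, S x y z w = 0 := by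
    intro x y hx z w
    obtain ⟨a, ha, c, hc, rfl⟩ := hW y
    rw [hS.add_second, hS.antisymm_left x (J c), hS.J_first hJ, k₂ x a hx ha, k₂ c x hc hx,
      neg_zero, add_zero]
  obtain ⟨a, ha, c, hc, rfl⟩ := hW x
  rw [hS.add_first, hS.J_first hJ, k₃ a y ha, k₃ c y hc, add_zero]

end IsCurvatureLike

/-- For a Norden form `g` on `(T, J)`, the space `T` is the complexification of a totally real
subspace on which `g` is positive definite: an orthonormal basis of the complex bilinear form
`g(x,y) - i g(Jx,y)` spans one. -/
lemma exists_totallyReal_posDef {T : Type*} [AddCommGroup T] [Module ℝ T] [FiniteDimensional ℝ T]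
    (g : T →ₗ[ℝ] T →ₗ[ℝ] ℝ) (J : T →ₗ[ℝ] T) (hsymm : ∀ x y, g x y = g y x)
    (hnd : ∀ x, (∀ y, g x y = 0) → x = 0) (hJ : ∀ x, J (J x) = -x)
    (hN : ∀ x y, g (J x) (J y) = -g x y) :
    ∃ W : Submodule ℝ T, (∀ x ∈ W, ∀ y ∈ W, g (J x) y = 0) ∧ (∀ x ∈ W, x ≠ 0 → 0 < g x x) ∧
      ∀ t, ∃ x ∈ W, ∃ y ∈ W, t = x + J y := by
  have hJs : ∀ x y, g (J x) y = g x (J y) := fun x y => by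
    have := hN x (J y)
    rw [hJ, map_neg] at this
    linarith
  let _ : Module ℂ T :=
    { smul := fun c x => c.re • x + c.im • J x
      one_smul := fun x => by change (1 : ℂ).re • x + (1 : ℂ).im • J x = x; simp
      mul_smul := fun c d x => by
        change (c * d).re • x + (c * d).im • J x =
          c.re • (d.re • x + d.im • J x) + c.im • J (d.re • x + d.im • J x)
        simp only [Complex.mul_re, Complex.mul_im, map_add, map_smul, hJ]
        module
      smul_zero := fun c => by change c.re • (0 : T) + c.im • J 0 = 0; simp
      smul_add := fun c x y => by
        change c.re • (x + y) + c.im • J (x + y) =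
          (c.re • x + c.im • J x) + (c.re • y + c.im • J y)
        rw [map_add]; module
      add_smul := fun c d x => by
        change (c + d).re • x + (c + d).im • J x =
          (c.re • x + c.im • J x) + (d.re • x + d.im • J x)
        rw [Complex.add_re, Complex.add_im]; module
      zero_smul := fun x => by change (0 : ℂ).re • x + (0 : ℂ).im • J x = 0; simp }
  have hsm : ∀ (c : ℂ) (x : T), c • x = c.re • x + c.im • J x := fun _ _ => rfl
  have _ : IsScalarTower ℝ ℂ T := ⟨fun r c x => by
    simp only [hsm, Complex.smul_re, Complex.smul_im, smul_eq_mul]; module⟩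
  have _ : FiniteDimensional ℂ T := FiniteDimensional.right ℝ ℂ T
  let q : LinearMap.BilinForm ℂ T := LinearMap.mk₂ ℂ
    (fun x y => (g x y : ℂ) - Complex.I * (g (J x) y : ℂ))
    (fun x x' y => by simp; ring)
    (fun c x y => by
      rw [hsm]
      apply Complex.ext <;> simp [hJ]; ring)
    (fun x y y' => by simp; ring)
    (fun c x y => by
      rw [hsm]
      apply Complex.ext <;> simp [hN, ← hJs]; ring)
  have hq : ∀ x y, q x y = (g x y : ℂ) - Complex.I * (g (J x) y : ℂ) := fun x y => rfl
  have hqs : ∀ x y, q x y = q y x := fun x y => by rw [hq, hq, hsymm, hJs, hsymm x (J y)]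
  have hassoc : QuadraticMap.associated (R := ℂ) q.toQuadraticMap = q :=
    QuadraticMap.associated_left_inverse ℂ fun x y => hqs x y
  obtain ⟨e⟩ := QuadraticForm.equivalent_weightedSumSquares_of_isAlgClosed q.toQuadraticMap (by
    rw [hassoc]
    intro x hx
    refine hnd x fun y => ?_
    have := congrArg Complex.re (hx y)
    simpa [hq] using this)
  have hQ : ∀ x, q x x = ∑ i, e x i * e x i := fun x => by
    have := e.map_app x
    rw [QuadraticMap.weightedSumSquares_apply] at this
    simpa using this.symm
  have hQ2 : ∀ x y, q x y = ∑ i, e x i * e y i := fun x y => by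
    have h1 := hQ (x + y)
    have he : e (x + y) = e x + e y := map_add e.toLinearEquiv x y
    have h2 : ∑ i, e (x + y) i * e (x + y) i =
        (∑ i, e x i * e x i) + (∑ i, e y i * e y i) + 2 * ∑ i, e x i * e y i := by
      rw [he, Finset.mul_sum, ← Finset.sum_add_distrib, ← Finset.sum_add_distrib]
      exact Finset.sum_congr rfl fun i _ => by simp only [Pi.add_apply]; ring
    rw [h2, ← hQ, ← hQ] at h1
    simp only [map_add, LinearMap.add_apply] at h1
    rw [hqs y x] at h1
    linear_combination h1 / 2
  have hsmul : ∀ (r : ℝ) x, e (r • x) = (r : ℂ) • e x := fun r x => by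
    have h1 : r • x = (r : ℂ) • x := by rw [hsm]; simp
    rw [h1]
    exact map_smul e.toLinearEquiv _ _
  have hJI : ∀ x, J x = Complex.I • x := fun x => by rw [hsm]; simp
  let W : Submodule ℝ T :=
    { carrier := {x | ∀ i, (e x i).im = 0}
      add_mem' := fun {x y} hx hy i => by
        have he : e (x + y) = e x + e y := map_add e.toLinearEquiv x y
        rw [he]; simp [hx i, hy i]
      zero_mem' := fun i => by
        have he : e 0 = 0 := map_zero e.toLinearEquiv
        rw [he]; simp
      smul_mem' := fun r x hx i => by rw [hsmul]; simp [hx i] }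
  refine ⟨W, fun x hx y hy => ?_, fun x hx hx0 => ?_, fun t => ?_⟩
  · have h1 := congrArg Complex.im (hQ2 x y)
    have h2 : ∀ i, (e x i).im = 0 := hx
    have h3 : ∀ i, (e y i).im = 0 := hy
    simpa [hq, h2, h3] using h1
  · have h1 := congrArg Complex.re (hQ2 x x)
    have h2 : ∀ i, (e x i).im = 0 := hx
    simp only [hq, h2, Complex.sub_re, Complex.ofReal_re, Complex.mul_re, Complex.I_re, zero_mul,
      Complex.I_im, Complex.ofReal_im, mul_zero, sub_zero, Complex.re_sum] at h1
    rw [h1]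
    obtain ⟨i, hi⟩ : ∃ i, e x i ≠ 0 := by
      by_contra! hc
      exact hx0 (e.toLinearEquiv.map_eq_zero_iff.1 (funext hc))
    refine Finset.sum_pos' (fun i _ => mul_self_nonneg _) ⟨i, Finset.mem_univ i, ?_⟩
    exact mul_self_pos.2 fun h0 => hi (Complex.ext h0 (h2 i))
  · refine ⟨e.toLinearEquiv.symm fun i => ((e t i).re : ℂ), ?_,
      e.toLinearEquiv.symm fun i => ((e t i).im : ℂ), ?_, ?_⟩
    · intro i
      change (e.toLinearEquiv (e.toLinearEquiv.symm _) i).im = 0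
      rw [LinearEquiv.apply_symm_apply]; simp
    · intro i
      change (e.toLinearEquiv (e.toLinearEquiv.symm _) i).im = 0
      rw [LinearEquiv.apply_symm_apply]; simp
    · rw [hJI, ← map_smul, ← map_add]
      refine (e.toLinearEquiv.eq_symm_apply).2 (funext fun i => ?_)
      change e t i = ((e t i).re : ℂ) + Complex.I * ((e t i).im : ℂ)
      rw [mul_comm, Complex.re_add_im]

/-- The algebraic form of the curvature tensor of a Kähler-Norden manifold of constant totally real
sectional curvatures. -/
theorem curvature_eq_of_totallyReal_const {T : Type*} [AddCommGroup T] [Module ℝ T]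
    [FiniteDimensional ℝ T] (g : T →ₗ[ℝ] T →ₗ[ℝ] ℝ) (J : T →ₗ[ℝ] T) (R : T → T → T → T)
    (hsymm : ∀ x y, g x y = g y x) (hnd : ∀ x, (∀ y, g x y = 0) → x = 0)
    (hJ : ∀ x, J (J x) = -x) (hN : ∀ x y, g (J x) (J y) = -g x y)
    (hadd : ∀ x x' y z, R (x + x') y z = R x y z + R x' y z)
    (hsmul : ∀ (a : ℝ) x y z, R (a • x) y z = a • R x y z)
    (hanti : ∀ x y z, R x y z = -R y x z)
    (hbianchi : ∀ x y z, R x y z + R y z x + R z x y = 0)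
    (hRJ : ∀ x y z, R x y (J z) = J (R x y z))
    (hskew : ∀ x y z w, g (R x y z) w = -g z (R x y w)) {ν νt : ℝ}
    (hcurv : ∀ x y, g y y * g x x - g x y * g y x ≠ 0 → g (J x) x = 0 → g (J x) y = 0 →
      g (J y) x = 0 → g (J y) y = 0 →
      g (R x y y) x / (g y y * g x x - g x y * g y x) = ν ∧
      g (R x y y) (J x) / (g y y * g x x - g x y * g y x) = νt) (x y z : T) :
    R x y z = ν • (g y z • x - g x z • y - g (J y) z • J x + g (J x) z • J y)
      - νt • (g y z • J x - g x z • J y + g (J y) z • x - g (J x) z • y) := by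
  have hJs : ∀ x y, g (J x) y = g x (J y) := fun x y => by
    have := hN x (J y)
    rw [hJ, map_neg] at this
    linarith
  obtain ⟨W, hW₁, hW₂, hW₃⟩ := exists_totallyReal_posDef g J hsymm hnd hJ hN
  -- the model tensor; its difference to `R` has vanishing sectional values on `W`
  let R₀ : T → T → T → T := fun x y z =>
    ν • (g y z • x - g x z • y - g (J y) z • J x + g (J x) z • J y)
      - νt • (g y z • J x - g x z • J y + g (J y) z • x - g (J x) z • y)
  have hR₀ : ∀ x y z w, g (R₀ x y z) w =
      ν * (g y z * g x w - g x z * g y w - g (J y) z * g (J x) w + g (J x) z * g (J y) w)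
      - νt * (g y z * g (J x) w - g x z * g (J y) w + g (J y) z * g x w - g (J x) z * g y w) :=
    fun x y z w => by simp [R₀]; ring
  let S : T → T → T → T → ℝ := fun x y z w => g (R x y z) w - g (R₀ x y z) w
  have hSdef : ∀ x y z w, S x y z w = g (R x y z) w -
      (ν * (g y z * g x w - g x z * g y w - g (J y) z * g (J x) w + g (J x) z * g (J y) w)
      - νt * (g y z * g (J x) w - g x z * g (J y) w + g (J y) z * g x w - g (J x) z * g y w)) :=
    fun x y z w => by rw [← hR₀]
  have hS : IsCurvatureLike S :=
    { add_first := fun x x' y z w => by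
        simp only [hSdef, hadd, map_add, LinearMap.add_apply]; ring
      smul_first := fun a x y z w => by
        simp only [hSdef, hsmul, map_smul, LinearMap.smul_apply, smul_eq_mul]; ring
      add_last := fun x y z w w' => by simp only [hSdef, map_add]; ring
      antisymm_left := fun x y z w => by
        simp only [hSdef]; rw [hanti x y z, map_neg, LinearMap.neg_apply]; ring
      antisymm_right := fun x y z w => by
        simp only [hSdef]; rw [hskew x y z w, hsymm z]; ring
      bianchi := fun x y z w => by
        simp only [hSdef]
        have h1 : g (R x y z) w + g (R y z x) w + g (R z x y) w = 0 := by
          rw [← LinearMap.add_apply, ← LinearMap.add_apply, ← map_add, ← map_add, hbianchi,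
            map_zero, LinearMap.zero_apply]
        rw [hsymm x z, hsymm y x, hsymm z y, hJs x z, hJs y x, hJs z y, hsymm x (J z),
          hsymm y (J x), hsymm z (J y)]
        linear_combination h1 }
  have hSJ : ∀ x y z w, S x y (J z) w = S x y z (J w) := fun x y z w => by
    simp only [hSdef]
    rw [hRJ, hJs (R x y z) w, hN x w, hN y w, hN x z, hN y z, ← hJs x z, ← hJs y z, ← hJs x w,
      ← hJs y w]
    ring
  have hS0 : ∀ x ∈ W, ∀ y ∈ W, S x y y x = 0 ∧ S x y y (J x) = 0 := by
    intro x hx y hy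
    by_cases hg : g y y * g x x - g x y * g y x = 0
    -- on the definite space `W`, degenerate planes come from dependent vectors only
    · rcases eq_or_ne x 0 with rfl | hx0
      · have h0 : ∀ z w, S 0 y z w = 0 := fun z w => by
          have := hS.smul_first 0 0 y z w
          rwa [zero_smul, zero_mul] at this
        exact ⟨h0 _ _, h0 _ _⟩
      · have hpos := hW₂ x hx hx0
        have hu : g x x • y - g x y • x = 0 := by
          by_contra hne
          have h1 := hW₂ _ (W.sub_mem (W.smul_mem _ hy) (W.smul_mem _ hx)) hne
          have h2 : g (g x x • y - g x y • x) (g x x • y - g x y • x) =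
              g x x * (g y y * g x x - g x y * g y x) := by
            simp only [map_sub, map_smul, LinearMap.sub_apply, LinearMap.smul_apply, smul_eq_mul]
            rw [hsymm y x]; ring
          rw [h2, hg, mul_zero] at h1
          exact lt_irrefl _ h1
        have h0 : ∀ z w, S x y z w = 0 := fun z w => by
          have h1 := hS.smul_first (g x x) y x z w
          rw [sub_eq_zero.1 hu, hS.smul_first] at h1
          have h2 := hS.antisymm_left x x z w
          have h3 : S x x z w = 0 := by linarith
          rw [h3, mul_zero] at h1
          rw [hS.antisymm_left, (mul_eq_zero.1 h1.symm).resolve_left hpos.ne', neg_zero]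
        exact ⟨h0 _ _, h0 _ _⟩
    · obtain ⟨h1, h2⟩ := hcurv x y hg (hW₁ x hx x hx) (hW₁ x hx y hy) (hW₁ y hy x hx)
        (hW₁ y hy y hy)
      rw [div_eq_iff hg] at h1 h2
      constructor
      · rw [hSdef, h1, hW₁ x hx x hx, hW₁ x hx y hy, hW₁ y hy x hx, hW₁ y hy y hy]
        ring
      · rw [hSdef, h2, hN, hN, ← hJs x x, ← hJs y x, hW₁ x hx x hx, hW₁ x hx y hy, hW₁ y hy x hx,
          hW₁ y hy y hy]
        ring
  have hzero := hS.eq_zero_of_totallyReal hSJ hW₃ (fun x hx y hy => (hS0 x hx y hy).1)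
    (fun x hx y hy => (hS0 x hx y hy).2)
  have : R x y z - R₀ x y z = 0 := hnd _ fun w => by
    rw [map_sub, LinearMap.sub_apply]
    exact hzero x y z w
  exact sub_eq_zero.1 this

end CurvatureAlgebra

/-! ### The ambient curvature in terms of either Norden metric -/

section CurvatureForm

variable {E : Type*} [NormedAddCommGroup E] [NormedSpace ℝ E] [FiniteDimensional ℝ E]
  [CompleteSpace E]
  {B : Type*} [TopologicalSpace B] [ChartedSpace E B] [IsManifold 𝓘(ℝ, E) ∞ B]

/-- The curvature tensor is the one of a Kähler-Norden manifold with constant totally real sectional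
curvatures `ν` and `κ` with respect to the Norden metric `h`. -/
def HasCurvatureForm
    (h : Π p : B, TangentSpace 𝓘(ℝ, E) p →L[ℝ] TangentSpace 𝓘(ℝ, E) p →L[ℝ] ℝ)
    (J : Π p : B, TangentSpace 𝓘(ℝ, E) p →L[ℝ] TangentSpace 𝓘(ℝ, E) p)
    (D : CovariantDerivative 𝓘(ℝ, E) E (TangentSpace 𝓘(ℝ, E) : B → Type _)) (ν κ : B → ℝ) : Prop :=
  ∀ (b : B) (x y z : TangentSpace 𝓘(ℝ, E) b), ambientCurvature D b x y z =
    ν b • (h b y z • x - h b x z • y - h b (J b y) z • J b x + h b (J b x) z • J b y)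
      - κ b • (h b y z • J b x - h b x z • J b y + h b (J b y) z • x - h b (J b x) z • y)

variable (K : KaehlerNorden E B) {ν νt : B → ℝ}

lemma KaehlerNorden.HasConstantTotallyRealCurvatures.hasCurvatureForm
    (hν : K.HasConstantTotallyRealCurvatures ν νt) :
    HasCurvatureForm K.g K.J K.nabla ν νt := by
  intro b x y z
  have _ : FiniteDimensional ℝ (TangentSpace 𝓘(ℝ, E) b) := inferInstanceAs (FiniteDimensional ℝ E)
  have hK := K.isKaehlerNorden
  exact curvature_eq_of_totallyReal_const
    (LinearMap.mk₂ ℝ (fun x y => K.g b x y) (by simp) (by simp) (by simp) (by simp))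
    (K.J b).toLinearMap (fun x y z => ambientCurvature K.nabla b x y z)
    (K.g_symm b) (K.g_nondegenerate b) (K.J_sq b) (K.norden b) hK.ambientCurvature_add_left
    hK.ambientCurvature_smul_left hK.ambientCurvature_antisymm hK.ambientCurvature_bianchi
    hK.ambientCurvature_J hK.ambientCurvature_skew
    (fun x y hg h1 h2 h3 h4 => hν b x y hg h1 h2 h3 h4)
    x y z

/-- Passing to the associated Norden metric exchanges the two sectional curvatures, up to sign. -/
lemma KaehlerNorden.HasConstantTotallyRealCurvatures.hasCurvatureForm_assoc
    (hν : K.HasConstantTotallyRealCurvatures ν νt) :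
    HasCurvatureForm K.assoc K.J K.nabla (fun b => -νt b) ν := by
  intro b x y z
  rw [hν.hasCurvatureForm K b x y z]
  have h1 : ∀ x y, K.assoc b x y = K.g b (K.J b x) y := fun _ _ => rfl
  simp only [h1, K.J_sq, map_neg, neg_apply]
  module

end CurvatureForm

/-! ### Algebra of the tangent space of the hypersurface -/

section RadicalFrame

/-- The algebraic structure of the tangent space of a radical transversal lightlike hypersurface:
`H` is the induced degenerate form with radical spanned by `ξ`, `η` is the form dual to `ξ` that
vanishes on the screen, and `φ` is the tangential part of `J`. The form induced by the second Norden
metric is `b η ⊗ η + H(φ ·, ·)`. The screen is the kernel of `η`. -/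
structure IsRadicalFrame {V : Type*} [AddCommGroup V] [Module ℝ V] (H : V →ₗ[ℝ] V →ₗ[ℝ] ℝ)
    (φ : V →ₗ[ℝ] V) (η : V →ₗ[ℝ] ℝ) (ξ : V) (b : ℝ) : Prop where
  symm : ∀ x y, H x y = H y x
  radical : ∀ y, H ξ y = 0
  eta_xi : η ξ = 1
  phi_xi : φ ξ = 0
  eta_phi : ∀ x, η (φ x) = 0
  phi_sq : ∀ x, φ (φ x) = -x + η x • ξ
  phi_symm : ∀ x y, H (φ x) y = H x (φ y)
  nondegenerate : ∀ x, (∀ y, H x y = 0) → x = η x • ξ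
  b_ne_zero : b ≠ 0
  exists_screen : ∃ v, η v = 0 ∧ v ≠ 0

namespace IsRadicalFrame

variable {V : Type*} [AddCommGroup V] [Module ℝ V] {H : V →ₗ[ℝ] V →ₗ[ℝ] ℝ}
    {φ : V →ₗ[ℝ] V} {η : V →ₗ[ℝ] ℝ} {ξ : V} {b : ℝ} (A : IsRadicalFrame H φ η ξ b)
include A

lemma eq_zero_of_screen {x : V} (hx : η x = 0) (h : ∀ y, η y = 0 → H x y = 0) : x = 0 := by
  have h1 : x = η x • ξ := A.nondegenerate x fun y => by
    have h2 := h (y - η y • ξ) (by simp [A.eta_xi])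
    rw [map_sub, map_smul, A.symm x ξ, A.radical] at h2
    simpa using h2
  rw [h1, hx, zero_smul]

/-- On the screen, the two induced forms are linearly independent. -/
lemma eq_zero_of_proportional {a c : ℝ}
    (h : ∀ x y, η x = 0 → η y = 0 → a * H (φ x) y = c * H x y) : a = 0 ∧ c = 0 := by
  obtain ⟨v, hv, hv0⟩ := A.exists_screen
  have h1 : ∀ x, η x = 0 → a • φ x - c • x = 0 := fun x hx =>
    A.eq_zero_of_screen (by simp [A.eta_phi, hx]) fun y hy => by
      simp [h x y hx hy]
  have h2 := h1 v hv
  have h3 := h1 (φ v) (A.eta_phi v)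
  rw [A.phi_sq, hv, zero_smul, add_zero] at h3
  have h4 : (a * a + c * c) • v = 0 := by
    have : (a * a + c * c) • v = -(a • (a • -v - c • φ v)) - c • (a • φ v - c • v) := by module
    rw [this, h2, h3, smul_zero, smul_zero, neg_zero, sub_zero]
  have h5 := (smul_eq_zero.1 h4).resolve_right hv0
  constructor <;> nlinarith [mul_self_nonneg a, mul_self_nonneg c]

/-- Since `φ² = -1` on the screen, `H(v, w) v + H(φ v, w) φ v = 0` forces
`H(v, w)² + H(φ v, w)² = 0`; this fails for suitable `v` and `w`. -/
lemma eq_zero_of_screen_products {a : ℝ}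
    (h : ∀ v w, η v = 0 → η w = 0 → a • (H v w • v + H (φ v) w • φ v) = 0) : a = 0 := by
  obtain ⟨v, hv, hv0⟩ := A.exists_screen
  obtain ⟨w, hw, hvw⟩ : ∃ w, η w = 0 ∧ H v w ≠ 0 := by
    by_contra! hc
    exact hv0 (A.eq_zero_of_screen hv hc)
  by_contra ha
  have h1 := (smul_eq_zero.1 (h v w hv hw)).resolve_left ha
  have h2 := congrArg φ h1
  simp only [map_add, map_smul, A.phi_sq, hv, map_zero] at h2
  have h3 : (H v w * H v w + H (φ v) w * H (φ v) w) • v = 0 := by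
    have : (H v w * H v w + H (φ v) w * H (φ v) w) • v =
        H v w • (H v w • v + H (φ v) w • φ v) -
        H (φ v) w • (H v w • φ v + H (φ v) w • (-v + (0 : ℝ) • ξ)) := by module
    rw [this, h1, h2]; simp
  have h4 := (smul_eq_zero.1 h3).resolve_right hv0
  exact hvw (by nlinarith [mul_self_nonneg (H v w), mul_self_nonneg (H (φ v) w)])

variable {κ μ : ℝ} {Ht : V → V → ℝ} (hHt : ∀ x y, Ht x y = b * η x * η y + H (φ x) y)
  {R : V → V → V → V}
  (hR : ∀ x y z, R x y z = -κ • (Ht y z • x - Ht x z • y) + μ • (H y z • φ x - H x z • φ y))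
include hHt

lemma tilde_symm (x y : V) : Ht x y = Ht y x := by
  rw [hHt, hHt, A.phi_symm, A.symm]; ring

lemma tilde_xi (y : V) : Ht ξ y = b * η y := by
  rw [hHt, A.eta_xi, A.phi_xi]; simp

lemma tilde_screen {x y : V} (hx : η x = 0) : Ht x y = H (φ x) y := by
  rw [hHt, hx]; ring

include hR

lemma curvature_xi (y z : V) : R ξ y z = -κ • (Ht y z • ξ - (b * η z) • y) := by
  rw [hR, A.tilde_xi hHt, A.radical, A.phi_xi]; simp

/-- If `R` is semi-symmetric, the `φ`-part of `R` vanishes: this follows from `R(ξ, φ v)` acting on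
`R(ξ, v) w` for `v` and `w` in the screen. -/
lemma eq_zero_of_semiSymmetric (hκ : κ ≠ 0)
    (h : ∀ x y u v w, R x y (R u v w) - R u v (R x y w) - R (R x y u) v w - R u (R x y v) w = 0) :
    μ = 0 := by
  have hab : κ * b * μ = 0 := A.eq_zero_of_screen_products fun v w hv hw => by
    have hφ := A.eta_phi v
    have h1 := h ξ (φ v) ξ v w
    have e1 : ∀ y z, η z = 0 → R ξ y z = -(κ * Ht y z) • ξ := fun y z hz => by
      rw [A.curvature_xi hHt hR, hz]; module
    have e2 : ∀ y, η y = 0 → ∀ a : ℝ, R ξ y (a • ξ) = (κ * b * a) • y := fun y hy a => by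
      rw [A.curvature_xi hHt hR, A.tilde_symm hHt, hHt]
      simp only [map_smul, A.eta_xi, A.phi_xi, hy]
      simp
      module
    have e3 : ∀ a : ℝ, R ξ (a • ξ) w = 0 := fun a => by
      rw [A.curvature_xi hHt hR, A.tilde_symm hHt, hHt, hw]
      simp [A.symm (φ w) ξ, A.radical]
    have e2' : R ξ (φ v) ξ = (κ * b) • φ v := by
      have := e2 (φ v) hφ 1
      rwa [one_smul, mul_one] at this
    rw [e1 v w hw, e1 (φ v) w hw, e2 (φ v) hφ, e2 v hv, e2', e1 (φ v) v hv, e3, hR,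
      hHt ((κ * b) • φ v)] at h1
    simp only [map_smul, LinearMap.smul_apply, A.phi_sq, hv, hφ, hw, A.tilde_screen hHt hv,
      A.tilde_screen hHt hφ, smul_eq_mul] at h1
    rw [← h1]
    simp
    module
  exact (mul_eq_zero.1 hab).resolve_left (mul_ne_zero hκ A.b_ne_zero)

/-- Without its `φ`-part, `R` has the algebraic form of a tensor of constant curvature for the
symmetric form `Ht`, and such a tensor is semi-symmetric. -/
lemma semiSymmetric_of_eq_zero (hμ : μ = 0) (x y u v w : V) :
    R x y (R u v w) - R u v (R x y w) - R (R x y u) v w - R u (R x y v) w = 0 := by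
  let G : V →ₗ[ℝ] V →ₗ[ℝ] ℝ := LinearMap.mk₂ ℝ Ht (fun x x' y => by simp [hHt]; ring)
    (fun c x y => by simp [hHt]; ring) (fun x y y' => by simp [hHt]; ring)
    (fun c x y => by simp [hHt]; ring)
  have hG : ∀ x y, Ht x y = G x y := fun _ _ => rfl
  have hs : ∀ x y, G x y = G y x := A.tilde_symm hHt
  have hR' : ∀ x y z, R x y z = -κ • (G y z • x - G x z • y) := fun x y z => by
    rw [hR, hμ, zero_smul, add_zero]; rfl
  simp only [hR', map_smul, map_sub, LinearMap.smul_apply, LinearMap.sub_apply, smul_eq_mul]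
  rw [hs v x, hs v y, hs u x, hs u y]
  module

variable {ι : Type*} [Fintype ι] (e : Basis ι ℝ V)

/-- The trace of `z ↦ R(x, z) y` in a basis. -/
lemma ricci_eq (x y : V) : ∑ i, e.repr (R x (e i) y) i =
    κ * (Fintype.card ι - 1) * Ht x y
      + μ * (H (φ x) y - (∑ i, e.repr (φ (e i)) i) * H x y) := by
  have hsum : ∀ (a : V →ₗ[ℝ] ℝ) (x : V), ∑ i, a (e i) * e.repr x i = a x := fun a x => by
    conv_rhs => rw [← e.sum_repr x, map_sum]
    exact Finset.sum_congr rfl fun i _ => by rw [map_smul, smul_eq_mul, mul_comm]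
  have h1 : ∑ i, Ht (e i) y * e.repr x i = Ht x y := by
    rw [← A.tilde_symm hHt y x, hHt]
    simp only [A.tilde_symm hHt _ y, hHt]
    exact hsum ((b * η y) • η + H (φ y)) x
  have h2 : ∑ i, H (e i) y * e.repr (φ x) i = H (φ x) y := by
    simp only [A.symm _ y]
    exact hsum (H y) (φ x)
  simp only [hR, map_add, map_smul, map_sub, Finsupp.add_apply, Finsupp.smul_apply,
    Finsupp.sub_apply, smul_eq_mul, Basis.repr_self, Finsupp.single_eq_same,
    Finset.sum_add_distrib, ← Finset.mul_sum, Finset.sum_sub_distrib, h1, h2, mul_one,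
    Finset.sum_const, Finset.card_univ, nsmul_eq_mul]
  ring

variable {Ric : V → V → ℝ} {m τ : ℝ}
  (hRic : ∀ x y, Ric x y = κ * m * Ht x y + μ * (H (φ x) y - τ * H x y))
include hRic

/-- If the Ricci form is annihilated by the curvature operators, then by `R(ξ, y)` acting on
`Ric(ξ, v)` it restricts to a multiple of `Ht` on the screen. -/
lemma eq_zero_of_ricciSemiSymmetric (hκ : κ ≠ 0)
    (h : ∀ x y u v, -Ric (R x y u) v - Ric u (R x y v) = 0) : μ = 0 := by
  refine (A.eq_zero_of_proportional (a := μ) (c := μ * τ) fun y v hy hv => ?_).1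
  have h1 := h ξ y ξ v
  rw [A.curvature_xi hHt hR, A.curvature_xi hHt hR, A.eta_xi, hv, A.tilde_symm hHt y ξ,
    A.tilde_xi hHt, hy] at h1
  have e1 : -κ • ((b * 0) • ξ - (b * 1) • y) = (κ * b) • y := by module
  have e2 : -κ • (Ht y v • ξ - (b * 0) • y) = (-(κ * Ht y v)) • ξ := by module
  rw [e1, e2, hRic, hRic, A.tilde_xi hHt] at h1
  simp only [hHt, map_smul, LinearMap.smul_apply, smul_eq_mul, hy, hv, A.eta_xi, A.phi_xi,
    A.radical, map_zero, LinearMap.zero_apply] at h1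
  have h2 : κ * b * (μ * H (φ y) v - μ * τ * H y v) = 0 := by linarith
  have := (mul_eq_zero.1 h2).resolve_left (mul_ne_zero hκ A.b_ne_zero)
  linarith

lemma ricciSemiSymmetric_of_eq_zero (hμ : μ = 0) (x y u v : V) :
    -Ric (R x y u) v - Ric u (R x y v) = 0 := by
  let G : V →ₗ[ℝ] V →ₗ[ℝ] ℝ := LinearMap.mk₂ ℝ Ht (fun x x' y => by simp [hHt]; ring)
    (fun c x y => by simp [hHt]; ring) (fun x y y' => by simp [hHt]; ring)
    (fun c x y => by simp [hHt]; ring)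
  have hs : ∀ x y, G x y = G y x := A.tilde_symm hHt
  have hR' : ∀ x y z, R x y z = -κ • (G y z • x - G x z • y) := fun x y z => by
    rw [hR, hμ, zero_smul, add_zero]; rfl
  have hRic' : ∀ x y, Ric x y = κ * m * G x y := fun x y => by
    rw [hRic, hμ, zero_mul, add_zero]; rfl
  simp only [hR', hRic', map_smul, map_sub, LinearMap.smul_apply, LinearMap.sub_apply, smul_eq_mul]
  rw [hs u x, hs u y]
  ring

/-- If the Ricci form is a combination of `H` and `Ht`, its value at `(ξ, ξ)` determines the
coefficient of `Ht`, so that only the `φ`-part of the curvature remains on the screen. -/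
lemma eq_zero_of_ricci_eq {k c : ℝ} (h : ∀ x y, Ric x y = k * H x y + c * Ht x y) : μ = 0 := by
  have h1 := h ξ ξ
  rw [hRic, A.tilde_xi hHt, A.eta_xi, A.phi_xi, A.radical] at h1
  simp only [map_zero, LinearMap.zero_apply] at h1
  have hc : c = κ * m := by
    have : b * (c - κ * m) = 0 := by linarith
    linarith [(mul_eq_zero.1 this).resolve_left A.b_ne_zero]
  refine (A.eq_zero_of_proportional (a := μ) (c := μ * τ + k) fun x y hx hy => ?_).1
  have h2 := h x y
  rw [hRic, hc] at h2
  linarith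

end IsRadicalFrame

end RadicalFrame

/-! ### Linear algebra of a radical transversal lightlike hypersurface -/

section HypersurfacePointwise

variable {E : Type*} [NormedAddCommGroup E] [NormedSpace ℝ E] [FiniteDimensional ℝ E]
  [CompleteSpace E]
  {B : Type*} [TopologicalSpace B] [ChartedSpace E B] [IsManifold 𝓘(ℝ, E) ∞ B]
  {F : Type*} [NormedAddCommGroup F] [NormedSpace ℝ F]
  {M : Type*} [TopologicalSpace M] [ChartedSpace F M] [IsManifold 𝓘(ℝ, F) ∞ M]

/-- The setting of a totally umbilical radical transversal lightlike hypersurface, immersed by `f`,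
of the Kähler-Norden manifold with Norden metric `h`. -/
structure IsUmbilicalHypersurface
    (h : Π p : B, TangentSpace 𝓘(ℝ, E) p →L[ℝ] TangentSpace 𝓘(ℝ, E) p →L[ℝ] ℝ)
    (J : Π p : B, TangentSpace 𝓘(ℝ, E) p →L[ℝ] TangentSpace 𝓘(ℝ, E) p)
    (D : CovariantDerivative 𝓘(ℝ, E) E (TangentSpace 𝓘(ℝ, E) : B → Type _)) (f : M → B)
    (S : Π p : M, Submodule ℝ (TangentSpace 𝓘(ℝ, F) p)) : Prop where
  kaehler : IsKaehlerNorden h J D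
  immersion : IsSmoothImmersion F E f
  codim : finrank ℝ F + 1 = finrank ℝ E
  three_le : 3 ≤ finrank ℝ F
  umbilical : IsUmbilicalRadicalTransversal h f S J D

/-- For a section `ξ` of the radical, the function `b` with `Jξ = b N` for the transversal field `N`
normalized by `h(N, ξ) = 1`. Pairing with `ξ` gives `b = h(Jξ, ξ)`, which does not involve `N`. -/
def transversalFactor
    (h : Π p : B, TangentSpace 𝓘(ℝ, E) p →L[ℝ] TangentSpace 𝓘(ℝ, E) p →L[ℝ] ℝ)
    (J : Π p : B, TangentSpace 𝓘(ℝ, E) p →L[ℝ] TangentSpace 𝓘(ℝ, E) p) (f : M → B) (p : M)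
    (ξ : TangentSpace 𝓘(ℝ, F) p) : ℝ :=
  h (f p) (J (f p) (mfderiv 𝓘(ℝ, F) 𝓘(ℝ, E) f p ξ)) (mfderiv 𝓘(ℝ, F) 𝓘(ℝ, E) f p ξ)

/-- The induced degenerate metric as a bilinear form. -/
def inducedForm
    (h : Π p : B, TangentSpace 𝓘(ℝ, E) p →L[ℝ] TangentSpace 𝓘(ℝ, E) p →L[ℝ] ℝ) (f : M → B) (p : M) :
    TangentSpace 𝓘(ℝ, F) p →ₗ[ℝ] TangentSpace 𝓘(ℝ, F) p →ₗ[ℝ] ℝ :=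
  LinearMap.mk₂ ℝ (inducedMetric h f p) (by simp [inducedMetric]) (by simp [inducedMetric])
    (by simp [inducedMetric]) (by simp [inducedMetric])

/-- The one-form `x ↦ h(x, N)`; for a null pair it is dual to the radical and vanishes on the
screen. -/
def dualForm
    (h : Π p : B, TangentSpace 𝓘(ℝ, E) p →L[ℝ] TangentSpace 𝓘(ℝ, E) p →L[ℝ] ℝ) (f : M → B) (p : M)
    (N : TangentSpace 𝓘(ℝ, E) (f p)) : TangentSpace 𝓘(ℝ, F) p →ₗ[ℝ] ℝ where
  toFun x := h (f p) (mfderiv 𝓘(ℝ, F) 𝓘(ℝ, E) f p x) N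
  map_add' := by simp
  map_smul' := by simp

namespace IsUmbilicalHypersurface

variable {h : Π p : B, TangentSpace 𝓘(ℝ, E) p →L[ℝ] TangentSpace 𝓘(ℝ, E) p →L[ℝ] ℝ}
  {J : Π p : B, TangentSpace 𝓘(ℝ, E) p →L[ℝ] TangentSpace 𝓘(ℝ, E) p}
  {D : CovariantDerivative 𝓘(ℝ, E) E (TangentSpace 𝓘(ℝ, E) : B → Type _)} {f : M → B}
  {S : Π p : M, Submodule ℝ (TangentSpace 𝓘(ℝ, F) p)} {p : M} {ξ : TangentSpace 𝓘(ℝ, F) p}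
  {N : TangentSpace 𝓘(ℝ, E) (f p)}
  (A : IsUmbilicalHypersurface h J D f S) (hN : IsNullPairAt h f S p ξ N)
include A hN

lemma apply_xi (x : TangentSpace 𝓘(ℝ, F) p) :
    h (f p) (mfderiv 𝓘(ℝ, F) 𝓘(ℝ, E) f p ξ) (mfderiv 𝓘(ℝ, F) 𝓘(ℝ, E) f p x) = 0 :=
  hN.mem_radical x

lemma apply_N_xi : h (f p) (mfderiv 𝓘(ℝ, F) 𝓘(ℝ, E) f p ξ) N = 1 := by
  rw [A.kaehler.symm]; exact hN.pairing

/-- The tangent hyperplane consists of the ambient vectors that are orthogonal to the radical. -/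
lemma exists_tangent {w : TangentSpace 𝓘(ℝ, E) (f p)}
    (hw : h (f p) w (mfderiv 𝓘(ℝ, F) 𝓘(ℝ, E) f p ξ) = 0) :
    ∃ x : TangentSpace 𝓘(ℝ, F) p, mfderiv 𝓘(ℝ, F) 𝓘(ℝ, E) f p x = w := by
  have _ : FiniteDimensional ℝ (TangentSpace 𝓘(ℝ, E) (f p)) :=
    inferInstanceAs (FiniteDimensional ℝ E)
  let d : TangentSpace 𝓘(ℝ, F) p →ₗ[ℝ] TangentSpace 𝓘(ℝ, E) (f p) :=
    (mfderiv 𝓘(ℝ, F) 𝓘(ℝ, E) f p).toLinearMap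
  let l : Module.Dual ℝ (TangentSpace 𝓘(ℝ, E) (f p)) :=
    (h (f p) (mfderiv 𝓘(ℝ, F) 𝓘(ℝ, E) f p ξ)).toLinearMap
  have hl : l ≠ 0 := fun h0 => by
    have h1 : l N = 1 := A.apply_N_xi hN
    rw [h0] at h1
    exact zero_ne_one h1
  have h1 := Module.Dual.finrank_ker_add_one_of_ne_zero hl
  have h2 : finrank ℝ (LinearMap.range d) = finrank ℝ F :=
    LinearMap.finrank_range_of_inj (A.immersion.injective p)
  have h3 : finrank ℝ (TangentSpace 𝓘(ℝ, E) (f p)) = finrank ℝ E := rfl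
  have hle : LinearMap.range d ≤ LinearMap.ker l := by
    rintro _ ⟨x, rfl⟩
    exact A.apply_xi hN x
  have heq := Submodule.eq_of_le_of_finrank_eq hle (by have := A.codim; omega)
  have hmem : w ∈ LinearMap.range d := by
    rw [heq, LinearMap.mem_ker]
    change h (f p) _ w = 0
    rw [A.kaehler.symm]; exact hw
  exact hmem

lemma exists_tangent_add (w : TangentSpace 𝓘(ℝ, E) (f p)) :
    ∃ x : TangentSpace 𝓘(ℝ, F) p,
      mfderiv 𝓘(ℝ, F) 𝓘(ℝ, E) f p x = w - h (f p) w (mfderiv 𝓘(ℝ, F) 𝓘(ℝ, E) f p ξ) • N := by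
  refine A.exists_tangent hN ?_
  rw [map_sub, map_smul, sub_apply, smul_apply, hN.pairing]
  simp

/-- The normal space is spanned by the radical. -/
lemma eq_smul_xi {u : TangentSpace 𝓘(ℝ, E) (f p)}
    (hu : ∀ x : TangentSpace 𝓘(ℝ, F) p, h (f p) u (mfderiv 𝓘(ℝ, F) 𝓘(ℝ, E) f p x) = 0) :
    u = h (f p) u N • mfderiv 𝓘(ℝ, F) 𝓘(ℝ, E) f p ξ := by
  refine sub_eq_zero.1 (A.kaehler.nondegenerate (f p) _ fun w => ?_)
  obtain ⟨x, hx⟩ := A.exists_tangent_add hN w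
  have hw : w = mfderiv 𝓘(ℝ, F) 𝓘(ℝ, E) f p x +
      h (f p) w (mfderiv 𝓘(ℝ, F) 𝓘(ℝ, E) f p ξ) • N := by rw [hx]; abel
  rw [hw]
  simp only [map_sub, map_smul, sub_apply, smul_apply, map_add, smul_eq_mul, hu,
    A.apply_xi hN, A.apply_N_xi hN]
  ring

/-- The transversal bundle does not depend on the choice of the null pair. -/
lemma mem_transversalSpace_iff {v : TangentSpace 𝓘(ℝ, E) (f p)} :
    v ∈ transversalSpace h f S p ↔ ∃ c : ℝ, v = c • N := by
  constructor
  · intro hv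
    refine Submodule.span_induction (p := fun v _ => ∃ c : ℝ, v = c • N) ?_ ⟨0, by simp⟩ ?_ ?_ hv
    · rintro N' ⟨ξ', hN'⟩
      have h1 := A.eq_smul_xi hN (u := mfderiv 𝓘(ℝ, F) 𝓘(ℝ, E) f p ξ') (A.apply_xi hN')
      set c := h (f p) (mfderiv 𝓘(ℝ, F) 𝓘(ℝ, E) f p ξ') N with hc
      have hc1 : c * h (f p) N' (mfderiv 𝓘(ℝ, F) 𝓘(ℝ, E) f p ξ) = 1 := by
        have h2 := hN'.pairing
        rw [h1, map_smul, smul_eq_mul] at h2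
        exact h2
      have hc0 : c ≠ 0 := fun h0 => by rw [h0, zero_mul] at hc1; exact zero_ne_one hc1
      have horth : ∀ x : TangentSpace 𝓘(ℝ, F) p,
          h (f p) (N' - c⁻¹ • N) (mfderiv 𝓘(ℝ, F) 𝓘(ℝ, E) f p x) = 0 := by
        intro x
        obtain ⟨s, hs, r, hr, hsr⟩ := Submodule.mem_sup.1
          ((A.umbilical.screen.isCompl p).sup_eq_top ▸ Submodule.mem_top (x := x))
        have hr' := A.eq_smul_xi hN (u := mfderiv 𝓘(ℝ, F) 𝓘(ℝ, E) f p r) hr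
        rw [← hsr, map_add, hr']
        simp only [map_sub, map_smul, sub_apply, smul_apply, map_add, smul_eq_mul,
          hN.orthogonal s hs, hN'.orthogonal s hs, hN.pairing]
        have : h (f p) N' (mfderiv 𝓘(ℝ, F) 𝓘(ℝ, E) f p ξ) = c⁻¹ := eq_inv_of_mul_eq_one_right hc1
        rw [this]; ring
      have h3 := A.eq_smul_xi hN horth
      set a := h (f p) (N' - c⁻¹ • N) N
      have h4 : N' = c⁻¹ • N + a • mfderiv 𝓘(ℝ, F) 𝓘(ℝ, E) f p ξ := by rw [← h3]; abel
      have h5 := hN'.null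
      rw [h4] at h5
      simp only [map_smul, smul_apply, map_add, add_apply, smul_eq_mul, hN.null, hN.pairing,
        A.apply_N_xi hN, A.apply_xi hN] at h5
      have h6 : a = 0 := by
        have : c⁻¹ * a = 0 := by linarith
        exact (mul_eq_zero.1 this).resolve_left (inv_ne_zero hc0)
      exact ⟨c⁻¹, by rw [h4, h6, zero_smul, add_zero]⟩
    · rintro x y _ _ ⟨c, rfl⟩ ⟨c', rfl⟩
      exact ⟨c + c', by rw [add_smul]⟩
    · rintro a x _ ⟨c, rfl⟩
      exact ⟨a * c, by rw [mul_smul]⟩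
  · rintro ⟨c, rfl⟩
    exact Submodule.smul_mem _ _ (Submodule.subset_span ⟨ξ, hN⟩)

/-- Radical transversality. -/
lemma J_xi : J (f p) (mfderiv 𝓘(ℝ, F) 𝓘(ℝ, E) f p ξ) = transversalFactor h J f p ξ • N := by
  have h1 : J (f p) (mfderiv 𝓘(ℝ, F) 𝓘(ℝ, E) f p ξ) ∈ transversalSpace h f S p := by
    rw [← A.umbilical.radicalTransversal p]
    exact Submodule.mem_map_of_mem (f := (J (f p)).toLinearMap) hN.mem_radical
  obtain ⟨c, hc⟩ := (A.mem_transversalSpace_iff hN).1 h1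
  rw [transversalFactor, hc, map_smul, smul_apply, hN.pairing]
  simp

lemma transversalFactor_ne_zero : transversalFactor h J f p ξ ≠ 0 := by
  intro h0
  have h1 := A.J_xi hN
  rw [h0, zero_smul] at h1
  have h2 := A.kaehler.J_sq (f p) (mfderiv 𝓘(ℝ, F) 𝓘(ℝ, E) f p ξ)
  rw [h1, map_zero] at h2
  have h3 := A.apply_N_xi hN
  rw [neg_eq_zero.1 h2.symm, map_zero, zero_apply] at h3
  exact zero_ne_one h3

lemma J_N : J (f p) N = -(transversalFactor h J f p ξ)⁻¹ • mfderiv 𝓘(ℝ, F) 𝓘(ℝ, E) f p ξ := by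
  have h0 := A.transversalFactor_ne_zero hN
  have h1 := congrArg (J (f p)) (A.J_xi hN)
  rw [A.kaehler.J_sq, map_smul] at h1
  rw [neg_smul, ← smul_neg, h1, smul_smul, inv_mul_cancel₀ h0, one_smul]

lemma J_apply_symm (u v : TangentSpace 𝓘(ℝ, E) (f p)) :
    h (f p) (J (f p) u) v = h (f p) u (J (f p) v) := by
  have := A.kaehler.norden (f p) u (J (f p) v)
  rw [A.kaehler.J_sq, map_neg] at this
  linarith

lemma apply_J_N (x : TangentSpace 𝓘(ℝ, F) p) :
    h (f p) (J (f p) N) (mfderiv 𝓘(ℝ, F) 𝓘(ℝ, E) f p x) = 0 := by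
  rw [A.J_N hN, map_smul, smul_apply, A.apply_xi hN, smul_zero]

lemma apply_J_xi (x : TangentSpace 𝓘(ℝ, F) p) :
    h (f p) (J (f p) (mfderiv 𝓘(ℝ, F) 𝓘(ℝ, E) f p x)) (mfderiv 𝓘(ℝ, F) 𝓘(ℝ, E) f p ξ) =
      transversalFactor h J f p ξ * h (f p) (mfderiv 𝓘(ℝ, F) 𝓘(ℝ, E) f p x) N := by
  rw [A.J_apply_symm hN, A.J_xi hN, map_smul, smul_eq_mul]

/-- The tangential part `φ` of `J` makes the tangent space into a radical frame. -/
lemma exists_radicalFrame : ∃ φ : TangentSpace 𝓘(ℝ, F) p →ₗ[ℝ] TangentSpace 𝓘(ℝ, F) p,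
    IsRadicalFrame (inducedForm h f p) φ (dualForm h f p N) ξ (transversalFactor h J f p ξ) ∧
    (∀ x, mfderiv 𝓘(ℝ, F) 𝓘(ℝ, E) f p (φ x) = J (f p) (mfderiv 𝓘(ℝ, F) 𝓘(ℝ, E) f p x) -
      (transversalFactor h J f p ξ * dualForm h f p N x) • N) ∧
    ∀ x y, h (f p) (J (f p) (mfderiv 𝓘(ℝ, F) 𝓘(ℝ, E) f p x)) (mfderiv 𝓘(ℝ, F) 𝓘(ℝ, E) f p y) =
      transversalFactor h J f p ξ * dualForm h f p N x * dualForm h f p N y +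
      inducedForm h f p (φ x) y := by
  set b := transversalFactor h J f p ξ with hb
  set η := dualForm (F := F) h f p N with hη
  have hη' : ∀ x, h (f p) (mfderiv 𝓘(ℝ, F) 𝓘(ℝ, E) f p x) N = η x := fun _ => rfl
  have hinj := A.immersion.injective p
  have hex : ∀ x : TangentSpace 𝓘(ℝ, F) p, ∃ y : TangentSpace 𝓘(ℝ, F) p,
      mfderiv 𝓘(ℝ, F) 𝓘(ℝ, E) f p y =
        J (f p) (mfderiv 𝓘(ℝ, F) 𝓘(ℝ, E) f p x) - (b * η x) • N := fun x => by
    obtain ⟨y, hy⟩ := A.exists_tangent_add hN (J (f p) (mfderiv 𝓘(ℝ, F) 𝓘(ℝ, E) f p x))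
    rw [A.apply_J_xi hN] at hy
    exact ⟨y, hy⟩
  choose φ₀ hφ₀ using hex
  let φ : TangentSpace 𝓘(ℝ, F) p →ₗ[ℝ] TangentSpace 𝓘(ℝ, F) p :=
    { toFun := φ₀
      map_add' := fun x y => hinj (by
        rw [map_add, hφ₀, hφ₀, hφ₀, map_add, map_add, map_add]; module)
      map_smul' := fun c x => hinj (by
        rw [map_smul, hφ₀, hφ₀, map_smul, map_smul, map_smul, RingHom.id_apply, smul_eq_mul]
        module) }
  have hφ : ∀ x, mfderiv 𝓘(ℝ, F) 𝓘(ℝ, E) f p (φ x) =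
      J (f p) (mfderiv 𝓘(ℝ, F) 𝓘(ℝ, E) f p x) - (b * η x) • N := hφ₀
  have hH : ∀ x y, inducedForm h f p x y =
      h (f p) (mfderiv 𝓘(ℝ, F) 𝓘(ℝ, E) f p x) (mfderiv 𝓘(ℝ, F) 𝓘(ℝ, E) f p y) := fun _ _ => rfl
  have hηφ : ∀ x, η (φ x) = 0 := fun x => by
    rw [← hη', hφ, map_sub, map_smul, sub_apply, smul_apply, hN.null, A.J_apply_symm hN,
      A.kaehler.symm, A.apply_J_N hN]
    simp
  have hHφ : ∀ x y, inducedForm h f p (φ x) y =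
      h (f p) (J (f p) (mfderiv 𝓘(ℝ, F) 𝓘(ℝ, E) f p x))
        (mfderiv 𝓘(ℝ, F) 𝓘(ℝ, E) f p y) - b * η x * η y := fun x y => by
    rw [hH, hφ, map_sub, map_smul, sub_apply, smul_apply, A.kaehler.symm (f p) N, hη', smul_eq_mul]
  have hηξ : η ξ = 1 := A.apply_N_xi hN
  refine ⟨φ, ⟨fun x y => ?_, fun y => A.apply_xi hN y, hηξ, hinj ?_, hηφ, fun x => hinj ?_,
    fun x y => ?_, fun x hx => hinj ?_, A.transversalFactor_ne_zero hN, ?_⟩, hφ, fun x y => ?_⟩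
  · rw [hH, hH, A.kaehler.symm]
  · rw [hφ, A.J_xi hN, hηξ, map_zero, mul_one, sub_self]
  · rw [hφ, hηφ, hφ, map_sub, map_smul, A.J_N hN, A.kaehler.J_sq, map_add, map_neg, map_smul,
      mul_zero, zero_smul, sub_zero, smul_smul, sub_eq_add_neg, ← neg_smul, ← hb]
    have h0 := A.transversalFactor_ne_zero hN
    rw [← hb] at h0
    congr 2
    field_simp
  · have hs : ∀ x y, inducedForm (F := F) h f p x y = inducedForm h f p y x := fun x y => by
      rw [hH, hH, A.kaehler.symm]
    rw [hs x, hHφ, hHφ, A.J_apply_symm hN, A.kaehler.symm]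
    ring
  · rw [map_smul]
    exact A.eq_smul_xi hN hx
  · have _ : FiniteDimensional ℝ (TangentSpace 𝓘(ℝ, F) p) :=
      FiniteDimensional.of_finrank_pos (by
        have := A.three_le
        change 0 < finrank ℝ F
        omega)
    have h1 : finrank ℝ (LinearMap.range η) ≤ 1 := (Submodule.finrank_le _).trans (by simp)
    have h2 := LinearMap.finrank_range_add_finrank_ker η
    have h3 : finrank ℝ (TangentSpace 𝓘(ℝ, F) p) = finrank ℝ F := rfl
    have h4 := A.three_le
    have h5 : 0 < finrank ℝ (LinearMap.ker η) := by omega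
    have : Nontrivial (LinearMap.ker η) := Module.finrank_pos_iff.1 h5
    obtain ⟨⟨v, hv⟩, hv0⟩ := exists_ne (0 : LinearMap.ker η)
    exact ⟨v, hv, fun h0 => hv0 (Subtype.ext h0)⟩
  · rw [hHφ]; ring

end IsUmbilicalHypersurface

end HypersurfacePointwise

/-! ### The equations of Weingarten, Gauss and Codazzi -/

section GaussCodazzi

variable {E : Type*} [NormedAddCommGroup E] [NormedSpace ℝ E] [FiniteDimensional ℝ E]
  [CompleteSpace E]
  {B : Type*} [TopologicalSpace B] [ChartedSpace E B] [IsManifold 𝓘(ℝ, E) ∞ B]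
  {F : Type*} [NormedAddCommGroup F] [NormedSpace ℝ F]
  {M : Type*} [TopologicalSpace M] [ChartedSpace F M] [IsManifold 𝓘(ℝ, F) ∞ M]

/-- The one-form `α` with `∇_x ξ = -ρ x + α(x) ξ` for the ambient connection. -/
def radicalForm
    (h : Π p : B, TangentSpace 𝓘(ℝ, E) p →L[ℝ] TangentSpace 𝓘(ℝ, E) p →L[ℝ] ℝ)
    (D : CovariantDerivative 𝓘(ℝ, E) E (TangentSpace 𝓘(ℝ, E) : B → Type _)) (f : M → B) (p : M)
    (ξ : Π p : M, TangentSpace 𝓘(ℝ, F) p) (N : Π p : M, TangentSpace 𝓘(ℝ, E) (f p)) (ρ : M → ℝ)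
    (x : TangentSpace 𝓘(ℝ, F) p) : ℝ :=
  h (f p) (covAlong D f (fun q => mfderiv 𝓘(ℝ, F) 𝓘(ℝ, E) f q (ξ q)) p x +
    ρ p • mfderiv 𝓘(ℝ, F) 𝓘(ℝ, E) f p x) (N p)

namespace IsUmbilicalHypersurface

variable {h : Π p : B, TangentSpace 𝓘(ℝ, E) p →L[ℝ] TangentSpace 𝓘(ℝ, E) p →L[ℝ] ℝ}
  {J : Π p : B, TangentSpace 𝓘(ℝ, E) p →L[ℝ] TangentSpace 𝓘(ℝ, E) p}
  {D : CovariantDerivative 𝓘(ℝ, E) E (TangentSpace 𝓘(ℝ, E) : B → Type _)} {f : M → B}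
  {S : Π p : M, Submodule ℝ (TangentSpace 𝓘(ℝ, F) p)} {p : M}
  (A : IsUmbilicalHypersurface h J D f S)
include A

/-- The Gauss formula: the induced connection is the tangential part of the ambient one. -/
lemma mfderiv_inducedConnection {ξ₀ : TangentSpace 𝓘(ℝ, F) p} {N₀ : TangentSpace 𝓘(ℝ, E) (f p)}
    (hN : IsNullPairAt h f S p ξ₀ N₀) (Y : Π p : M, TangentSpace 𝓘(ℝ, F) p)
    (x : TangentSpace 𝓘(ℝ, F) p) :
    mfderiv 𝓘(ℝ, F) 𝓘(ℝ, E) f p (inducedConnection h f S D Y p x) =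
      covAlong D f (fun q => mfderiv 𝓘(ℝ, F) 𝓘(ℝ, E) f q (Y q)) p x -
      h (f p) (covAlong D f (fun q => mfderiv 𝓘(ℝ, F) 𝓘(ℝ, E) f q (Y q)) p x)
        (mfderiv 𝓘(ℝ, F) 𝓘(ℝ, E) f p ξ₀) • N₀ := by
  set v := covAlong D f (fun q => mfderiv 𝓘(ℝ, F) 𝓘(ℝ, E) f q (Y q)) p x with hv
  obtain ⟨y, hy⟩ := A.exists_tangent_add hN v
  have hex : ∃ u : TangentSpace 𝓘(ℝ, F) p,
      v - mfderiv 𝓘(ℝ, F) 𝓘(ℝ, E) f p u ∈ transversalSpace h f S p := by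
    refine ⟨y, (A.mem_transversalSpace_iff hN).2 ⟨h (f p) v (mfderiv 𝓘(ℝ, F) 𝓘(ℝ, E) f p ξ₀), ?_⟩⟩
    rw [hy]; abel
  have hdef : inducedConnection h f S D Y p x = hex.choose := dif_pos hex
  obtain ⟨c, hc⟩ := (A.mem_transversalSpace_iff hN).1 hex.choose_spec
  rw [← hdef] at hc
  have h1 : h (f p) v (mfderiv 𝓘(ℝ, F) 𝓘(ℝ, E) f p ξ₀) = c := by
    have h2 := congrArg (fun w => h (f p) w (mfderiv 𝓘(ℝ, F) 𝓘(ℝ, E) f p ξ₀)) hc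
    simp only [map_sub, sub_apply, map_smul, smul_apply, hN.pairing, smul_eq_mul, mul_one] at h2
    rw [A.kaehler.symm (f p) (mfderiv 𝓘(ℝ, F) 𝓘(ℝ, E) f p _), A.apply_xi hN, sub_zero] at h2
    exact h2
  rw [h1, ← hc]
  abel

lemma smooth : ContMDiff 𝓘(ℝ, F) 𝓘(ℝ, E) ∞ f := A.immersion.smooth

variable {U : Set M} {ξ : Π p : M, TangentSpace 𝓘(ℝ, F) p}
  {N : Π p : M, TangentSpace 𝓘(ℝ, E) (f p)} {ρ : M → ℝ} (hU : IsUmbilicalOn h f S D U ξ N ρ)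
include hU

lemma smoothAlongOn_xi :
    SmoothAlongOn (F := F) f (fun q => mfderiv 𝓘(ℝ, F) 𝓘(ℝ, E) f q (ξ q)) U :=
  smoothAlongOn_mfderiv A.smooth hU.smooth_xi

lemma contMDiffOn_transversalFactor :
    ContMDiffOn 𝓘(ℝ, F) 𝓘(ℝ, ℝ) ∞ (fun q => transversalFactor h J f q (ξ q)) U :=
  A.kaehler.contMDiffOn_apply_apply A.smooth
    (A.kaehler.smoothAlongOn_J A.smooth (A.smoothAlongOn_xi hU)) (A.smoothAlongOn_xi hU)

/-- Tangent fields remain orthogonal to `ξ`, so that their derivatives pair with `ξ` as `-∇ξ` pairs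
with them. -/
lemma apply_covAlong_xi_eq_neg (hp : p ∈ U) {Y : Π p : M, TangentSpace 𝓘(ℝ, F) p}
    (hY : MDiffAlongAt (F := F) f (fun q => mfderiv 𝓘(ℝ, F) 𝓘(ℝ, E) f q (Y q)) p)
    (x : TangentSpace 𝓘(ℝ, F) p) :
    h (f p) (covAlong D f (fun q => mfderiv 𝓘(ℝ, F) 𝓘(ℝ, E) f q (Y q)) p x)
      (mfderiv 𝓘(ℝ, F) 𝓘(ℝ, E) f p (ξ p)) =
    -h (f p) (mfderiv 𝓘(ℝ, F) 𝓘(ℝ, E) f p (Y p))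
      (covAlong D f (fun q => mfderiv 𝓘(ℝ, F) 𝓘(ℝ, E) f q (ξ q)) p x) := by
  have hn := hU.isOpen.mem_nhds hp
  have h1 := (A.kaehler.hasDeriv_apply_apply hY ((A.smoothAlongOn_xi hU).mDiffAlongAt hn)).2 x
  have h2 : (fun q => h (f q) (mfderiv 𝓘(ℝ, F) 𝓘(ℝ, E) f q (Y q))
      (mfderiv 𝓘(ℝ, F) 𝓘(ℝ, E) f q (ξ q))) =ᶠ[𝓝 p] fun _ => (0 : ℝ) :=
    Filter.eventually_of_mem hn fun q hq =>
      (A.kaehler.symm _ _ _).trans (A.apply_xi (hU.nullPair q hq) _)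
  rw [mvfderiv_congr h2, mvfderiv_const] at h1
  have h3 : (0 : ℝ) = _ := h1
  linarith

/-- The second fundamental form, computed with an arbitrary differentiable extension. -/
lemma apply_covAlong_xi (hp : p ∈ U) {Y : Π p : M, TangentSpace 𝓘(ℝ, F) p}
    (hY : MDiffAlongAt (F := F) f (fun q => mfderiv 𝓘(ℝ, F) 𝓘(ℝ, E) f q (Y q)) p)
    (x : TangentSpace 𝓘(ℝ, F) p) :
    h (f p) (covAlong D f (fun q => mfderiv 𝓘(ℝ, F) 𝓘(ℝ, E) f q (Y q)) p x)
      (mfderiv 𝓘(ℝ, F) 𝓘(ℝ, E) f p (ξ p)) = ρ p * inducedMetric h f p x (Y p) := by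
  have he : MDiffAlongAt (F := F) f
      (fun q => mfderiv 𝓘(ℝ, F) 𝓘(ℝ, E) f q (FiberBundle.extend F (Y p) q)) p :=
    (smoothAlongOn_mfderiv A.smooth (smoothFieldOn_extend (Y p))).mDiffAlongAt
      ((chartAt F p).open_source.mem_nhds (mem_chart_source F p))
  have h1 := A.apply_covAlong_xi_eq_neg hU hp he x
  rw [FiberBundle.extend_apply_self] at h1
  rw [A.apply_covAlong_xi_eq_neg hU hp hY, ← h1]
  exact hU.umbilical p hp x (Y p)

lemma apply_covAlong_of_xi (hp : p ∈ U) (x y : TangentSpace 𝓘(ℝ, F) p) :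
    h (f p) (mfderiv 𝓘(ℝ, F) 𝓘(ℝ, E) f p y)
      (covAlong D f (fun q => mfderiv 𝓘(ℝ, F) 𝓘(ℝ, E) f q (ξ q)) p x) =
      -(ρ p * inducedMetric h f p x y) := by
  have he : MDiffAlongAt (F := F) f
      (fun q => mfderiv 𝓘(ℝ, F) 𝓘(ℝ, E) f q (FiberBundle.extend F y q)) p :=
    (smoothAlongOn_mfderiv A.smooth (smoothFieldOn_extend y)).mDiffAlongAt
      ((chartAt F p).open_source.mem_nhds (mem_chart_source F p))
  have h1 := A.apply_covAlong_xi_eq_neg hU hp he x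
  rw [A.apply_covAlong_xi hU hp he, FiberBundle.extend_apply_self] at h1
  linarith

/-- The Weingarten formula for the radical. -/
lemma covAlong_xi (hp : p ∈ U) (x : TangentSpace 𝓘(ℝ, F) p) :
    covAlong D f (fun q => mfderiv 𝓘(ℝ, F) 𝓘(ℝ, E) f q (ξ q)) p x =
      -ρ p • mfderiv 𝓘(ℝ, F) 𝓘(ℝ, E) f p x +
      radicalForm h D f p ξ N ρ x • mfderiv 𝓘(ℝ, F) 𝓘(ℝ, E) f p (ξ p) := by
  have h1 := A.eq_smul_xi (hU.nullPair p hp)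
    (u := covAlong D f (fun q => mfderiv 𝓘(ℝ, F) 𝓘(ℝ, E) f q (ξ q)) p x +
      ρ p • mfderiv 𝓘(ℝ, F) 𝓘(ℝ, E) f p x) fun y => by
    rw [A.kaehler.symm, map_add, map_smul, A.apply_covAlong_of_xi hU hp, A.kaehler.symm,
      smul_eq_mul, inducedMetric]
    ring
  rw [radicalForm, ← h1, neg_smul]
  abel

/-- The Weingarten formula for the transversal field, obtained by differentiating `Jξ = b N`. -/
lemma exists_covAlong_N (hp : p ∈ U) (x : TangentSpace 𝓘(ℝ, F) p) : ∃ β : ℝ,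
    covAlong D f N p x =
      -(ρ p / transversalFactor h J f p (ξ p)) •
        J (f p) (mfderiv 𝓘(ℝ, F) 𝓘(ℝ, E) f p x) + β • N p := by
  have hn := hU.isOpen.mem_nhds hp
  have hb0 := A.transversalFactor_ne_zero (hU.nullPair p hp)
  have hb : MDiffAt (fun q => transversalFactor h J f q (ξ q)) p :=
    ((A.contMDiffOn_transversalFactor hU).contMDiffAt hn).mdifferentiableAt (by simp)
  have h1 := A.kaehler.covAlong_J ((A.smoothAlongOn_xi hU).mDiffAlongAt hn) x
  have h2 := covAlong_congr (D := D) A.smooth.continuous.continuousAt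
    (Filter.eventually_of_mem hn fun q hq => A.J_xi (hU.nullPair q hq)) x
  rw [h2, covAlong_smul hb (hU.smooth_N.mDiffAlongAt hn), A.covAlong_xi hU hp, map_add, map_smul,
    map_smul, A.J_xi (hU.nullPair p hp)] at h1
  set b := transversalFactor h J f p (ξ p) with hbdef
  set db := mvfderiv 𝓘(ℝ, F) (fun q => transversalFactor h J f q (ξ q)) p x
  set α := radicalForm h D f p ξ N ρ x
  refine ⟨α - db / b, ?_⟩
  have h3 : b • covAlong D f N p x = b • (-(ρ p / b) • J (f p) (mfderiv 𝓘(ℝ, F) 𝓘(ℝ, E) f p x) +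
      (α - db / b) • N p) := by
    rw [smul_add, smul_smul, smul_smul]
    have e1 : b * -(ρ p / b) = -ρ p := by field_simp
    have e2 : b * (α - db / b) = α * b - db := by field_simp
    rw [e1, e2, sub_smul, mul_smul, ← add_sub_assoc, ← h1]
    abel
  exact (smul_right_injective _ hb0) h3

variable {X Y Z : Π p : M, TangentSpace 𝓘(ℝ, F) p}

lemma mfderiv_inducedConnection_field (hp : p ∈ U)
    (hZ : MDiffAlongAt (F := F) f (fun q => mfderiv 𝓘(ℝ, F) 𝓘(ℝ, E) f q (Z q)) p)
    (x : TangentSpace 𝓘(ℝ, F) p) :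
    mfderiv 𝓘(ℝ, F) 𝓘(ℝ, E) f p (inducedConnection h f S D Z p x) =
      covAlong D f (fun q => mfderiv 𝓘(ℝ, F) 𝓘(ℝ, E) f q (Z q)) p x -
      (ρ p * inducedMetric h f p x (Z p)) • N p := by
  rw [A.mfderiv_inducedConnection (hU.nullPair p hp), A.apply_covAlong_xi hU hp hZ]

lemma contMDiffOn_inducedMetric (hX : SmoothFieldOn X U) (hY : SmoothFieldOn Y U) :
    ContMDiffOn 𝓘(ℝ, F) 𝓘(ℝ, ℝ) ∞ (fun q => inducedMetric h f q (X q) (Y q)) U :=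
  A.kaehler.contMDiffOn_apply_apply A.smooth (smoothAlongOn_mfderiv A.smooth hX)
    (smoothAlongOn_mfderiv A.smooth hY)

omit hU in
lemma isUmbilicalOn_mono {U' : Set M} (hU : IsUmbilicalOn h f S D U ξ N ρ) (hU' : IsOpen U')
    (hsub : U' ⊆ U) : IsUmbilicalOn h f S D U' ξ N ρ where
  isOpen := hU'
  smooth_xi := hU.smooth_xi.mono hsub
  smooth_N := hU.smooth_N.mono hsub
  nullPair q hq := hU.nullPair q (hsub hq)
  smooth_rho := hU.smooth_rho.mono hsub
  umbilical q hq := hU.umbilical q (hsub hq)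

/-- The second derivative of a tangent field, up to multiples of `N`. -/
lemma exists_covAlong_inducedConnection (hp : p ∈ U) (hX : SmoothFieldOn X U)
    (hZ : SmoothFieldOn Z U) (y : TangentSpace 𝓘(ℝ, F) p) : ∃ c : ℝ,
    covAlong D f (fun q => mfderiv 𝓘(ℝ, F) 𝓘(ℝ, E) f q
      (inducedConnection h f S D Z q (X q))) p y =
    covAlong D f (fun q => covAlong D f (fun q => mfderiv 𝓘(ℝ, F) 𝓘(ℝ, E) f q (Z q)) q (X q)) p y +
      (ρ p ^ 2 / transversalFactor h J f p (ξ p) * inducedMetric h f p (X p) (Z p)) •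
        J (f p) (mfderiv 𝓘(ℝ, F) 𝓘(ℝ, E) f p y) + c • N p := by
  have hn := hU.isOpen.mem_nhds hp
  have hdZ := smoothAlongOn_mfderiv A.smooth hZ
  have hc : MDiffAt (fun q => ρ q * inducedMetric h f q (X q) (Z q)) p :=
    ((hU.smooth_rho.mul (A.contMDiffOn_inducedMetric hU hX hZ)).contMDiffAt hn).mdifferentiableAt
      (by simp)
  have hXZ := (A.kaehler.smoothAlongOn_covAlong A.smooth hU.isOpen hdZ hX).mDiffAlongAt hn
  have hNp := hU.smooth_N.mDiffAlongAt hn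
  obtain ⟨β, hβ⟩ := A.exists_covAlong_N hU hp y
  have h1 := covAlong_congr (D := D) A.smooth.continuous.continuousAt
    (Filter.eventually_of_mem hn fun q hq => A.mfderiv_inducedConnection_field hU hq
      (hdZ.mDiffAlongAt (hU.isOpen.mem_nhds hq)) (X q)) y
  rw [covAlong_sub hXZ (hNp.smul hc), covAlong_smul hc hNp, hβ] at h1
  refine ⟨-(mvfderiv 𝓘(ℝ, F) (fun q => ρ q * inducedMetric h f q (X q) (Z q)) p y +
    ρ p * inducedMetric h f p (X p) (Z p) * β), h1.trans ?_⟩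
  module

/-- The Gauss equation. -/
lemma mfderiv_curvatureOfFields [CompleteSpace F] (hp : p ∈ U) (hX : SmoothFieldOn X U)
    (hY : SmoothFieldOn Y U) (hZ : SmoothFieldOn Z U) {w : TangentSpace 𝓘(ℝ, E) (f p)}
    (hw : w = ambientCurvature D (f p) (mfderiv 𝓘(ℝ, F) 𝓘(ℝ, E) f p (X p))
        (mfderiv 𝓘(ℝ, F) 𝓘(ℝ, E) f p (Y p)) (mfderiv 𝓘(ℝ, F) 𝓘(ℝ, E) f p (Z p)) +
      (ρ p ^ 2 / transversalFactor h J f p (ξ p)) •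
        (inducedMetric h f p (Y p) (Z p) • J (f p) (mfderiv 𝓘(ℝ, F) 𝓘(ℝ, E) f p (X p)) -
        inducedMetric h f p (X p) (Z p) • J (f p) (mfderiv 𝓘(ℝ, F) 𝓘(ℝ, E) f p (Y p)))) :
    mfderiv 𝓘(ℝ, F) 𝓘(ℝ, E) f p (curvatureOfFields (inducedConnection h f S D) X Y Z p) =
      w - h (f p) w (mfderiv 𝓘(ℝ, F) 𝓘(ℝ, E) f p (ξ p)) • N p := by
  have hdZ := smoothAlongOn_mfderiv A.smooth hZ
  have hR := A.kaehler.curvature_along A.smooth hU.isOpen hp hX hY hdZ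
  obtain ⟨c₁, h₁⟩ := A.exists_covAlong_inducedConnection hU hp hY hZ (X p)
  obtain ⟨c₂, h₂⟩ := A.exists_covAlong_inducedConnection hU hp hX hZ (Y p)
  rw [curvatureOfFields, map_sub, map_sub]
  simp only [A.mfderiv_inducedConnection (hU.nullPair p hp)]
  rw [h₁, h₂, hw, ← hR]
  simp only [map_add, map_sub, map_smul, add_apply, sub_apply, smul_apply,
    (hU.nullPair p hp).pairing, smul_eq_mul]
  module

/-- The Codazzi equation. It is read off from the second derivatives of `ξ` instead of those of
tangent fields, by means of the Weingarten formula. -/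
lemma codazzi [CompleteSpace F] (hp : p ∈ U) (x y z : TangentSpace 𝓘(ℝ, F) p) :
    h (f p) (ambientCurvature D (f p) (mfderiv 𝓘(ℝ, F) 𝓘(ℝ, E) f p x)
        (mfderiv 𝓘(ℝ, F) 𝓘(ℝ, E) f p y) (mfderiv 𝓘(ℝ, F) 𝓘(ℝ, E) f p z))
        (mfderiv 𝓘(ℝ, F) 𝓘(ℝ, E) f p (ξ p)) =
      (mvfderiv 𝓘(ℝ, F) ρ p x - ρ p * radicalForm h D f p ξ N ρ x) * inducedMetric h f p y z -
      (mvfderiv 𝓘(ℝ, F) ρ p y - ρ p * radicalForm h D f p ξ N ρ y) * inducedMetric h f p x z := by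
  have hO : IsOpen (U ∩ (chartAt F p).source) := hU.isOpen.inter (chartAt F p).open_source
  have hpO : p ∈ U ∩ (chartAt F p).source := ⟨hp, mem_chart_source F p⟩
  have hn := hO.mem_nhds hpO
  have hU' := A.isUmbilicalOn_mono hU hO inter_subset_left
  have hξ := A.smoothAlongOn_xi hU'
  have hρ : MDiffAt ρ p := (hU'.smooth_rho.contMDiffAt hn).mdifferentiableAt (by simp)
  have hext : ∀ v : TangentSpace 𝓘(ℝ, F) p, SmoothFieldOn (FiberBundle.extend F v)
      (U ∩ (chartAt F p).source) := fun v => (smoothFieldOn_extend v).mono inter_subset_right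
  -- the second derivative of `ξ`, paired with a tangent vector
  have key : ∀ x y : TangentSpace 𝓘(ℝ, F) p,
      h (f p) (covAlong D f (fun q => covAlong D f
        (fun q => mfderiv 𝓘(ℝ, F) 𝓘(ℝ, E) f q (ξ q)) q (FiberBundle.extend F y q)) p x)
        (mfderiv 𝓘(ℝ, F) 𝓘(ℝ, E) f p z) =
      -mvfderiv 𝓘(ℝ, F) ρ p x * inducedMetric h f p y z - ρ p * h (f p) (covAlong D f
        (fun q => mfderiv 𝓘(ℝ, F) 𝓘(ℝ, E) f q (FiberBundle.extend F y q)) p x)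
        (mfderiv 𝓘(ℝ, F) 𝓘(ℝ, E) f p z) -
      ρ p * radicalForm h D f p ξ N ρ y * inducedMetric h f p x z := by
    intro x y
    have hdY := smoothAlongOn_mfderiv A.smooth (hext y)
    have hα : ContMDiffOn 𝓘(ℝ, F) 𝓘(ℝ, ℝ) ∞
        (fun q => radicalForm h D f q ξ N ρ (FiberBundle.extend F y q))
        (U ∩ (chartAt F p).source) :=
      A.kaehler.contMDiffOn_apply_apply A.smooth
        ((A.kaehler.smoothAlongOn_covAlong A.smooth hO hξ (hext y)).add A.smooth
          (SmoothAlongOn.smul A.smooth hU'.smooth_rho hdY)) hU'.smooth_N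
    have hαp := (hα.contMDiffAt hn).mdifferentiableAt (by simp)
    have h1 := covAlong_congr (D := D) A.smooth.continuous.continuousAt
      (Filter.eventually_of_mem hn fun q hq => A.covAlong_xi hU' hq (FiberBundle.extend F y q)) x
    have hρ' : MDiffAt (fun q => -ρ q) p := hρ.neg
    have hdYp := hdY.mDiffAlongAt hn
    have hξp := hξ.mDiffAlongAt hn
    rw [covAlong_add (hdYp.smul hρ') (hξp.smul hαp), covAlong_smul hρ' hdYp,
      covAlong_smul hαp hξp, A.covAlong_xi hU hp] at h1
    have h2 : mvfderiv 𝓘(ℝ, F) (fun q => -ρ q) p x = -mvfderiv 𝓘(ℝ, F) ρ p x := by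
      have := mvfderiv_clm_comp (-ContinuousLinearMap.id ℝ ℝ) hρ x
      simpa using this
    rw [h1, h2]
    simp only [map_add, map_smul, add_apply, smul_apply, smul_eq_mul,
      A.apply_xi (hU.nullPair p hp), FiberBundle.extend_apply_self, inducedMetric]
    ring
  have hR := A.kaehler.curvature_along A.smooth hO hpO (hext x) (hext y) hξ
  have ht := A.kaehler.covAlong_mfderiv_sub A.smooth hO hpO (hext x) (hext y)
  have hb := A.apply_covAlong_of_xi hU hp
    (VectorField.mlieBracket 𝓘(ℝ, F) (FiberBundle.extend F x) (FiberBundle.extend F y) p) z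
  simp only [FiberBundle.extend_apply_self] at hR ht
  rw [A.kaehler.ambientCurvature_skew, ← hR, map_sub, map_sub, A.kaehler.symm (f p) _
    (covAlong D f _ p x), A.kaehler.symm (f p) _ (covAlong D f _ p y), key, key, hb]
  simp only [inducedMetric]
  rw [← ht, map_sub, sub_apply]
  ring

end IsUmbilicalHypersurface

end GaussCodazzi

/-! ### Curvature of the induced connection, semi-symmetry and the Ricci tensor -/

section InducedCurvature

variable {E : Type*} [NormedAddCommGroup E] [NormedSpace ℝ E] [FiniteDimensional ℝ E]
  [CompleteSpace E]
  {B : Type*} [TopologicalSpace B] [ChartedSpace E B] [IsManifold 𝓘(ℝ, E) ∞ B]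
  {F : Type*} [NormedAddCommGroup F] [NormedSpace ℝ F]
  {M : Type*} [TopologicalSpace M] [ChartedSpace F M] [IsManifold 𝓘(ℝ, F) ∞ M]

/-- The difference `ρ² / b - κ`, whose vanishing characterizes the symmetry conditions on the
induced connection. -/
def umbilicalDefect
    (h : Π p : B, TangentSpace 𝓘(ℝ, E) p →L[ℝ] TangentSpace 𝓘(ℝ, E) p →L[ℝ] ℝ)
    (J : Π p : B, TangentSpace 𝓘(ℝ, E) p →L[ℝ] TangentSpace 𝓘(ℝ, E) p) (κ : B → ℝ) (f : M → B)
    (ξ : Π p : M, TangentSpace 𝓘(ℝ, F) p) (ρ : M → ℝ) (p : M) : ℝ :=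
  ρ p ^ 2 / transversalFactor h J f p (ξ p) - κ (f p)

/-- The form `h(J x, y)` induced by the second Norden metric. -/
def inducedTwin
    (h : Π p : B, TangentSpace 𝓘(ℝ, E) p →L[ℝ] TangentSpace 𝓘(ℝ, E) p →L[ℝ] ℝ)
    (J : Π p : B, TangentSpace 𝓘(ℝ, E) p →L[ℝ] TangentSpace 𝓘(ℝ, E) p) (f : M → B) (p : M)
    (x y : TangentSpace 𝓘(ℝ, F) p) : ℝ :=
  h (f p) (J (f p) (mfderiv 𝓘(ℝ, F) 𝓘(ℝ, E) f p x)) (mfderiv 𝓘(ℝ, F) 𝓘(ℝ, E) f p y)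

namespace IsUmbilicalHypersurface

variable {h : Π p : B, TangentSpace 𝓘(ℝ, E) p →L[ℝ] TangentSpace 𝓘(ℝ, E) p →L[ℝ] ℝ}
  {J : Π p : B, TangentSpace 𝓘(ℝ, E) p →L[ℝ] TangentSpace 𝓘(ℝ, E) p}
  {D : CovariantDerivative 𝓘(ℝ, E) E (TangentSpace 𝓘(ℝ, E) : B → Type _)} {f : M → B}
  {S : Π p : M, Submodule ℝ (TangentSpace 𝓘(ℝ, F) p)} {p : M}
  (A : IsUmbilicalHypersurface h J D f S)
include A

section Defect

variable {κ : B → ℝ}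

lemma transversalFactor_eq {ξ : TangentSpace 𝓘(ℝ, F) p} {N : TangentSpace 𝓘(ℝ, E) (f p)}
    (hN : IsNullPairAt h f S p ξ N) {b : ℝ}
    (hb : J (f p) (mfderiv 𝓘(ℝ, F) 𝓘(ℝ, E) f p ξ) = b • N) :
    transversalFactor h J f p ξ = b := by
  rw [transversalFactor, hb, map_smul, smul_apply, hN.pairing, smul_eq_mul, mul_one]

lemma curvatureEqSqDiv_iff : CurvatureEqSqDiv h f S J D κ ↔
    ∀ U ξ N ρ, IsUmbilicalOn h f S D U ξ N ρ → ∀ p ∈ U, umbilicalDefect h J κ f ξ ρ p = 0 := by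
  constructor
  · intro H U ξ N ρ hU p hp
    rw [umbilicalDefect, H U ξ N ρ hU (fun q => transversalFactor h J f q (ξ q))
      (fun q hq => A.J_xi (hU.nullPair q hq)) p hp, sub_self]
  · intro H U ξ N ρ hU b hb p hp
    have h1 := H U ξ N ρ hU p hp
    rw [umbilicalDefect, A.transversalFactor_eq (hU.nullPair p hp) (hb p hp)] at h1
    exact (sub_eq_zero.1 h1).symm

end Defect

variable {ν κ : B → ℝ} (hC : HasCurvatureForm h J D ν κ)
  {U : Set M} {ξ : Π p : M, TangentSpace 𝓘(ℝ, F) p}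
  {N : Π p : M, TangentSpace 𝓘(ℝ, E) (f p)} {ρ : M → ℝ} (hU : IsUmbilicalOn h f S D U ξ N ρ)
  [CompleteSpace F]
include hC hU

/-- By the Codazzi equation along the radical, one of the two sectional curvatures vanishes along
the hypersurface and the other one is determined by the radial derivative of `ρ`. -/
lemma curvature_constants (hp : p ∈ U) : ν (f p) = 0 ∧
    mvfderiv 𝓘(ℝ, F) ρ p (ξ p) - ρ p * radicalForm h D f p ξ N ρ (ξ p) =
      -κ (f p) * transversalFactor h J f p (ξ p) := by
  have hN := hU.nullPair p hp
  obtain ⟨φ, hA, hφ, hHt⟩ := A.exists_radicalFrame hN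
  have hb0 := A.transversalFactor_ne_zero hN
  have hη : ∀ x : TangentSpace 𝓘(ℝ, F) p,
      h (f p) (mfderiv 𝓘(ℝ, F) 𝓘(ℝ, E) f p x) (N p) = dualForm h f p (N p) x :=
    fun _ => rfl
  have hH : ∀ x y : TangentSpace 𝓘(ℝ, F) p,
      h (f p) (mfderiv 𝓘(ℝ, F) 𝓘(ℝ, E) f p x) (mfderiv 𝓘(ℝ, F) 𝓘(ℝ, E) f p y) =
    inducedForm h f p x y := fun _ _ => rfl
  have hH' : ∀ x y, inducedMetric (F := F) h f p x y = inducedForm h f p x y := fun _ _ => rfl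
  have key := hA.eq_zero_of_proportional (a := -(ν (f p) * transversalFactor h J f p (ξ p)))
    (c := mvfderiv 𝓘(ℝ, F) ρ p (ξ p) - ρ p * radicalForm h D f p ξ N ρ (ξ p) +
      κ (f p) * transversalFactor h J f p (ξ p)) fun y z hy hz => by
    have h1 := A.codazzi hU hp (ξ p) y z
    rw [hC] at h1
    simp only [map_add, map_sub, map_smul, add_apply, sub_apply, smul_apply, smul_eq_mul,
      A.apply_J_xi hN, hHt, hH, hH', hη, hA.radical, hA.symm _ (ξ p), hA.eta_xi, hA.phi_xi, hy, hz,
      map_zero, LinearMap.zero_apply] at h1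
    linarith
  constructor
  · exact (mul_eq_zero.1 (neg_eq_zero.1 key.1)).resolve_right hb0
  · linarith [key.2]

/-- The curvature tensor of the induced connection. -/
lemma curvatureTensor_eq (hp : p ∈ U) {φ : TangentSpace 𝓘(ℝ, F) p →ₗ[ℝ] TangentSpace 𝓘(ℝ, F) p}
    (hφ : ∀ x, mfderiv 𝓘(ℝ, F) 𝓘(ℝ, E) f p (φ x) = J (f p) (mfderiv 𝓘(ℝ, F) 𝓘(ℝ, E) f p x) -
      (transversalFactor h J f p (ξ p) * dualForm h f p (N p) x) • N p)
    (x y z : TangentSpace 𝓘(ℝ, F) p) :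
    curvatureTensor (inducedConnection h f S D) p x y z =
      -κ (f p) • (inducedTwin h J f p y z • x - inducedTwin h J f p x z • y) +
      umbilicalDefect h J κ f ξ ρ p •
        (inducedForm h f p y z • φ x - inducedForm h f p x z • φ y) := by
  have hN := hU.nullPair p hp
  have hO : IsOpen (U ∩ (chartAt F p).source) := hU.isOpen.inter (chartAt F p).open_source
  have hU' := A.isUmbilicalOn_mono hU hO inter_subset_left
  have hext : ∀ v : TangentSpace 𝓘(ℝ, F) p, SmoothFieldOn (FiberBundle.extend F v)
      (U ∩ (chartAt F p).source) := fun v => (smoothFieldOn_extend v).mono inter_subset_right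
  refine A.immersion.injective p ?_
  refine (A.mfderiv_curvatureOfFields hU' ⟨hp, mem_chart_source F p⟩ (hext x) (hext y) (hext z)
    rfl).trans ?_
  have hH : ∀ x y : TangentSpace 𝓘(ℝ, F) p,
      h (f p) (mfderiv 𝓘(ℝ, F) 𝓘(ℝ, E) f p x) (mfderiv 𝓘(ℝ, F) 𝓘(ℝ, E) f p y) =
    inducedForm h f p x y := fun _ _ => rfl
  have hη : ∀ x : TangentSpace 𝓘(ℝ, F) p,
      h (f p) (mfderiv 𝓘(ℝ, F) 𝓘(ℝ, E) f p x) (N p) = dualForm h f p (N p) x :=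
    fun _ => rfl
  have hH' : ∀ x y, inducedMetric (F := F) h f p x y = inducedForm h f p x y := fun _ _ => rfl
  have hξ : ∀ x, inducedForm h f p x (ξ p) = 0 := fun x => by
    rw [← hH, A.kaehler.symm]; exact A.apply_xi hN x
  rw [hC, (A.curvature_constants hC hU hp).1]
  simp only [FiberBundle.extend_apply_self, map_add, map_sub, map_smul, add_apply,
    sub_apply, smul_apply, smul_eq_mul, A.apply_J_xi hN, hφ, hH, hH', hη, umbilicalDefect,
    inducedTwin, hξ]
  module

/-- The algebraic description of the tangent space, together with the curvature and the Ricci tensor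
of the induced connection. -/
lemma exists_radicalFrame_curvature [FiniteDimensional ℝ F] (hp : p ∈ U) :
    ∃ (φ : TangentSpace 𝓘(ℝ, F) p →ₗ[ℝ] TangentSpace 𝓘(ℝ, F) p) (τ : ℝ),
      IsRadicalFrame (inducedForm h f p) φ (dualForm h f p (N p)) (ξ p)
        (transversalFactor h J f p (ξ p)) ∧
      (∀ x y, inducedTwin h J f p x y = transversalFactor h J f p (ξ p) *
        dualForm h f p (N p) x * dualForm h f p (N p) y + inducedForm h f p (φ x) y) ∧
      (∀ x y z, curvatureTensor (inducedConnection h f S D) p x y z =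
        -κ (f p) • (inducedTwin h J f p y z • x - inducedTwin h J f p x z • y) +
        umbilicalDefect h J κ f ξ ρ p •
          (inducedForm h f p y z • φ x - inducedForm h f p x z • φ y)) ∧
      ∀ x y, ricciTensor (inducedConnection h f S D) p x y =
        κ (f p) * (finrank ℝ F - 1) * inducedTwin h J f p x y +
        umbilicalDefect h J κ f ξ ρ p *
          (inducedForm h f p (φ x) y - τ * inducedForm h f p x y) := by
  obtain ⟨φ, hA, hφ, hHt⟩ := A.exists_radicalFrame (hU.nullPair p hp)
  have hR := A.curvatureTensor_eq hC hU hp hφ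
  let e : Basis (Fin (finrank ℝ F)) ℝ (TangentSpace 𝓘(ℝ, F) p) := finBasis ℝ F
  refine ⟨φ, ∑ i, e.repr (φ (e i)) i, hA, hHt, hR, fun x y => ?_⟩
  have h1 := hA.ricci_eq hHt hR e x y
  rw [Fintype.card_fin] at h1
  exact h1

omit hU

/-- Semi-symmetry and Ricci semi-symmetry of the induced connection. -/
theorem tfae_semiSymmetric [FiniteDimensional ℝ F] (hκ : ∀ b, κ b ≠ 0) :
    List.TFAE [SemiSymmetric (inducedConnection h f S D),
      RicciSemiSymmetric (inducedConnection h f S D), CurvatureEqSqDiv h f S J D κ] := by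
  rw [A.curvatureEqSqDiv_iff]
  tfae_have 1 → 3 := fun H U ξ N ρ hU p hp => by
    obtain ⟨φ, τ, hA, hHt, hR, -⟩ := A.exists_radicalFrame_curvature hC hU hp
    exact hA.eq_zero_of_semiSymmetric hHt hR (hκ _) (H p)
  tfae_have 2 → 3 := fun H U ξ N ρ hU p hp => by
    obtain ⟨φ, τ, hA, hHt, hR, hRic⟩ := A.exists_radicalFrame_curvature hC hU hp
    exact hA.eq_zero_of_ricciSemiSymmetric hHt hR hRic (hκ _) (H p)
  tfae_have 3 → 1 := fun H p => by
    obtain ⟨U, ξ, N, ρ, hp, hU⟩ := A.umbilical.umbilical p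
    obtain ⟨φ, τ, hA, hHt, hR, -⟩ := A.exists_radicalFrame_curvature hC hU hp
    exact hA.semiSymmetric_of_eq_zero hHt hR (H U ξ N ρ hU p hp)
  tfae_have 3 → 2 := fun H p => by
    obtain ⟨U, ξ, N, ρ, hp, hU⟩ := A.umbilical.umbilical p
    obtain ⟨φ, τ, hA, hHt, hR, hRic⟩ := A.exists_radicalFrame_curvature hC hU hp
    exact hA.ricciSemiSymmetric_of_eq_zero hHt hR hRic (H U ξ N ρ hU p hp)
  tfae_finish

/-- For a constant sectional curvature, the Ricci tensor is a constant combination of the two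
induced forms exactly when the umbilicity factor has the critical value. -/
lemma exists_ricci_eq_iff [FiniteDimensional ℝ F] (hκ : ∃ c, ∀ b, κ b = c) :
    (∃ k c : ℝ, ∀ (p : M) (x y : TangentSpace 𝓘(ℝ, F) p),
      ricciTensor (inducedConnection h f S D) p x y =
        k * inducedMetric h f p x y + c * inducedTwin h J f p x y) ↔
    CurvatureEqSqDiv h f S J D κ := by
  rw [A.curvatureEqSqDiv_iff]
  constructor
  · rintro ⟨k, c, H⟩ U ξ N ρ hU p hp
    obtain ⟨φ, τ, hA, hHt, hR, hRic⟩ := A.exists_radicalFrame_curvature hC hU hp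
    exact hA.eq_zero_of_ricci_eq hHt hR hRic (H p)
  · intro H
    obtain ⟨c, hc⟩ := hκ
    refine ⟨0, c * (finrank ℝ F - 1), fun p x y => ?_⟩
    obtain ⟨U, ξ, N, ρ, hp, hU⟩ := A.umbilical.umbilical p
    obtain ⟨φ, τ, hA, hHt, hR, hRic⟩ := A.exists_radicalFrame_curvature hC hU hp
    rw [hRic, H U ξ N ρ hU p hp, hc]
    ring

end IsUmbilicalHypersurface

end InducedCurvature

/-! ### Local symmetry -/

section LocalSymmetry

/-- Every tangent vector is the value of a globally smooth vector field. -/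
lemma exists_smoothFieldOn_univ {F : Type*} [NormedAddCommGroup F] [NormedSpace ℝ F]
    [FiniteDimensional ℝ F] {M : Type*} [TopologicalSpace M] [T2Space M] [ChartedSpace F M]
    [IsManifold 𝓘(ℝ, F) ∞ M] {p : M} (v : TangentSpace 𝓘(ℝ, F) p) :
    ∃ X : Π p : M, TangentSpace 𝓘(ℝ, F) p, SmoothFieldOn X univ ∧ X p = v := by
  let χ : SmoothBumpFunction 𝓘(ℝ, F) p := Classical.choice inferInstance
  refine ⟨fun q => χ q • FiberBundle.extend F v q, ?_, ?_⟩
  · exact (ContMDiffOn.smul_section_of_tsupport (V := (TangentSpace 𝓘(ℝ, F) : M → Type _))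
      χ.contMDiff.contMDiffOn (chartAt F p).open_source χ.tsupport_subset_chartAt_source
      (smoothFieldOn_extend v)).contMDiffOn
  · change χ p • FiberBundle.extend F v p = v
    rw [χ.eq_one, one_smul, FiberBundle.extend_apply_self]

variable {E : Type*} [NormedAddCommGroup E] [NormedSpace ℝ E] [FiniteDimensional ℝ E]
  [CompleteSpace E]
  {B : Type*} [TopologicalSpace B] [ChartedSpace E B] [IsManifold 𝓘(ℝ, E) ∞ B]
  {F : Type*} [NormedAddCommGroup F] [NormedSpace ℝ F]
  {M : Type*} [TopologicalSpace M] [ChartedSpace F M] [IsManifold 𝓘(ℝ, F) ∞ M]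

namespace IsUmbilicalHypersurface

variable {h : Π p : B, TangentSpace 𝓘(ℝ, E) p →L[ℝ] TangentSpace 𝓘(ℝ, E) p →L[ℝ] ℝ}
  {J : Π p : B, TangentSpace 𝓘(ℝ, E) p →L[ℝ] TangentSpace 𝓘(ℝ, E) p}
  {D : CovariantDerivative 𝓘(ℝ, E) E (TangentSpace 𝓘(ℝ, E) : B → Type _)} {f : M → B}
  {S : Π p : M, Submodule ℝ (TangentSpace 𝓘(ℝ, F) p)} {p : M}
  (A : IsUmbilicalHypersurface h J D f S)
include A

variable {κ : B → ℝ} {c : ℝ} {U : Set M} {ξ : Π p : M, TangentSpace 𝓘(ℝ, F) p}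
  {N : Π p : M, TangentSpace 𝓘(ℝ, E) (f p)} {ρ : M → ℝ} (hU : IsUmbilicalOn h f S D U ξ N ρ)
  {X Y Z : Π p : M, TangentSpace 𝓘(ℝ, F) p}
include hU

/-- The induced connection is not metric: the defect is measured by the second fundamental form. -/
lemma mvfderiv_inducedMetric (hp : p ∈ U) (hX : SmoothFieldOn X U) (hY : SmoothFieldOn Y U)
    (u : TangentSpace 𝓘(ℝ, F) p) :
    mvfderiv 𝓘(ℝ, F) (fun q => inducedMetric h f q (X q) (Y q)) p u =
      inducedMetric h f p (inducedConnection h f S D X p u) (Y p) +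
      inducedMetric h f p (X p) (inducedConnection h f S D Y p u) +
      ρ p * (inducedMetric h f p u (X p) * dualForm h f p (N p) (Y p) +
        inducedMetric h f p u (Y p) * dualForm h f p (N p) (X p)) := by
  have hn := hU.isOpen.mem_nhds hp
  have hdX := (smoothAlongOn_mfderiv A.smooth hX).mDiffAlongAt hn
  have hdY := (smoothAlongOn_mfderiv A.smooth hY).mDiffAlongAt hn
  have hX' := A.mfderiv_inducedConnection_field hU hp hdX u
  have hY' := A.mfderiv_inducedConnection_field hU hp hdY u
  refine ((A.kaehler.hasDeriv_apply_apply hdX hdY).2 u).trans ?_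
  have e : ∀ x : TangentSpace 𝓘(ℝ, F) p,
      h (f p) (mfderiv 𝓘(ℝ, F) 𝓘(ℝ, E) f p x) (N p) = dualForm h f p (N p) x := fun _ => rfl
  rw [inducedMetric, inducedMetric, hX', hY']
  simp only [map_sub, sub_apply, map_smul, smul_apply, smul_eq_mul,
    A.kaehler.symm (f p) (N p), e]
  ring

/-- The second Norden metric, in contrast, is parallel for the induced connection. -/
lemma mvfderiv_inducedTwin (hp : p ∈ U) (hX : SmoothFieldOn X U) (hY : SmoothFieldOn Y U)
    (u : TangentSpace 𝓘(ℝ, F) p) :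
    MDiffAt (fun q => inducedTwin h J f q (X q) (Y q)) p ∧
    mvfderiv 𝓘(ℝ, F) (fun q => inducedTwin h J f q (X q) (Y q)) p u =
      inducedTwin h J f p (inducedConnection h f S D X p u) (Y p) +
      inducedTwin h J f p (X p) (inducedConnection h f S D Y p u) := by
  have hn := hU.isOpen.mem_nhds hp
  have hN := hU.nullPair p hp
  have hdX := (smoothAlongOn_mfderiv A.smooth hX).mDiffAlongAt hn
  have hdY := (smoothAlongOn_mfderiv A.smooth hY).mDiffAlongAt hn
  have hX' := A.mfderiv_inducedConnection_field hU hp hdX u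
  have hY' := A.mfderiv_inducedConnection_field hU hp hdY u
  have h1 := A.kaehler.hasDeriv_apply_apply (A.kaehler.mDiffAlongAt_J hdX) hdY
  refine ⟨h1.1, (h1.2 u).trans ?_⟩
  have e : ∀ x : TangentSpace 𝓘(ℝ, F) p,
      h (f p) (J (f p) (mfderiv 𝓘(ℝ, F) 𝓘(ℝ, E) f p x)) (N p) = 0 := fun x => by
    rw [A.J_apply_symm hN, A.kaehler.symm, A.apply_J_N hN]
  rw [A.kaehler.covAlong_J hdX, inducedTwin, inducedTwin, hX', hY']
  simp only [map_sub, sub_apply, map_smul, smul_apply, smul_eq_mul, A.apply_J_N hN, e]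
  ring

variable [CompleteSpace F] {ν : B → ℝ} (hC : HasCurvatureForm h J D ν κ) (hc : ∀ b, κ b = c)
include hC hc

lemma mfderiv_curvatureTensor (hp : p ∈ U) (x y z : TangentSpace 𝓘(ℝ, F) p) :
    mfderiv 𝓘(ℝ, F) 𝓘(ℝ, E) f p (curvatureTensor (inducedConnection h f S D) p x y z) =
      (umbilicalDefect h J κ f ξ ρ p * inducedMetric h f p y z) •
        (J (f p) (mfderiv 𝓘(ℝ, F) 𝓘(ℝ, E) f p x) -
          (transversalFactor h J f p (ξ p) *
            h (f p) (mfderiv 𝓘(ℝ, F) 𝓘(ℝ, E) f p x) (N p)) • N p) -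
      (umbilicalDefect h J κ f ξ ρ p * inducedMetric h f p x z) •
        (J (f p) (mfderiv 𝓘(ℝ, F) 𝓘(ℝ, E) f p y) -
          (transversalFactor h J f p (ξ p) *
            h (f p) (mfderiv 𝓘(ℝ, F) 𝓘(ℝ, E) f p y) (N p)) • N p) -
      c • (inducedTwin h J f p y z • mfderiv 𝓘(ℝ, F) 𝓘(ℝ, E) f p x -
        inducedTwin h J f p x z • mfderiv 𝓘(ℝ, F) 𝓘(ℝ, E) f p y) := by
  obtain ⟨φ, hA, hφ, -⟩ := A.exists_radicalFrame (hU.nullPair p hp)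
  have hη : ∀ x : TangentSpace 𝓘(ℝ, F) p,
      h (f p) (mfderiv 𝓘(ℝ, F) 𝓘(ℝ, E) f p x) (N p) = dualForm h f p (N p) x := fun _ => rfl
  have hH' : ∀ x y, inducedMetric (F := F) h f p x y = inducedForm h f p x y := fun _ _ => rfl
  rw [A.curvatureTensor_eq hC hU hp hφ, hc]
  simp only [map_add, map_sub, map_smul, hη, ← hφ, hH']
  module

lemma contMDiffOn_umbilicalDefect :
    ContMDiffOn 𝓘(ℝ, F) 𝓘(ℝ, ℝ) ∞ (umbilicalDefect h J κ f ξ ρ) U := by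
  have h1 : ContMDiffOn 𝓘(ℝ, F) 𝓘(ℝ, ℝ) ∞
      (fun q => ρ q ^ 2 / transversalFactor h J f q (ξ q) - c) U :=
    ((hU.smooth_rho.pow 2).div₀ (A.contMDiffOn_transversalFactor hU)
      fun q hq => A.transversalFactor_ne_zero (hU.nullPair q hq)).sub contMDiffOn_const
  exact h1.congr fun q _ => by rw [umbilicalDefect, hc]

/-- The covariant derivative of the curvature tensor at a point where the coefficients of `φX` and
`φY` in `R(X,Y)Z` vanish. -/
lemma nabla_curvature (hp : p ∈ U) (hX : SmoothFieldOn X U) (hY : SmoothFieldOn Y U)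
    (hZ : SmoothFieldOn Z U) {φ : TangentSpace 𝓘(ℝ, F) p →ₗ[ℝ] TangentSpace 𝓘(ℝ, F) p}
    (hφ : ∀ x, mfderiv 𝓘(ℝ, F) 𝓘(ℝ, E) f p (φ x) = J (f p) (mfderiv 𝓘(ℝ, F) 𝓘(ℝ, E) f p x) -
      (transversalFactor h J f p (ξ p) * dualForm h f p (N p) x) • N p)
    {s₁ s₂ : M → ℝ}
    (hs₁ : s₁ = fun q => umbilicalDefect h J κ f ξ ρ q * inducedMetric h f q (Y q) (Z q))
    (hs₂ : s₂ = fun q => umbilicalDefect h J κ f ξ ρ q * inducedMetric h f q (X q) (Z q))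
    (h₁ : s₁ p = 0) (h₂ : s₂ p = 0) (u : TangentSpace 𝓘(ℝ, F) p) :
    inducedConnection h f S D (fun q => curvatureTensor (inducedConnection h f S D) q
        (X q) (Y q) (Z q)) p u
      - curvatureTensor (inducedConnection h f S D) p (inducedConnection h f S D X p u) (Y p) (Z p)
      - curvatureTensor (inducedConnection h f S D) p (X p) (inducedConnection h f S D Y p u) (Z p)
      - curvatureTensor (inducedConnection h f S D) p (X p) (Y p)
        (inducedConnection h f S D Z p u) =
    (mvfderiv 𝓘(ℝ, F) s₁ p u - umbilicalDefect h J κ f ξ ρ p *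
      (inducedMetric h f p (inducedConnection h f S D Y p u) (Z p) +
        inducedMetric h f p (Y p) (inducedConnection h f S D Z p u))) • φ (X p) -
    (mvfderiv 𝓘(ℝ, F) s₂ p u - umbilicalDefect h J κ f ξ ρ p *
      (inducedMetric h f p (inducedConnection h f S D X p u) (Z p) +
        inducedMetric h f p (X p) (inducedConnection h f S D Z p u))) • φ (Y p) := by
  have hn := hU.isOpen.mem_nhds hp
  have hN := hU.nullPair p hp
  have sdX := smoothAlongOn_mfderiv A.smooth hX
  have sdY := smoothAlongOn_mfderiv A.smooth hY
  have hdX := sdX.mDiffAlongAt hn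
  have hdY := sdY.mDiffAlongAt hn
  have hX' := A.mfderiv_inducedConnection_field hU hp hdX u
  have hY' := A.mfderiv_inducedConnection_field hU hp hdY u
  have hNp := hU.smooth_N.mDiffAlongAt hn
  have hb : MDiffAt (fun q => transversalFactor h J f q (ξ q)) p :=
    ((A.contMDiffOn_transversalFactor hU).contMDiffAt hn).mdifferentiableAt (by simp)
  have hμ : MDiffAt (umbilicalDefect h J κ f ξ ρ) p :=
    ((A.contMDiffOn_umbilicalDefect hU hC hc).contMDiffAt hn).mdifferentiableAt (by simp)
  have hH : ∀ {X Y : Π p : M, TangentSpace 𝓘(ℝ, F) p}, SmoothFieldOn X U → SmoothFieldOn Y U →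
      MDiffAt (fun q => inducedMetric h f q (X q) (Y q)) p := fun hX hY =>
    ((A.contMDiffOn_inducedMetric hU hX hY).contMDiffAt hn).mdifferentiableAt (by simp)
  have hs₁' : MDiffAt s₁ p := hs₁ ▸ hμ.mul (hH hY hZ)
  have hs₂' : MDiffAt s₂ p := hs₂ ▸ hμ.mul (hH hX hZ)
  obtain ⟨ht₁, ht₁'⟩ := A.mvfderiv_inducedTwin hU hp hY hZ u
  obtain ⟨ht₂, ht₂'⟩ := A.mvfderiv_inducedTwin hU hp hX hZ u
  have hQ : ∀ {X : Π p : M, TangentSpace 𝓘(ℝ, F) p},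
      MDiffAlongAt (F := F) f (fun q => mfderiv 𝓘(ℝ, F) 𝓘(ℝ, E) f q (X q)) p →
      MDiffAlongAt (F := F) f (fun q => J (f q) (mfderiv 𝓘(ℝ, F) 𝓘(ℝ, E) f q (X q)) -
        (transversalFactor h J f q (ξ q) *
          h (f q) (mfderiv 𝓘(ℝ, F) 𝓘(ℝ, E) f q (X q)) (N q)) • N q) p := fun hX =>
    (A.kaehler.mDiffAlongAt_J hX).sub
      (hNp.smul (hb.mul (A.kaehler.hasDeriv_apply_apply hX hNp).1))
  have hW := covAlong_congr (D := D) A.smooth.continuous.continuousAt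
    (Filter.eventually_of_mem hn fun q hq =>
      (A.mfderiv_curvatureTensor hU hC hc hq (X q) (Y q) (Z q)).trans (congrArg₂ (fun a b =>
        a • (J (f q) (mfderiv 𝓘(ℝ, F) 𝓘(ℝ, E) f q (X q)) -
          (transversalFactor h J f q (ξ q) *
            h (f q) (mfderiv 𝓘(ℝ, F) 𝓘(ℝ, E) f q (X q)) (N q)) • N q) -
        b • (J (f q) (mfderiv 𝓘(ℝ, F) 𝓘(ℝ, E) f q (Y q)) -
          (transversalFactor h J f q (ξ q) *
            h (f q) (mfderiv 𝓘(ℝ, F) 𝓘(ℝ, E) f q (Y q)) (N q)) • N q) -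
        c • (inducedTwin h J f q (Y q) (Z q) • mfderiv 𝓘(ℝ, F) 𝓘(ℝ, E) f q (X q) -
          inducedTwin h J f q (X q) (Z q) • mfderiv 𝓘(ℝ, F) 𝓘(ℝ, E) f q (Y q)))
        (congrFun hs₁ q).symm (congrFun hs₂ q).symm)) u
  have hL : MDiffAlongAt (F := F) f (fun q => inducedTwin h J f q (Y q) (Z q) •
      mfderiv 𝓘(ℝ, F) 𝓘(ℝ, E) f q (X q) - inducedTwin h J f q (X q) (Z q) •
      mfderiv 𝓘(ℝ, F) 𝓘(ℝ, E) f q (Y q)) p := (hdX.smul ht₁).sub (hdY.smul ht₂)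
  have hcc : MDiffAt (fun _ : M => c) p := mdifferentiableAt_const
  rw [covAlong_sub (((hQ hdX).smul hs₁').sub ((hQ hdY).smul hs₂')) (hL.smul hcc),
    covAlong_sub ((hQ hdX).smul hs₁') ((hQ hdY).smul hs₂'), covAlong_smul hcc hL,
    covAlong_smul hs₁' (hQ hdX), covAlong_smul hs₂' (hQ hdY),
    covAlong_sub (hdX.smul ht₁) (hdY.smul ht₂), covAlong_smul ht₁ hdX, covAlong_smul ht₂ hdY,
    h₁, h₂, ht₁', ht₂', mvfderiv_const, zero_apply] at hW
  let W := fun q => curvatureTensor (inducedConnection h f S D) q (X q) (Y q) (Z q)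
  change inducedConnection h f S D W p u - _ - _ - _ = _
  have hdW := A.mfderiv_inducedConnection hN W u
  have hR := A.mfderiv_curvatureTensor hU hC hc hp
  have hη : ∀ x : TangentSpace 𝓘(ℝ, F) p,
      h (f p) (mfderiv 𝓘(ℝ, F) 𝓘(ℝ, E) f p x) (N p) = dualForm h f p (N p) x := fun _ => rfl
  have hZ0 : umbilicalDefect h J κ f ξ ρ p * inducedMetric h f p (Y p) (Z p) = 0 := by
    rw [← h₁, hs₁]
  have hZ1 : umbilicalDefect h J κ f ξ ρ p * inducedMetric h f p (X p) (Z p) = 0 := by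
    rw [← h₂, hs₂]
  simp only [hη, ← hφ] at hR hW
  -- both sides are tangent, so that they agree as soon as they agree up to a multiple of `N`
  have hcancel : ∀ {a b : TangentSpace 𝓘(ℝ, F) p} {r : ℝ}, mfderiv 𝓘(ℝ, F) 𝓘(ℝ, E) f p a =
      mfderiv 𝓘(ℝ, F) 𝓘(ℝ, E) f p b + r • N p → a = b := fun {a b r} hab => by
    have h3 := congrArg (fun w => h (f p) w (mfderiv 𝓘(ℝ, F) 𝓘(ℝ, E) f p (ξ p))) hab
    simp only [map_add, add_apply, map_smul, smul_apply, hN.pairing, smul_eq_mul,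
      A.kaehler.symm (f p) (mfderiv 𝓘(ℝ, F) 𝓘(ℝ, E) f p _) (mfderiv 𝓘(ℝ, F) 𝓘(ℝ, E) f p (ξ p)),
      A.apply_xi hN] at h3
    have hr : r = 0 := by linarith
    exact A.immersion.injective p (by rw [hab, hr, zero_smul, add_zero])
  replace hW : covAlong D f (fun q => mfderiv 𝓘(ℝ, F) 𝓘(ℝ, E) f q (W q)) p u = _ := hW
  set r₀ := h (f p) (covAlong D f (fun q => mfderiv 𝓘(ℝ, F) 𝓘(ℝ, E) f q (W q)) p u)
    (mfderiv 𝓘(ℝ, F) 𝓘(ℝ, E) f p (ξ p))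
  have hX'' := eq_add_of_sub_eq hX'.symm
  have hY'' := eq_add_of_sub_eq hY'.symm
  refine hcancel (r := -r₀ - c *
    (inducedTwin h J f p (Y p) (Z p) * (ρ p * inducedMetric h f p u (X p)) -
      inducedTwin h J f p (X p) (Z p) * (ρ p * inducedMetric h f p u (Y p)))) ?_
  simp only [map_sub, map_smul, hdW, hR, hW, hX'', hY'', hZ0, hZ1]
  module

omit hU

/-- For a constant sectional curvature, the induced connection is locally symmetric exactly when the
umbilicity factor has the critical value. If the defect is non-zero at a point, then it is non-zero
nearby, where local symmetry forces `ρ = 0`; then also the radial derivative of `ρ` vanishes, which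
contradicts `curvature_constants`. -/
lemma locallySymmetric_iff [FiniteDimensional ℝ F] [T2Space M] (hc0 : c ≠ 0) :
    LocallySymmetric (inducedConnection h f S D) ↔ CurvatureEqSqDiv h f S J D κ := by
  rw [A.curvatureEqSqDiv_iff]
  constructor
  · intro H U ξ N ρ hU p hp
    have hμ := A.contMDiffOn_umbilicalDefect hU hC hc
    -- at a point where the defect does not vanish, the hypersurface is totally geodesic
    have key : ∀ q ∈ U, umbilicalDefect h J κ f ξ ρ q ≠ 0 → ρ q = 0 := by
      intro q hq hμq
      have hn := hU.isOpen.mem_nhds hq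
      obtain ⟨φ, hA, hφ, -⟩ := A.exists_radicalFrame (hU.nullPair q hq)
      have h0 : umbilicalDefect h J κ f ξ ρ q * ρ q = 0 :=
        hA.eq_zero_of_screen_products fun v w hv hw => by
        -- `∇_W R` is evaluated on `X = φ v`, `Y = v` and `Z = ξ`: then the coefficients of `φX` and
        -- `φY` vanish at `q`, and their derivatives come from the defect of metricity only
        obtain ⟨W, sW, hW⟩ := exists_smoothFieldOn_univ w
        obtain ⟨X, sX, hX⟩ := exists_smoothFieldOn_univ (φ v)
        obtain ⟨Y, sY, hY⟩ := exists_smoothFieldOn_univ v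
        obtain ⟨Z, sZ, hZ⟩ := exists_smoothFieldOn_univ (ξ q)
        have uX := sX.mono (subset_univ U)
        have uY := sY.mono (subset_univ U)
        have uZ := sZ.mono (subset_univ U)
        have hH : ∀ x y, inducedMetric (F := F) h f q x y = inducedForm h f q x y := fun _ _ => rfl
        have hz : ∀ x, inducedMetric (F := F) h f q x (ξ q) = 0 := fun x => by
          rw [hH, hA.symm, hA.radical]
        have hd : ∀ {Y : Π p : M, TangentSpace 𝓘(ℝ, F) p}, SmoothFieldOn Y U →
            mvfderiv 𝓘(ℝ, F) (fun p => umbilicalDefect h J κ f ξ ρ p *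
              inducedMetric h f p (Y p) (Z p)) q w = umbilicalDefect h J κ f ξ ρ q *
            mvfderiv 𝓘(ℝ, F) (fun p => inducedMetric h f p (Y p) (Z p)) q w := fun {Y} uY => by
          rw [mvfderiv_fun_mul ((hμ.contMDiffAt hn).mdifferentiableAt (by simp))
            (((A.contMDiffOn_inducedMetric hU uY uZ).contMDiffAt hn).mdifferentiableAt (by simp))]
          simp [hZ, hz]
        have h1 := H W X Y Z sW sX sY sZ q
        rw [A.nabla_curvature hU hC hc hq uX uY uZ hφ rfl rfl (by rw [hZ, hz, mul_zero])
          (by rw [hZ, hz, mul_zero]), hW, hd uX, hd uY, A.mvfderiv_inducedMetric hU hq uX uZ,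
          A.mvfderiv_inducedMetric hU hq uY uZ, hX, hY, hZ, hA.eta_xi, hz, hA.phi_sq, hv] at h1
        simp only [hH, hA.symm w, hA.eta_phi] at h1
        rw [← neg_eq_zero, ← h1]
        module
      exact (mul_eq_zero.1 h0).resolve_left hμq
    by_contra hne
    have hev : ∀ᶠ q in 𝓝 p, umbilicalDefect h J κ f ξ ρ q ≠ 0 :=
      (hμ.contMDiffAt (hU.isOpen.mem_nhds hp)).continuousAt.eventually_ne hne
    have hρ : ρ =ᶠ[𝓝 p] fun _ => 0 := by
      filter_upwards [hev, hU.isOpen.mem_nhds hp] with q hq hqU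
      exact key q hqU hq
    have h1 := (A.curvature_constants hC hU hp).2
    rw [mvfderiv_congr hρ, mvfderiv_const, hρ.eq_of_nhds, hc, zero_apply, zero_mul, sub_zero] at h1
    exact mul_ne_zero (neg_ne_zero.2 hc0) (A.transversalFactor_ne_zero (hU.nullPair p hp)) h1.symm
  · intro H W X Y Z sW sX sY sZ p
    obtain ⟨U, ξ, N, ρ, hp, hU⟩ := A.umbilical.umbilical p
    have hμ : ∀ q ∈ U, umbilicalDefect h J κ f ξ ρ q = 0 := H U ξ N ρ hU
    obtain ⟨φ, hA, hφ, -⟩ := A.exists_radicalFrame (hU.nullPair p hp)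
    have hd : ∀ a : M → ℝ,
        mvfderiv 𝓘(ℝ, F) (fun q => umbilicalDefect h J κ f ξ ρ q * a q) p (W p) = 0 := fun a => by
      have h1 : (fun q => umbilicalDefect h J κ f ξ ρ q * a q) =ᶠ[𝓝 p] fun _ => 0 :=
        Filter.eventually_of_mem (hU.isOpen.mem_nhds hp) fun q hq =>
          (congrArg (· * a q) (hμ q hq)).trans (zero_mul _)
      rw [mvfderiv_congr h1, mvfderiv_const, zero_apply]
    rw [A.nabla_curvature hU hC hc hp (sX.mono (subset_univ U)) (sY.mono (subset_univ U))
      (sZ.mono (subset_univ U)) hφ rfl rfl (by rw [hμ p hp, zero_mul])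
      (by rw [hμ p hp, zero_mul]), hd, hd, hμ p hp]
    simp

end IsUmbilicalHypersurface

end LocalSymmetry

/-! ### The equivalences -/

section Theorem

variable {E : Type*} [NormedAddCommGroup E] [NormedSpace ℝ E] [FiniteDimensional ℝ E]
  [CompleteSpace E]
  {B : Type*} [TopologicalSpace B] [ChartedSpace E B] [IsManifold 𝓘(ℝ, E) ∞ B]
  {F : Type*} [NormedAddCommGroup F] [NormedSpace ℝ F] [FiniteDimensional ℝ F]
  {M : Type*} [TopologicalSpace M] [T2Space M] [ChartedSpace F M] [IsManifold 𝓘(ℝ, F) ∞ M]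
  {h : Π p : B, TangentSpace 𝓘(ℝ, E) p →L[ℝ] TangentSpace 𝓘(ℝ, E) p →L[ℝ] ℝ}
  {J : Π p : B, TangentSpace 𝓘(ℝ, E) p →L[ℝ] TangentSpace 𝓘(ℝ, E) p}
  {D : CovariantDerivative 𝓘(ℝ, E) E (TangentSpace 𝓘(ℝ, E) : B → Type _)} {f : M → B}
  {S : Π p : M, Submodule ℝ (TangentSpace 𝓘(ℝ, F) p)} {ν κ : B → ℝ}

/-- The equivalences for either of the two Norden metrics; `P` stands for the almost Einstein
condition. -/
theorem IsUmbilicalHypersurface.tfae_symmetric (A : IsUmbilicalHypersurface h J D f S)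
    (hC : HasCurvatureForm h J D ν κ) (hκ : ∀ q, κ q ≠ 0) {P : Prop}
    (hP : P ↔ ∃ k c : ℝ, ∀ (p : M) (x y : TangentSpace 𝓘(ℝ, F) p),
      ricciTensor (inducedConnection h f S D) p x y =
        k * inducedMetric h f p x y + c * inducedTwin h J f p x y) :
    List.TFAE [SemiSymmetric (inducedConnection h f S D),
        RicciSemiSymmetric (inducedConnection h f S D), CurvatureEqSqDiv h f S J D κ] ∧
      ((∃ c, ∀ q, κ q = c) →
        List.TFAE [SemiSymmetric (inducedConnection h f S D),
          RicciSemiSymmetric (inducedConnection h f S D), CurvatureEqSqDiv h f S J D κ,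
          LocallySymmetric (inducedConnection h f S D), P]) := by
  have _ : CompleteSpace F := FiniteDimensional.complete ℝ F
  have h1 := A.tfae_semiSymmetric hC hκ
  refine ⟨h1, fun hc => ?_⟩
  have h2 := A.exists_ricci_eq_iff hC hc
  obtain ⟨c, hc⟩ := hc
  tfae_have 1 ↔ 2 := h1.out 0 1
  tfae_have 1 ↔ 3 := h1.out 0 2
  tfae_have 5 ↔ 3 := hP.trans h2
  tfae_have 4 ↔ 3 := by
    constructor
    · intro H
      rcases isEmpty_or_nonempty M with hM | ⟨⟨p⟩⟩
      · exact fun _ _ _ _ _ _ _ p => hM.elim p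
      · exact (A.locallySymmetric_iff hC hc (hc (f p) ▸ hκ (f p))).1 H
    · intro H U X Y Z hU hX hY hZ p
      exact (A.locallySymmetric_iff hC hc (hc (f p) ▸ hκ (f p))).2 H U X Y Z hU hX hY hZ p
  tfae_finish

end Theorem

end

theorem theorem1p1
    {E : Type*} [NormedAddCommGroup E] [NormedSpace ℝ E] [FiniteDimensional ℝ E] [CompleteSpace E]
    {F : Type*} [NormedAddCommGroup F] [NormedSpace ℝ F] [FiniteDimensional ℝ F]
    (n : ℕ) (hn : 2 ≤ n) (hE : Module.finrank ℝ E = 2 * n) (hF : Module.finrank ℝ F + 1 = 2 * n)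
    -- the ambient Kähler-Norden manifold, of dimension `2n`
    {B : Type*} [TopologicalSpace B] [T2Space B] [ChartedSpace E B] [IsManifold 𝓘(ℝ, E) ∞ B]
    (K : KaehlerNorden E B) (ν νt : B → ℝ) (hν : K.HasConstantTotallyRealCurvatures ν νt)
    -- the hypersurface, immersed by `f`, with a distribution `S`
    {M : Type*} [TopologicalSpace M] [T2Space M] [ChartedSpace F M] [IsManifold 𝓘(ℝ, F) ∞ M]
    (f : M → B) (hf : IsSmoothImmersion F E f)
    (S : Π p : M, Submodule ℝ (TangentSpace 𝓘(ℝ, F) p)) :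
    -- the hypersurface `(M, g)`
    (IsUmbilicalRadicalTransversal K.g f S K.J K.nabla → (∀ q, νt q ≠ 0) →
      List.TFAE [SemiSymmetric (inducedConnection K.g f S K.nabla),
          RicciSemiSymmetric (inducedConnection K.g f S K.nabla),
        CurvatureEqSqDiv K.g f S K.J K.nabla νt] ∧
      ((∃ c, ∀ q, νt q = c) →
        List.TFAE [SemiSymmetric (inducedConnection K.g f S K.nabla),
          RicciSemiSymmetric (inducedConnection K.g f S K.nabla),
          CurvatureEqSqDiv K.g f S K.J K.nabla νt,
          LocallySymmetric (inducedConnection K.g f S K.nabla),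
          AlmostEinstein f K (inducedConnection K.g f S K.nabla)])) ∧
    -- the hypersurface with the metric induced by the associated Norden metric
    (IsUmbilicalRadicalTransversal K.assoc f S K.J K.nabla → (∀ q, ν q ≠ 0) →
      List.TFAE [SemiSymmetric (inducedConnection K.assoc f S K.nabla),
          RicciSemiSymmetric (inducedConnection K.assoc f S K.nabla),
        CurvatureEqSqDiv K.assoc f S K.J K.nabla ν] ∧
      ((∃ c, ∀ q, ν q = c) →
        List.TFAE [SemiSymmetric (inducedConnection K.assoc f S K.nabla),
          RicciSemiSymmetric (inducedConnection K.assoc f S K.nabla),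
          CurvatureEqSqDiv K.assoc f S K.J K.nabla ν,
          LocallySymmetric (inducedConnection K.assoc f S K.nabla),
          AlmostEinstein f K (inducedConnection K.assoc f S K.nabla)])) := by
  refine ⟨fun hu hκ => ?_, fun hu hκ => ?_⟩
  · have A : IsUmbilicalHypersurface K.g K.J K.nabla f S :=
      ⟨K.isKaehlerNorden, hf, hF.trans hE.symm, by omega, hu⟩
    exact A.tfae_symmetric (hν.hasCurvatureForm K) hκ Iff.rfl
  · have A : IsUmbilicalHypersurface K.assoc K.J K.nabla f S :=
      ⟨K.isKaehlerNorden_assoc, hf, hF.trans hE.symm, by omega, hu⟩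
    -- the second form belonging to `K.assoc` is `g(J²x, y) = -g(x, y)`
    have hT : ∀ (p : M) (x y : TangentSpace 𝓘(ℝ, F) p),
        inducedTwin K.assoc K.J f p x y = -inducedMetric K.g f p x y := fun p x y => by
      change K.g (f p) (K.J (f p) (K.J (f p) _)) _ = -K.g (f p) _ _
      rw [K.J_sq, map_neg, neg_apply]
    refine A.tfae_symmetric (hν.hasCurvatureForm_assoc K) hκ ⟨?_, ?_⟩
    · rintro ⟨k, c, H⟩
      exact ⟨c, -k, fun p x y => by rw [H, hT]; ring⟩
    · rintro ⟨k, c, H⟩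
      exact ⟨-c, k, fun p x y => by rw [H, hT]; ring⟩
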